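/- **Setting.** Let $m\ge 0$ and $0\le k\le j\le\infty$. Let $D^m\subset\mathbb R^m$ be the open unit ball; the antiball is $\mathbb R^m\setminus\overline{D^m}$. A *standard embedding* between disjoint unions of open subsets (pieces) of $\mathbb R^m$ is an injective map which carries each piece into a single piece by a map of the form $x\mapsto rx+c$ with $r>0$, $c\in\mathbb R^m$. Everything below is discrete (spaces of standard embeddings are regarded as sets), which is indicated by ${}^\delta$. * ${}^\delta B_m$ is the operad of sets ${}^\delta B_m(A)={}^\delta\mathrm{sEmb}(A\times D^m,D^m)$, $A$ finite (little balls). * ${}^\delta\mathcal F_k(B_m)$ is the category of finite sets $A$ with $|A|\le k$, the morphisms $A\to B$ being the standard embeddings $A\times D^m\to B\times D^m$. ${}^\delta\widetilde\Gamma_k(B_m)$ is the category of finite sets $A$ with $|A|\le k$, the morphisms $A\to B$ being the standard embeddings $(A\times D^m)\amalg(\mathbb R^m\setminus\overline{D^m})\to(B\times D^m)\amalg(\mathbb R^m\setminus\overline{D^m})$. * For $M\subseteq\mathbb R^m$ open, ${}^\delta\mathcal O^s_k(M)$ is the poset (under inclusion) of images of standard embeddings $A\times D^m\to M$ with $|A|\le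 k$; ${}^\delta\widetilde{\mathcal O}{}^s_k(\mathbb R^m)$ is the poset of images of standard embeddings $(A\times D^m)\amalg(\mathbb R^m\setminus\overline{D^m})\to\mathbb R^m$ with $|A|\le k$. In the *absolute case* let $M\subseteq\mathbb R^m$ be any open subset, $\mathcal O_\bullet={}^\delta\mathcal O^s_\bullet(M)$ and $\mathcal C_\bullet={}^\delta\mathcal F_\bullet(B_m)$; in the *compactly supported case* let $M=\mathbb R^m$, $\mathcal O_\bullet={}^\delta\widetilde{\mathcal O}{}^s_\bullet(\mathbb R^m)$ and $\mathcal C_\bullet={}^\delta\widetilde\Gamma_\bullet(B_m)$. In both cases ${}^\delta\mathrm{sEmb}(-,M)$ is the contravariant set-valued functor on $\mathcal C_\bullet$ of standard embeddings into $M$ (of $A\times D^m$, resp. of $(A\times D^m)\amalg(\mathbb R^m\setminus\overline{D^m})$). The category $\mathcal C_j\ltimes{}^\delta\mathrm{sEmb}(-,M)$ has as objects the pairs $(A,f)$ with $A\in\mathcal C_j$ and $f$ in the value of ${}^\delta\mathrm{sEmb}(-,M)$ at $A$; a morphism $(A,f)\to(A',f')$ is a morphism $\alpha\colon A\to A'$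 with $f'\circ\alpha=f$. It has the functor $\mathrm{ev}\colon(A,f)\mapsto\mathrm{image}(f)$ to $\mathcal O_j$ and the projection $p$ to $\mathcal C_j$. Let $\mathcal D$ be a (closed) model category with small coproducts and functorial factorizations of morphisms into a cofibration followed by a trivial fibration. A *context-free functor* is a contravariant functor $F\colon\mathcal O_j\to\mathcal D$ together with a contravariant functor $F'\colon\mathcal C_j\to\mathcal D$ and a natural equivalence between $F\circ\mathrm{ev}$ and $F'\circ p$, that is, an isomorphism in the localization of the category of diagrams at the objectwise weak equivalences. Morphisms of context-free functors are pairs of natural transformations compatible with the equivalences. In the notation one does not distinguish $F$ from $F'$. A *$k$-truncated right module* (resp. *weak bimodule*) over ${}^\delta B_m$ in $\mathcal D$ consists of objects $N(A)$ for $|A|\le k$, functorial in bijections, with structure maps $N(A)\otimes{}^\delta B_m(B)\to N(A\cup_aB)$ (and, in the weak bimodule case, also ${}^\delta B_m(A)\otimes N(B)\to N(A\cup_aB)$), where $A\cup_aB=(A\setminus\{a\})\amalg B$, subject to the equivariance, associativity, commutativity and unit axioms, as far as all the sets that occur have at most $k$ elements. Here $N\otimes X=\coprod_XN$ for a set $X$.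 *Derived objects.* Functor and module categories carry the objectwise weak equivalences, and $\mathrm{Ho}$ denotes localization at the weak equivalences. * $T_kF(M):=\operatorname{holim}_{U\in\mathcal O_k}F(U)$ is the homotopy limit, i.e. the object of $\mathrm{Ho}(\mathcal D)$ characterized by natural bijections $\mathrm{Ho}(\mathcal D)(d,T_kF(M))\cong\mathrm{Ho}(\mathcal D^{\mathcal O_k^{op}})(\mathrm{const}\,d,F|_{\mathcal O_k})$. * For an object $X$ of a category of set-valued contravariant functors or modules and an object $G$ of the corresponding category $\mathcal E$ of $\mathcal D$-valued ones, the derived object of maps from $X$ to $G$ is the object $N$ of $\mathrm{Ho}(\mathcal D)$ characterized by natural bijections $\mathrm{Ho}(\mathcal D)(d,N)\cong\mathrm{Ho}(\mathcal E)(X\otimes d,G)$ for cofibrant $d$, where $(X\otimes d)(A)=\coprod_{X(A)}d$. It is denoted $\mathrm{hNat}_{\mathcal C_k}$ for functors on $\mathcal C_k$, and $\mathrm{hRmod}_{\le k}$, resp. $\mathrm{hWBimod}_{\le k}$, for $k$-truncated right modules, resp. weak bimodules, over ${}^\delta B_m$. **Theorem.** 1. The canonical functors from contravariant $\mathcal D$-valued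 functors on ${}^\delta\mathcal F_j(B_m)$ to $j$-truncated right modules over ${}^\delta B_m$, and from contravariant $\mathcal D$-valued functors on ${}^\delta\widetilde\Gamma_j(B_m)$ to $j$-truncated weak bimodules over ${}^\delta B_m$, are equivalences of categories. So a context-free functor can be thought of as a right module over ${}^\delta B_m$, resp. as a weak bimodule. 2. For context-free functors $F$ on ${}^\delta\mathcal O^s_j(M)$ there are equivalences, natural in $F$, $$T_kF(M)=\operatorname{holim}_{{}^\delta\mathcal O^s_k(M)}F\;\simeq\;\mathrm{hNat}_{{}^\delta\mathcal F_k(B_m)}\bigl({}^\delta\mathrm{sEmb}(-,M),F\bigr)\;\simeq\;\mathrm{hRmod}_{\le k}\bigl({}^\delta\mathrm{sEmb}(-,M),F\bigr).$$ 3. For context-free functors $F$ on ${}^\delta\widetilde{\mathcal O}{}^s_j(\mathbb R^m)$ there are equivalences, natural in $F$, $$T_kF(\mathbb R^m)=\operatorname{holim}_{{}^\delta\widetilde{\mathcal O}{}^s_k(\mathbb R^m)}F\;\simeq\;\mathrm{hNat}_{{}^\delta\widetilde\Gamma_k(B_m)}\bigl({}^\delta\mathrm{sEmb}(-,\mathbb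 R^m),F\bigr)\;\simeq\;\mathrm{hWBimod}_{\le k}\bigl({}^\delta\mathrm{sEmb}(-,\mathbb R^m),F\bigr).$$ The equivalences in 2 and 3 are meant in the following sense. There are bijections, natural in $F$ and in cofibrant $d\in\mathcal D$, between $\mathrm{Ho}(\mathcal D^{\mathcal O_k^{op}})(\mathrm{const}\,d,F)$ and $\mathrm{Ho}(\mathcal E)({}^\delta\mathrm{sEmb}(-,M)\otimes d,F)$, both for $\mathcal E$ the category of contravariant functors on $\mathcal C_k$ and for $\mathcal E$ the category of $k$-truncated modules. A functor from context-free functors to $\mathrm{Ho}(\mathcal D)$ is a homotopy limit $F\mapsto T_kF(M)$ if and only if it is a derived object $\mathrm{hNat}$, and if and only if it is a derived object $\mathrm{hRmod}_{\le k}$ (resp. $\mathrm{hWBimod}_{\le k}$). Any two functors with these respective properties are naturally isomorphic. -/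

import Mathlib

open CategoryTheory Limits HomotopicalAlgebra

universe v u

namespace EmbCalc

section Insertion

/-- `A ∪ₐ B = (A ∖ {a}) ⨿ B`. -/
abbrev Ins (A : Type) (a : A) (B : Type) : Type := {x : A // x ≠ a} ⊕ B

namespace Ins

/-- Functoriality of `A ∪ₐ B` in isomorphisms of `(A, a)` and of `B`. -/
def congr {A A' B B' : Type} (e : A ≃ A') (a : A) (e' : B ≃ B') :
    Ins A a B ≃ Ins A' (e a) B' where
  toFun
    | .inl x => .inl ⟨e x.1, fun h => x.2 (e.injective h)⟩
    | .inr b => .inr (e' b)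
  invFun
    | .inl x => .inl ⟨e.symm x.1, fun h => x.2 ((Equiv.symm_apply_eq e).1 h)⟩
    | .inr b => .inr (e'.symm b)
  left_inv := by rintro (⟨x, hx⟩ | b) <;> simp
  right_inv := by rintro (⟨x, hx⟩ | b) <;> simp

/-- `(A ∪ₐ B) ∪_b C ≃ A ∪ₐ (B ∪_b C)`. -/
def assoc (A : Type) (a : A) (B : Type) (b : B) (C : Type) :
    Ins (Ins A a B) (.inr b) C ≃ Ins A a (Ins B b C) where
  toFun
    | .inl ⟨.inl x, _⟩ => .inl x
    | .inl ⟨.inr y, h⟩ => .inr (.inl ⟨y, fun h' => h (by rw [h'])⟩)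
    | .inr c => .inr (.inr c)
  invFun
    | .inl x => .inl ⟨.inl x, by simp⟩
    | .inr (.inl y) => .inl ⟨.inr y.1, fun h => y.2 (Sum.inr_injective h)⟩
    | .inr (.inr c) => .inr c
  left_inv := by rintro (⟨x | y, h⟩ | c) <;> rfl
  right_inv := by rintro (x | y | c) <;> rfl

/-- `(A ∪ₐ B) ∪_{a'} C ≃ (A ∪_{a'} C) ∪ₐ B` for `a ≠ a'`. -/
def comm (A : Type) (a a' : A) (h : a ≠ a') (B C : Type) :
    Ins (Ins A a B) (.inl ⟨a', h.symm⟩) C ≃ Ins (Ins A a' C) (.inl ⟨a, h⟩) B where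
  toFun
    | .inl ⟨.inl x, hx⟩ => .inl ⟨.inl ⟨x.1, fun e => hx (by simp [← e])⟩,
        fun e => x.2 (congrArg Subtype.val (Sum.inl_injective e))⟩
    | .inl ⟨.inr b, _⟩ => .inr b
    | .inr c => .inl ⟨.inr c, by simp⟩
  invFun
    | .inl ⟨.inl x, hx⟩ => .inl ⟨.inl ⟨x.1, fun e => hx (by simp [← e])⟩,
        fun e => x.2 (congrArg Subtype.val (Sum.inl_injective e))⟩
    | .inl ⟨.inr c, _⟩ => .inr c
    | .inr b => .inl ⟨.inr b, by simp⟩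
  left_inv := by rintro (⟨x | y, h⟩ | c) <;> rfl
  right_inv := by rintro (⟨x | y, h⟩ | c) <;> rfl

/-- `A ∪ₐ {1} ≃ A`, identifying `1` with `a`. -/
noncomputable def rightUnit (A : Type) (a : A) : Ins A a Unit ≃ A :=
  Equiv.ofBijective (Sum.elim Subtype.val (fun _ => a)) (by
    refine ⟨?_, fun x => ?_⟩
    · rintro (⟨x, hx⟩ | _) (⟨y, hy⟩ | _) h
      · simp at h; subst h; rfl
      · exact absurd h hx
      · exact absurd h.symm hy
      · rfl
    · by_cases h : x = a
      · exact ⟨.inr (), h.symm⟩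
      · exact ⟨.inl ⟨x, h⟩, rfl⟩)

/-- `{1} ∪₁ B ≃ B`. -/
def leftUnit (B : Type) : Ins Unit () B ≃ B where
  toFun
    | .inl x => (x.2 rfl).elim
    | .inr b => b
  invFun b := .inr b
  left_inv := by
    rintro (⟨x, hx⟩ | b)
    · exact (hx rfl).elim
    · rfl
  right_inv _ := rfl

end Ins

end Insertion

/-- An operad in the category of sets, with partial compositions indexed by finite sets. -/
structure SetOperad where
  /-- the set `O(A)` -/
  ob : (A : Type) → [Finite A] → Type
  /-- functoriality in bijections -/
  map : {A B : Type} → [Finite A] → [Finite B] → (A ≃ B) → ob A → ob B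
  map_refl : ∀ {A : Type} [Finite A] (p : ob A), map (Equiv.refl A) p = p
  map_trans : ∀ {A B C : Type} [Finite A] [Finite B] [Finite C] (e : A ≃ B) (e' : B ≃ C)
    (p : ob A), map (e.trans e') p = map e' (map e p)
  /-- the unit -/
  one : ob Unit
  /-- the partial composition `- ∘ₐ - : O(A) × O(B) → O(A ∪ₐ B)` -/
  comp : {A : Type} → [Finite A] → (a : A) → {B : Type} → [Finite B] → ob A → ob B → ob (Ins A a B)
  comp_map : ∀ {A A' B B' : Type} [Finite A] [Finite A'] [Finite B] [Finite B']
    (e : A ≃ A') (a : A) (e' : B ≃ B') (p : ob A) (q : ob B),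
    comp (e a) (map e p) (map e' q) = map (Ins.congr e a e') (comp a p q)
  assoc : ∀ {A B C : Type} [Finite A] [Finite B] [Finite C] (a : A) (b : B)
    (p : ob A) (q : ob B) (r : ob C),
    map (Ins.assoc A a B b C) (comp (Sum.inr b : Ins A a B) (comp a p q) r) =
      comp a p (comp b q r)
  comm : ∀ {A B C : Type} [Finite A] [Finite B] [Finite C] (a a' : A) (h : a ≠ a')
    (p : ob A) (q : ob B) (r : ob C),
    map (Ins.comm A a a' h B C)
        (comp (Sum.inl ⟨a', h.symm⟩ : Ins A a B) (comp a p q) r) =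
      comp (Sum.inl ⟨a, h⟩ : Ins A a' C) (comp a' p r) q
  comp_one : ∀ {A : Type} [Finite A] (a : A) (p : ob A),
    map (Ins.rightUnit A a) (comp a p one) = p
  one_comp : ∀ {B : Type} [Finite B] (q : ob B),
    map (Ins.leftUnit B) (comp () one q) = q

/-- Finite sets with at most `k` elements, `0 ≤ k ≤ ∞`. -/
structure FinLE (k : ℕ∞) where
  /-- the underlying set -/
  carrier : Type
  [finite : Finite carrier]
  card_le : (Nat.card carrier : ℕ∞) ≤ k

attribute [instance] FinLE.finite

namespace FinLE

variable {k : ℕ∞}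

instance : CoeSort (FinLE k) Type := ⟨FinLE.carrier⟩

/-- The finite set `A ∪ₐ B`, when it has at most `k` elements. -/
abbrev ins (A : FinLE k) (a : A) (B : Type) [Finite B]
    (h : (Nat.card (Ins A a B) : ℕ∞) ≤ k) : FinLE k := ⟨Ins A a B, h⟩

/-- A set with at most `k` elements has at most `j` elements if `k ≤ j`. -/
abbrev ofLE {j : ℕ∞} (h : k ≤ j) (A : FinLE k) : FinLE j := ⟨A.carrier, A.card_le.trans h⟩

end FinLE

section Modules

variable (O : SetOperad) (k : ℕ∞) (D : Type u) [Category.{v} D]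

/-- A `k`-truncated right module over the operad `O` in sets, with values in `D`: it is defined
on sets with at most `k` elements, and has all the structure maps `M(A) ⊗ O(B) ⟶ M(A ∪ₐ B)` of a
right module whose source and target are defined. As `D` is tensored over sets through
coproducts, such a structure map is a family of morphisms `M(A) ⟶ M(A ∪ₐ B)` indexed by `O(B)`.
The axioms are those of a right module, as far as the maps in them are defined. -/
structure TruncRightModule where
  /-- the object `M(A)` -/
  obj : FinLE k → D
  /-- functoriality in bijections -/
  map : {A B : FinLE k} → (A ≃ B) → (obj A ⟶ obj B)
  map_refl : ∀ (A : FinLE k), map (Equiv.refl A) = 𝟙 (obj A)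
  map_trans : ∀ {A B C : FinLE k} (e : A ≃ B) (e' : B ≃ C), map (e.trans e') = map e ≫ map e'
  /-- the partial composition `- ∘ₐ p : M(A) ⟶ M(A ∪ₐ B)` for `p ∈ O(B)` -/
  act : (A : FinLE k) → (a : A) → {B : Type} → [Finite B] →
    (h : (Nat.card (Ins A a B) : ℕ∞) ≤ k) → O.ob B → (obj A ⟶ obj (A.ins a B h))
  act_map : ∀ {A A' : FinLE k} {B B' : Type} [Finite B] [Finite B'] (e : A ≃ A') (a : A)
    (e' : B ≃ B') (h : (Nat.card (Ins A a B) : ℕ∞) ≤ k)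
    (h' : (Nat.card (Ins A' (e a) B') : ℕ∞) ≤ k) (p : O.ob B),
    act A a h p ≫ map (B := A'.ins (e a) B' h') (Ins.congr e a e') =
      map e ≫ act A' (e a) h' (O.map e' p)
  act_assoc : ∀ (A : FinLE k) (a : A) {B C : Type} [Finite B] [Finite C] (b : B)
    (h₁ : (Nat.card (Ins A a B) : ℕ∞) ≤ k)
    (h₂ : (Nat.card (Ins (Ins A a B) (.inr b) C) : ℕ∞) ≤ k)
    (h₃ : (Nat.card (Ins A a (Ins B b C)) : ℕ∞) ≤ k) (p : O.ob B) (q : O.ob C),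
    act A a h₁ p ≫ act (A.ins a B h₁) (.inr b) h₂ q ≫
        map (B := A.ins a (Ins B b C) h₃) (Ins.assoc A a B b C) =
      act A a h₃ (O.comp b p q)
  act_comm : ∀ (A : FinLE k) (a a' : A) (hne : a ≠ a') {B C : Type} [Finite B] [Finite C]
    (h₁ : (Nat.card (Ins A a B) : ℕ∞) ≤ k) (h₂ : (Nat.card (Ins A a' C) : ℕ∞) ≤ k)
    (h₃ : (Nat.card (Ins (Ins A a B) (.inl ⟨a', hne.symm⟩) C) : ℕ∞) ≤ k)
    (h₄ : (Nat.card (Ins (Ins A a' C) (.inl ⟨a, hne⟩) B) : ℕ∞) ≤ k)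
    (p : O.ob B) (q : O.ob C),
    act A a h₁ p ≫ act (A.ins a B h₁) (.inl ⟨a', hne.symm⟩) h₃ q ≫
        map (B := (A.ins a' C h₂).ins (.inl ⟨a, hne⟩) B h₄) (Ins.comm A a a' hne B C) =
      act A a' h₂ q ≫ act (A.ins a' C h₂) (.inl ⟨a, hne⟩) h₄ p
  act_one : ∀ (A : FinLE k) (a : A) (h : (Nat.card (Ins A a Unit) : ℕ∞) ≤ k),
    act A a h O.one ≫ map (B := A) (Ins.rightUnit A a) = 𝟙 (obj A)

/-- A `k`-truncated weak bimodule over the operad `O` in sets, with values in `D`: a truncated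
right module with left structure maps `O(A) ⊗ M(B) ⟶ M(A ∪ₐ B)`, subject to the axioms of a weak
bimodule, as far as the maps in them are defined. -/
structure TruncWeakBimodule extends TruncRightModule O k D where
  /-- the partial composition `o ∘ₐ - : M(B) ⟶ M(A ∪ₐ B)` for `o ∈ O(A)` -/
  lact : {A : Type} → [Finite A] → (a : A) → (B : FinLE k) →
    (h : (Nat.card (Ins A a B) : ℕ∞) ≤ k) → O.ob A → (obj B ⟶ obj ⟨Ins A a B, h⟩)
  lact_map : ∀ {A A' : Type} [Finite A] [Finite A'] {B B' : FinLE k} (e : A ≃ A') (a : A)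
    (e' : B ≃ B') (h : (Nat.card (Ins A a B) : ℕ∞) ≤ k)
    (h' : (Nat.card (Ins A' (e a) B') : ℕ∞) ≤ k) (o : O.ob A),
    lact a B h o ≫ map (B := ⟨Ins A' (e a) B', h'⟩) (Ins.congr e a e') =
      map e' ≫ lact (e a) B' h' (O.map e o)
  lact_assoc : ∀ {A B : Type} [Finite A] [Finite B] (C : FinLE k) (a : A) (b : B)
    (h₁ : (Nat.card (Ins B b C) : ℕ∞) ≤ k)
    (h₂ : (Nat.card (Ins A a (Ins B b C)) : ℕ∞) ≤ k)
    (h₃ : (Nat.card (Ins (Ins A a B) (.inr b) C) : ℕ∞) ≤ k) (o : O.ob A) (o' : O.ob B),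
    lact (Sum.inr b : Ins A a B) C h₃ (O.comp a o o') ≫
        map (B := ⟨Ins A a (Ins B b C), h₂⟩) (Ins.assoc A a B b C) =
      lact b C h₁ o' ≫ lact a ⟨Ins B b C, h₁⟩ h₂ o
  lact_one : ∀ (B : FinLE k) (h : (Nat.card (Ins Unit () B) : ℕ∞) ≤ k),
    lact () B h O.one ≫ map (B := B) (Ins.leftUnit B) = 𝟙 (obj B)
  lact_act : ∀ {A C : Type} [Finite A] [Finite C] (B : FinLE k) (a : A) (b : B)
    (h₁ : (Nat.card (Ins A a B) : ℕ∞) ≤ k)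
    (h₂ : (Nat.card (Ins (Ins A a B) (.inr b) C) : ℕ∞) ≤ k)
    (h₃ : (Nat.card (Ins B b C) : ℕ∞) ≤ k)
    (h₄ : (Nat.card (Ins A a (Ins B b C)) : ℕ∞) ≤ k) (o : O.ob A) (p : O.ob C),
    lact a B h₁ o ≫ act ⟨Ins A a B, h₁⟩ (.inr b) h₂ p ≫
        map (B := ⟨Ins A a (Ins B b C), h₄⟩) (Ins.assoc A a B b C) =
      act B b h₃ p ≫ lact a (B.ins b C h₃) h₄ o
  lact_act_comm : ∀ {A B : Type} [Finite A] [Finite B] (C : FinLE k) (a a' : A) (hne : a ≠ a')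
    (h₁ : (Nat.card (Ins A a' C) : ℕ∞) ≤ k)
    (h₂ : (Nat.card (Ins (Ins A a' C) (.inl ⟨a, hne⟩) B) : ℕ∞) ≤ k)
    (h₃ : (Nat.card (Ins (Ins A a B) (.inl ⟨a', hne.symm⟩) C) : ℕ∞) ≤ k)
    (o : O.ob A) (p : O.ob B),
    lact (Sum.inl ⟨a', hne.symm⟩ : Ins A a B) C h₃ (O.comp a o p) ≫
        map (B := (⟨Ins A a' C, h₁⟩ : FinLE k).ins (.inl ⟨a, hne⟩) B h₂)
          (Ins.comm A a a' hne B C) =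
      lact a' C h₁ o ≫ act ⟨Ins A a' C, h₁⟩ (.inl ⟨a, hne⟩) h₂ p

variable {O k D}

namespace TruncRightModule

/-- Morphisms of truncated right modules. -/
@[ext]
structure Hom (M N : TruncRightModule O k D) where
  /-- the components -/
  app : (A : FinLE k) → (M.obj A ⟶ N.obj A)
  map_app : ∀ {A B : FinLE k} (e : A ≃ B), M.map e ≫ app B = app A ≫ N.map e
  act_app : ∀ (A : FinLE k) (a : A) {B : Type} [Finite B]
    (h : (Nat.card (Ins A a B) : ℕ∞) ≤ k) (p : O.ob B),
    M.act A a h p ≫ app (A.ins a B h) = app A ≫ N.act A a h p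

instance : Category (TruncRightModule O k D) where
  Hom := Hom
  id M := ⟨fun _ => 𝟙 _, by simp, by simp⟩
  comp f g := ⟨fun A => f.app A ≫ g.app A,
    fun e => by rw [← Category.assoc, f.map_app, Category.assoc, g.map_app, Category.assoc],
    fun A a _ _ h p => by
      rw [← Category.assoc, f.act_app, Category.assoc, g.act_app, Category.assoc]⟩
  id_comp f := Hom.ext (funext fun _ => Category.id_comp _)
  comp_id f := Hom.ext (funext fun _ => Category.comp_id _)
  assoc f g h := Hom.ext (funext fun _ => Category.assoc _ _ _)

/-- Postcomposition of a module with a functor. -/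
abbrev mapObj {D' : Type*} [Category D'] (M : TruncRightModule O k D) (Φ : D ⥤ D') :
    TruncRightModule O k D' where
  obj A := Φ.obj (M.obj A)
  map e := Φ.map (M.map e)
  map_refl A := by rw [M.map_refl, Φ.map_id]
  map_trans e e' := by rw [M.map_trans, Φ.map_comp]
  act A a _ _ h p := Φ.map (M.act A a h p)
  act_map e a e' h h' p := by rw [← Φ.map_comp, M.act_map e a e' h h' p, Φ.map_comp]
  act_assoc A a _ _ _ _ b h₁ h₂ h₃ p q := by
    rw [← Φ.map_comp, ← Φ.map_comp, M.act_assoc A a b h₁ h₂ h₃ p q]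
  act_comm A a a' hne _ _ _ _ h₁ h₂ h₃ h₄ p q := by
    rw [← Φ.map_comp, ← Φ.map_comp, M.act_comm A a a' hne h₁ h₂ h₃ h₄ p q, Φ.map_comp]
  act_one A a h := by rw [← Φ.map_comp, M.act_one, Φ.map_id]

end TruncRightModule

namespace TruncWeakBimodule

/-- Morphisms of truncated weak bimodules. -/
@[ext]
structure Hom (M N : TruncWeakBimodule O k D) where
  /-- the underlying morphism of truncated right modules -/
  right : M.toTruncRightModule ⟶ N.toTruncRightModule
  lact_app : ∀ {A : Type} [Finite A] (a : A) (B : FinLE k)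
    (h : (Nat.card (Ins A a B) : ℕ∞) ≤ k) (o : O.ob A),
    M.lact a B h o ≫ right.app ⟨Ins A a B, h⟩ = right.app B ≫ N.lact a B h o

instance : Category (TruncWeakBimodule O k D) where
  Hom := Hom
  id M := ⟨𝟙 _, fun a B h o => (Category.comp_id _).trans (Category.id_comp _).symm⟩
  comp f g := ⟨f.right ≫ g.right, fun a B h o => by
    change _ ≫ f.right.app _ ≫ g.right.app _ = (f.right.app _ ≫ g.right.app _) ≫ _
    rw [← Category.assoc, f.lact_app, Category.assoc, g.lact_app, Category.assoc]⟩
  id_comp f := Hom.ext (Category.id_comp _)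
  comp_id f := Hom.ext (Category.comp_id _)
  assoc f g h := Hom.ext (Category.assoc _ _ _)

/-- Postcomposition of a weak bimodule with a functor. -/
def mapObj {D' : Type*} [Category D'] (M : TruncWeakBimodule O k D) (Φ : D ⥤ D') :
    TruncWeakBimodule O k D' where
  toTruncRightModule := M.toTruncRightModule.mapObj Φ
  lact a B h o := Φ.map (M.lact a B h o)
  lact_map e a e' h h' o := by rw [← Φ.map_comp, M.lact_map e a e' h h' o, Φ.map_comp]
  lact_assoc C a b h₁ h₂ h₃ o o' := by
    rw [← Φ.map_comp, M.lact_assoc C a b h₁ h₂ h₃ o o', Φ.map_comp]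
  lact_one B h := by rw [← Φ.map_comp, M.lact_one, Φ.map_id]
  lact_act B a b h₁ h₂ h₃ h₄ o p := by
    rw [← Φ.map_comp, ← Φ.map_comp, M.lact_act B a b h₁ h₂ h₃ h₄ o p, Φ.map_comp]
  lact_act_comm C a a' hne h₁ h₂ h₃ o p := by
    rw [← Φ.map_comp, M.lact_act_comm C a a' hne h₁ h₂ h₃ o p, Φ.map_comp]

end TruncWeakBimodule

end Modules

section StandardEmbeddings

/-- The Euclidean space `ℝᵐ`. -/
abbrev Euc (m : ℕ) : Type := EuclideanSpace ℝ (Fin m)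

/-- The open unit ball `Dᵐ`. -/
abbrev disc (m : ℕ) : Set (Euc m) := Metric.ball 0 1

/-- The complement of the closed unit ball, the antiball. -/
abbrev antidisc (m : ℕ) : Set (Euc m) := (Metric.closedBall 0 1)ᶜ

/-- Disjoint unions of open subsets (the pieces) of `ℝᵐ`. -/
structure SM (m : ℕ) where
  /-- the index set of the pieces -/
  ι : Type
  /-- the pieces -/
  piece : ι → Set (Euc m)
  isOpen : ∀ i, IsOpen (piece i)

namespace SM

variable {m : ℕ}

/-- The underlying set of the disjoint union of the pieces. -/
abbrev Pt (S : SM m) : Type := Σ i : S.ι, S.piece i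

lemma pt_ext {S : SM m} {p q : S.Pt} (h : p.1 = q.1) (h' : (p.2 : Euc m) = q.2) : p = q := by
  obtain ⟨i, x⟩ := p
  obtain ⟨j, y⟩ := q
  obtain rfl : i = j := h
  obtain rfl : x = y := Subtype.ext h'
  rfl

lemma fst_eq {S : SM m} {p q : S.Pt} (h : p = q) : p.1 = q.1 := congrArg Sigma.fst h

lemma val_eq {S : SM m} {p q : S.Pt} (h : p = q) : (p.2 : Euc m) = q.2 :=
  congrArg (fun p : S.Pt => (p.2 : Euc m)) h

/-- Standard embeddings: injective maps which carry each piece to a piece by the restriction of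
a map `x ↦ r x + c` with `r > 0`. As the pieces are open, such a map is an (open) embedding. -/
structure Hom (S T : SM m) where
  /-- the underlying map -/
  toFun : S.Pt → T.Pt
  injective : Function.Injective toFun
  standard : ∀ i, ∃ (j : T.ι) (r : ℝ) (c : Euc m), 0 < r ∧ ∀ x : S.piece i,
    (toFun ⟨i, x⟩).1 = j ∧ ((toFun ⟨i, x⟩).2 : Euc m) = r • (x : Euc m) + c

/-- The category of disjoint unions of open subsets of `ℝᵐ` and standard embeddings. -/
instance : Category (SM m) where
  Hom := Hom
  id S := ⟨id, Function.injective_id, fun i => ⟨i, 1, 0, one_pos, fun x => by simp⟩⟩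
  comp f g := ⟨g.toFun ∘ f.toFun, g.injective.comp f.injective, fun i => by
    obtain ⟨j, r, c, hr, h⟩ := f.standard i
    obtain ⟨l, s, d, hs, h'⟩ := g.standard j
    refine ⟨l, s * r, s • c + d, mul_pos hs hr, fun x => ?_⟩
    obtain ⟨h1, h2⟩ := h x
    generalize hp : f.toFun ⟨i, x⟩ = p at h1 h2
    obtain ⟨j', y⟩ := p
    obtain rfl : j' = j := h1
    obtain ⟨h3, h4⟩ := h' y
    refine ⟨(congrArg (fun p => (g.toFun p).1) hp).trans h3,
      (congrArg (fun p => ((g.toFun p).2 : Euc m)) hp).trans (h4.trans ?_)⟩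
    have h5 : (y : Euc m) = r • (x : Euc m) + c := h2
    rw [h5, smul_add, mul_smul, add_assoc]⟩

lemma hom_ext {S T : SM m} {f g : S ⟶ T}
    (h : ∀ i x, (f.toFun ⟨i, x⟩).1 = (g.toFun ⟨i, x⟩).1)
    (h' : ∀ i x, ((f.toFun ⟨i, x⟩).2 : Euc m) = (g.toFun ⟨i, x⟩).2) : f = g := by
  obtain ⟨f, _, _⟩ := f
  obtain ⟨g, _, _⟩ := g
  obtain rfl : f = g := funext fun ⟨i, x⟩ => pt_ext (h i x) (h' i x)
  rfl

@[simp] lemma id_toFun (S : SM m) (p : S.Pt) : Hom.toFun (𝟙 S) p = p := rfl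

@[simp] lemma comp_toFun {S T U : SM m} (f : S ⟶ T) (g : T ⟶ U) (p : S.Pt) :
    (f ≫ g).toFun p = g.toFun (f.toFun p) := rfl

/-- An open subset of `ℝᵐ`, as a single piece. -/
abbrev single (M : TopologicalSpace.Opens (Euc m)) : SM m := ⟨Unit, fun _ => M, fun _ => M.2⟩

/-- The image of a standard embedding into an open subset of `ℝᵐ`. -/
def image {S : SM m} {M : TopologicalSpace.Opens (Euc m)} (f : S ⟶ single M) : Set (Euc m) :=
  Set.range fun p => ((f.toFun p).2 : Euc m)

lemma image_comp_subset {S T : SM m} {M : TopologicalSpace.Opens (Euc m)} (g : S ⟶ T)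
    (f : T ⟶ single M) : image (g ≫ f) ⊆ image f := by
  rintro _ ⟨p, rfl⟩
  exact ⟨g.toFun p, rfl⟩

variable (m) in
/-- The disjoint union `A × Dᵐ` of copies of the unit ball. -/
abbrev balls (A : Type) : SM m := ⟨A, fun _ => disc m, fun _ => Metric.isOpen_ball⟩

/-- The functor adding an antiball, `S ↦ S ⨿ (ℝᵐ ∖ closure Dᵐ)`. -/
def addAnti : SM m ⥤ SM m where
  obj S := ⟨Option S.ι, fun i => i.elim (antidisc m) S.piece, fun i => by
    cases i with
    | none => exact Metric.isClosed_closedBall.isOpen_compl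
    | some i => exact S.isOpen i⟩
  map {S T} f :=
    { toFun := fun
        | ⟨none, x⟩ => ⟨none, x⟩
        | ⟨some i, x⟩ => ⟨some (f.toFun ⟨i, x⟩).1, (f.toFun ⟨i, x⟩).2⟩
      injective := by
        rintro ⟨_ | i, x⟩ ⟨_ | j, y⟩ h
        · exact pt_ext rfl (val_eq h :)
        · exact absurd (fst_eq h) (Option.some_ne_none _).symm
        · exact absurd (fst_eq h) (Option.some_ne_none _)
        · have h1 : f.toFun ⟨i, x⟩ = f.toFun ⟨j, y⟩ :=
            pt_ext (Option.some_injective _ (fst_eq h)) (val_eq h :)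
          have h2 := f.injective h1
          exact pt_ext (congrArg some (fst_eq h2)) (val_eq h2 :)
      standard := fun
        | none => ⟨none, 1, 0, one_pos, fun x => by simp⟩
        | some i => by
            obtain ⟨j, r, c, hr, h⟩ := f.standard i
            exact ⟨some j, r, c, hr, fun x => ⟨congrArg some (h x).1, (h x).2⟩⟩ }
  map_id S := by
    refine hom_ext ?_ ?_ <;> rintro (_ | i) x <;> rfl
  map_comp f g := by
    refine hom_ext ?_ ?_ <;> rintro (_ | i) x <;> rfl

/-- The isomorphism `A × Dᵐ ≅ B × Dᵐ` given by a bijection `A ≃ B`. -/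
def ballsMap {A B : Type} (e : A ≃ B) : balls m A ⟶ balls m B where
  toFun p := ⟨e p.1, p.2⟩
  injective := by
    rintro ⟨i, x⟩ ⟨j, y⟩ h
    exact pt_ext (e.injective (fst_eq h)) (val_eq h :)
  standard i := ⟨e i, 1, 0, one_pos, fun x => by simp⟩

/-- The standard embedding `(A ∪ₐ B) × Dᵐ ⟶ A × Dᵐ` given by `q : B × Dᵐ ⟶ Dᵐ`: it is `q` into
the ball indexed by `a` on the balls indexed by `B`, and the identity on the other balls. -/
def insMor {A B : Type} (a : A) (q : balls m B ⟶ balls m Unit) :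
    balls m (Ins A a B) ⟶ balls m A where
  toFun
    | ⟨.inl x, y⟩ => ⟨x.1, y⟩
    | ⟨.inr b, y⟩ => ⟨a, (q.toFun ⟨b, y⟩).2⟩
  injective := by
    rintro ⟨x | b, y⟩ ⟨x' | b', y'⟩ h
    · exact pt_ext (congrArg Sum.inl (Subtype.ext (fst_eq h))) (val_eq h :)
    · exact absurd (fst_eq h) x.2
    · exact absurd (fst_eq h).symm x'.2
    · have h1 : q.toFun ⟨b, y⟩ = q.toFun ⟨b', y'⟩ := pt_ext (Subsingleton.elim _ _) (val_eq h :)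
      have h2 := q.injective h1
      exact pt_ext (congrArg Sum.inr (fst_eq h2)) (val_eq h2 :)
  standard
    | .inl x => ⟨x.1, 1, 0, one_pos, fun y => by simp⟩
    | .inr b => by
        obtain ⟨_, r, c, hr, h⟩ := q.standard b
        exact ⟨a, r, c, hr, fun y => ⟨rfl, (h y).2⟩⟩

lemma ballsMap_refl (A : Type) : ballsMap (Equiv.refl A) = 𝟙 (balls m A) := rfl

lemma ballsMap_trans {A B C : Type} (e : A ≃ B) (e' : B ≃ C) :
    ballsMap (m := m) (e.trans e') = ballsMap e ≫ ballsMap e' := rfl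

lemma ballsMap_insMor {A A' B B' : Type} (e : A ≃ A') (a : A) (e' : B ≃ B')
    (q : balls m B ⟶ balls m Unit) :
    ballsMap (Ins.congr e a e').symm ≫ insMor a q =
      insMor (e a) (ballsMap e'.symm ≫ q) ≫ ballsMap e.symm := by
  refine hom_ext ?_ ?_ <;> rintro (⟨x, hx⟩ | b) y
  · rfl
  · exact (e.symm_apply_apply a).symm
  · rfl
  · rfl

lemma ballsMap_insMor_assoc {A B C : Type} (a : A) (b : B) (q : balls m B ⟶ balls m Unit)
    (r : balls m C ⟶ balls m Unit) :
    ballsMap (Ins.assoc A a B b C).symm ≫ insMor (Sum.inr b : Ins A a B) r ≫ insMor a q =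
      insMor a (insMor b r ≫ q) := by
  refine hom_ext ?_ ?_ <;> rintro (⟨x, hx⟩ | ⟨b', hb⟩ | c) y <;> rfl

lemma ballsMap_insMor_comm {A B C : Type} (a a' : A) (h : a ≠ a')
    (q : balls m B ⟶ balls m Unit) (r : balls m C ⟶ balls m Unit) :
    ballsMap (Ins.comm A a a' h B C).symm ≫
        insMor (Sum.inl ⟨a', h.symm⟩ : Ins A a B) r ≫ insMor a q =
      insMor (Sum.inl ⟨a, h⟩ : Ins A a' C) q ≫ insMor a' r := by
  refine hom_ext ?_ ?_ <;> rintro (⟨⟨x, hx⟩ | c, h'⟩ | b) y <;> rfl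

lemma ballsMap_insMor_one {A : Type} (a : A) :
    ballsMap (Ins.rightUnit A a).symm ≫ insMor a (𝟙 (balls m Unit)) = 𝟙 _ := by
  have h : insMor a (𝟙 (balls m Unit)) = ballsMap (Ins.rightUnit A a) := by
    refine hom_ext ?_ ?_ <;> rintro (⟨x, hx⟩ | b) y <;> rfl
  rw [h, ← ballsMap_trans, Equiv.symm_trans_self, ballsMap_refl]

lemma ballsMap_one_insMor {B : Type} (q : balls m B ⟶ balls m Unit) :
    ballsMap (Ins.leftUnit B).symm ≫ insMor () q = q := by
  refine hom_ext ?_ ?_ <;> intro b y <;> rfl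

end SM

open SM

/-- The operad `ᵟB_m`, the underlying operad in sets of the little balls operad. -/
def littleBalls (m : ℕ) : SetOperad where
  ob A _ := balls m A ⟶ balls m Unit
  map e p := ballsMap e.symm ≫ p
  map_refl p := rfl
  map_trans e e' p := rfl
  one := 𝟙 _
  comp a _ _ p q := insMor a q ≫ p
  comp_map e a e' p q := by
    change insMor (e a) _ ≫ ballsMap e.symm ≫ p = ballsMap _ ≫ insMor a q ≫ p
    rw [← Category.assoc, ← ballsMap_insMor, Category.assoc]
  assoc a b p q r := by
    change ballsMap _ ≫ insMor _ r ≫ insMor a q ≫ p = insMor a (insMor b r ≫ q) ≫ p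
    rw [← ballsMap_insMor_assoc]; simp only [Category.assoc]
  comm a a' h p q r := by
    change ballsMap _ ≫ insMor _ r ≫ insMor a q ≫ p = insMor _ q ≫ insMor a' r ≫ p
    have := ballsMap_insMor_comm a a' h q r
    simp only [← Category.assoc] at this ⊢
    rw [this]
  comp_one a p := by
    change ballsMap _ ≫ insMor a (𝟙 _) ≫ p = p
    rw [← Category.assoc, ballsMap_insMor_one, Category.id_comp]
  one_comp q := by
    change ballsMap _ ≫ insMor () q ≫ 𝟙 _ = q
    rw [Category.comp_id, ballsMap_one_insMor]

section Inverse

variable {m : ℕ} {A : Type} (o : balls m A ⟶ balls m Unit) (a : A)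

/-- The inverse of the standard isomorphism `x ↦ r x + c` of `ℝᵐ` which `o : A × Dᵐ ⟶ Dᵐ`
restricts to on the ball indexed by `a`. -/
noncomputable def stdInv (y : Euc m) : Euc m :=
  (o.standard a).choose_spec.choose⁻¹ • (y - (o.standard a).choose_spec.choose_spec.choose)

variable {o a} in
lemma stdInv_eq {r : ℝ} {c : Euc m} (hr : 0 < r)
    (h : ∀ x : disc m, ((o.toFun ⟨a, x⟩).2 : Euc m) = r • (x : Euc m) + c) (y : Euc m) :
    stdInv o a y = r⁻¹ • (y - c) := by
  obtain ⟨hs, h'⟩ := (o.standard a).choose_spec.choose_spec.choose_spec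
  unfold stdInv
  set s := (o.standard a).choose_spec.choose
  set d := (o.standard a).choose_spec.choose_spec.choose
  have key : ∀ x ∈ disc m, r • x + c = s • x + d := fun x hx =>
    (h ⟨x, hx⟩).symm.trans (h' ⟨x, hx⟩).2
  have hcd : c = d := by simpa using key 0 (by simp)
  subst hcd
  have key' : ∀ x : Euc m, r • x = s • x := by
    intro x
    have hpos : 0 < 2 * (‖x‖ + 1) := by positivity
    have hx : (2 * (‖x‖ + 1))⁻¹ • x ∈ disc m := by
      rw [Metric.mem_ball, dist_zero_right, norm_smul, norm_inv, Real.norm_eq_abs,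
        abs_of_pos hpos, inv_mul_lt_iff₀ hpos]
      nlinarith [norm_nonneg x]
    have := add_right_cancel (key _ hx)
    rw [smul_comm r, smul_comm s] at this
    exact smul_right_injective _ (inv_ne_zero hpos.ne') this
  have h3 := key' (s⁻¹ • (y - d))
  rw [smul_inv_smul₀ hs.ne'] at h3
  have h4 : r⁻¹ • (y - d) = s⁻¹ • (y - d) := by
    conv_lhs => rw [← h3, inv_smul_smul₀ hr.ne']
  exact h4.symm

lemma exists_std : ∃ (r : ℝ) (c : Euc m), 0 < r ∧
    (∀ x : disc m, ((o.toFun ⟨a, x⟩).2 : Euc m) = r • (x : Euc m) + c) ∧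
    ∀ y, stdInv o a y = r⁻¹ • (y - c) := by
  obtain ⟨_, r, c, hr, h⟩ := o.standard a
  exact ⟨r, c, hr, fun x => (h x).2, stdInv_eq hr fun x => (h x).2⟩

lemma stdInv_mem_antidisc {y : Euc m} {U : Set (Euc m)} (hU : IsOpen U) (hy : y ∈ U)
    (h : ∀ x : disc m, ((o.toFun ⟨a, x⟩).2 : Euc m) ∉ U) : stdInv o a y ∈ antidisc m := by
  obtain ⟨r, c, hr, h1, h2⟩ := exists_std o a
  intro hmem
  rw [← closure_ball (0 : Euc m) one_ne_zero] at hmem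
  have hcont : Continuous fun x : Euc m => r • x + c := by fun_prop
  have : (fun x : Euc m => r • x + c) ⁻¹' U ∈ nhds (stdInv o a y) := by
    refine (hU.preimage hcont).mem_nhds ?_
    change r • stdInv o a y + c ∈ U
    rw [h2, smul_inv_smul₀ hr.ne', sub_add_cancel]
    exact hy
  obtain ⟨x, hxU, hx⟩ := mem_closure_iff_nhds.1 hmem _ this
  exact h ⟨x, hx⟩ (by rw [h1]; exact hxU)


/-- The standard embedding `((A ∪ₐ B) × Dᵐ) ⨿ antiball ⟶ (B × Dᵐ) ⨿ antiball` given by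
`o : A × Dᵐ ⟶ Dᵐ`: it is the identity on the balls indexed by `B`, and, if `s` is the standard
isomorphism of `ℝᵐ` which extends `o` on the ball indexed by `a`, it is `s⁻¹` on the antiball and
`s⁻¹ ∘ o` on the balls indexed by `A ∖ {a}`, both mapping to the antiball. -/
noncomputable def SM.lMor (o : balls m A ⟶ balls m Unit) (a : A) (B : Type) :
    addAnti.obj (balls m (Ins A a B)) ⟶ addAnti.obj (balls m B) where
  toFun
    | ⟨none, x⟩ => ⟨none, stdInv o a x, by
        refine stdInv_mem_antidisc o a Metric.isClosed_closedBall.isOpen_compl x.2 fun y hy => ?_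
        exact hy (Metric.ball_subset_closedBall (o.toFun ⟨a, y⟩).2.2)⟩
    | ⟨some (.inl i), x⟩ => ⟨none, stdInv o a (o.toFun ⟨i.1, x⟩).2, by
        obtain ⟨j, r, c, hr, h⟩ := o.standard i.1
        refine stdInv_mem_antidisc o a (U := (fun z => r⁻¹ • (z - c)) ⁻¹' disc m)
          (Metric.isOpen_ball.preimage (by fun_prop)) ?_ fun y hy => ?_
        · change r⁻¹ • (_ - c) ∈ disc m
          rw [(h x).2, add_sub_cancel_right, inv_smul_smul₀ hr.ne']
          exact x.2
        · have h1 : o.toFun ⟨i.1, ⟨_, hy⟩⟩ = o.toFun ⟨a, y⟩ := by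
            refine pt_ext (Subsingleton.elim _ _) ?_
            rw [(h _).2]
            simp only
            rw [smul_inv_smul₀ hr.ne', sub_add_cancel]
          exact i.2 (fst_eq (o.injective h1))⟩
    | ⟨some (.inr b), x⟩ => ⟨some b, x⟩
  injective := by
    obtain ⟨r, c, hr, -, h⟩ := exists_std o a
    have hinj : Function.Injective (stdInv o a) := fun y z hyz => by
      rw [h, h] at hyz
      exact sub_left_injective (smul_right_injective _ (inv_ne_zero hr.ne') hyz)
    have hno : ∀ x : antidisc m, ∀ p, (x : Euc m) ≠ (o.toFun p).2 := fun x p e =>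
      x.2 (e ▸ Metric.ball_subset_closedBall (o.toFun p).2.2)
    rintro ⟨_ | i | b, x⟩ ⟨_ | i' | b', x'⟩ e
    · have := val_eq e
      exact pt_ext rfl (hinj this :)
    · have := val_eq e
      exact (hno x _ (hinj this)).elim
    · exact absurd (fst_eq e).symm (Option.some_ne_none _)
    · have := val_eq e
      exact (hno x' _ (hinj this).symm).elim
    · have := val_eq e
      have h2 := o.injective (pt_ext (Subsingleton.elim _ _) (hinj this))
      exact pt_ext (congrArg (some ∘ Sum.inl) (Subtype.ext (fst_eq h2))) (val_eq h2 :)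
    · exact absurd (fst_eq e).symm (Option.some_ne_none _)
    · exact absurd (fst_eq e) (Option.some_ne_none _)
    · exact absurd (fst_eq e) (Option.some_ne_none _)
    · exact pt_ext (congrArg (some ∘ Sum.inr) (Option.some_injective _ (fst_eq e))) (val_eq e :)
  standard
    | none => by
        obtain ⟨r, c, hr, -, h⟩ := exists_std o a
        refine ⟨none, r⁻¹, - (r⁻¹ • c), inv_pos.2 hr, fun x => ⟨rfl, ?_⟩⟩
        change stdInv o a x = _
        rw [h, smul_sub, sub_eq_add_neg]
    | some (.inl i) => by
        obtain ⟨r, c, hr, -, h⟩ := exists_std o a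
        obtain ⟨j, s, d, hs, h'⟩ := o.standard i.1
        refine ⟨none, r⁻¹ * s, r⁻¹ • (d - c), mul_pos (inv_pos.2 hr) hs, fun x => ⟨rfl, ?_⟩⟩
        change stdInv o a (o.toFun ⟨i.1, x⟩).2 = _
        rw [h, (h' x).2, add_sub_assoc, smul_add, mul_smul]
    | some (.inr b) => ⟨some b, 1, 0, one_pos, fun x => by
        refine ⟨rfl, ?_⟩
        change (x : Euc m) = _
        simp⟩

end Inverse

namespace SM

variable {m : ℕ}

lemma stdInv_ballsMap {A A' : Type} (e : A ≃ A') (a : A) (o : balls m A ⟶ balls m Unit)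
    (y : Euc m) : stdInv (ballsMap e.symm ≫ o) (e a) y = stdInv o a y := by
  obtain ⟨r, c, hr, h, h'⟩ := exists_std o a
  rw [h', stdInv_eq hr (fun x => ?_)]
  rw [← h]
  change ((o.toFun ⟨e.symm (e a), x⟩).2 : Euc m) = _
  rw [e.symm_apply_apply]

lemma stdInv_insMor_inr {A B : Type} (a : A) (b : B) (o : balls m A ⟶ balls m Unit)
    (o' : balls m B ⟶ balls m Unit) (y : Euc m) :
    stdInv (insMor a o' ≫ o) (Sum.inr b : Ins A a B) y = stdInv o' b (stdInv o a y) := by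
  obtain ⟨r, c, hr, h, h'⟩ := exists_std o a
  obtain ⟨s, d, hs, h1, h1'⟩ := exists_std o' b
  rw [h', h1', stdInv_eq (mul_pos hr hs) (c := r • d + c) (fun x => ?_)]
  · rw [mul_inv_rev, mul_smul, add_comm, ← sub_sub, smul_sub r⁻¹, inv_smul_smul₀ hr.ne']
  · change ((o.toFun ⟨a, (o'.toFun ⟨b, x⟩).2⟩).2 : Euc m) = _
    rw [h, mul_smul, ← add_assoc, ← smul_add]
    congr 2
    exact h1 x

lemma stdInv_insMor_inl {A B : Type} (a a' : A) (h : a' ≠ a) (o : balls m A ⟶ balls m Unit)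
    (p : balls m B ⟶ balls m Unit) (y : Euc m) :
    stdInv (insMor a p ≫ o) (Sum.inl ⟨a', h⟩ : Ins A a B) y = stdInv o a' y := by
  obtain ⟨r, c, hr, h1, h1'⟩ := exists_std o a'
  rw [h1', stdInv_eq hr (fun x => ?_)]
  exact h1 x

lemma stdInv_one (y : Euc m) : stdInv (𝟙 (balls m Unit)) () y = y := by
  rw [stdInv_eq (r := 1) (c := 0) one_pos (fun x => ?_)]
  · simp
  · change (x : Euc m) = _
    simp

lemma stdInv_apply {A : Type} (o : balls m A ⟶ balls m Unit) (a : A) (x : disc m) :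
    stdInv o a (o.toFun ⟨a, x⟩).2 = x := by
  obtain ⟨r, c, hr, h, h'⟩ := exists_std o a
  rw [h', h, add_sub_cancel_right, inv_smul_smul₀ hr.ne']

lemma addAnti_lMor {A A' B B' : Type} (e : A ≃ A') (a : A) (e' : B ≃ B')
    (o : balls m A ⟶ balls m Unit) :
    addAnti.map (ballsMap (Ins.congr e a e').symm) ≫ lMor o a B =
      lMor (ballsMap e.symm ≫ o) (e a) B' ≫ addAnti.map (ballsMap e'.symm) := by
  refine hom_ext ?_ ?_ <;> rintro (_ | ⟨x, hx⟩ | b) y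
  · rfl
  · rfl
  · rfl
  · exact (stdInv_ballsMap e a o _).symm
  · exact (stdInv_ballsMap e a o _).symm
  · rfl

lemma addAnti_lMor_assoc {A B C : Type} (a : A) (b : B) (o : balls m A ⟶ balls m Unit)
    (o' : balls m B ⟶ balls m Unit) :
    addAnti.map (ballsMap (Ins.assoc A a B b C).symm) ≫
        lMor (insMor a o' ≫ o) (Sum.inr b : Ins A a B) C =
      lMor o a (Ins B b C) ≫ lMor o' b C := by
  refine hom_ext ?_ ?_ <;> rintro (_ | x | x | c) y
  · rfl
  · rfl
  · rfl
  · rfl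
  · exact stdInv_insMor_inr a b o o' _
  · exact stdInv_insMor_inr a b o o' _
  · change stdInv _ _ (o.toFun ⟨a, (o'.toFun ⟨x.1, y⟩).2⟩).2 = stdInv o' b _
    rw [stdInv_insMor_inr, stdInv_apply]
  · rfl

lemma addAnti_one_lMor {B : Type} :
    addAnti.map (ballsMap (Ins.leftUnit B).symm) ≫ lMor (𝟙 (balls m Unit)) () B = 𝟙 _ := by
  refine hom_ext ?_ ?_ <;> rintro (_ | b) y
  · rfl
  · rfl
  · exact stdInv_one _
  · rfl

lemma addAnti_lMor_insMor {A B C : Type} (a : A) (b : B) (o : balls m A ⟶ balls m Unit)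
    (p : balls m C ⟶ balls m Unit) :
    addAnti.map (ballsMap (Ins.assoc A a B b C).symm) ≫
        addAnti.map (insMor (Sum.inr b : Ins A a B) p) ≫ lMor o a B =
      lMor o a (Ins B b C) ≫ addAnti.map (insMor b p) := by
  refine hom_ext ?_ ?_ <;> rintro (_ | x | x | c) y <;> rfl

lemma addAnti_lMor_comm {A B C : Type} (a a' : A) (h : a ≠ a') (o : balls m A ⟶ balls m Unit)
    (p : balls m B ⟶ balls m Unit) :
    addAnti.map (ballsMap (Ins.comm A a a' h B C).symm) ≫
        lMor (insMor a p ≫ o) (Sum.inl ⟨a', h.symm⟩ : Ins A a B) C =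
      addAnti.map (insMor (Sum.inl ⟨a, h⟩ : Ins A a' C) p) ≫ lMor o a' C := by
  refine hom_ext ?_ ?_ <;> rintro (_ | ⟨⟨x, hx⟩ | c, h'⟩ | b) y
  · rfl
  · rfl
  · rfl
  · rfl
  · exact stdInv_insMor_inl a a' h.symm o p _
  · exact stdInv_insMor_inl a a' h.symm o p _
  · rfl
  · exact stdInv_insMor_inl a a' h.symm o p _

end SM

end StandardEmbeddings

open SM

section Categories

variable {m : ℕ}

/-- For a family `S` of disjoint unions of open subsets of `ℝᵐ` indexed by sets, the category of
finite sets `A` with at most `k` elements, with the standard embeddings `S A ⟶ S B` as the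
morphisms from `A` to `B`. -/
abbrev EmbCat (S : Type → SM m) (k : ℕ∞) : Type 1 :=
  InducedCategory (SM m) fun A : FinLE k => S A

variable (m) in
/-- The union `(A × Dᵐ) ⨿ (ℝᵐ ∖ closure Dᵐ)` of copies of the unit ball and one antiball. -/
abbrev ballsAndAntiball (A : Type) : SM m := addAnti.obj (balls m A)

variable (m) in
/-- The discrete category `ᵟF_k(B_m)`: its objects are the finite sets with at most `k` elements,
and its morphisms `A ⟶ B` are the standard embeddings `A × Dᵐ ⟶ B × Dᵐ`. -/
abbrev BallCat (k : ℕ∞) : Type 1 := EmbCat (balls m) k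

variable (m) in
/-- The discrete category `ᵟΓ̃_k(B_m)`: its objects are the unions of at most `k` standard balls
and one antiball, indexed by the pointed finite sets with at most `k + 1` elements (such a pointed
set is represented by the complement of its basepoint), and its morphisms are the standard
embeddings. -/
abbrev AntiballCat (k : ℕ∞) : Type 1 := EmbCat (ballsAndAntiball m) k

variable (S : Type → SM m)

/-- The inclusion of the full subcategory of the sets with at most `k` elements. -/
def EmbCat.incl {k j : ℕ∞} (h : k ≤ j) : EmbCat S k ⥤ EmbCat S j where
  obj A := FinLE.ofLE h A
  map f := InducedCategory.homMk f.hom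

/-- The contravariant functor `ᵟsEmb(-, M)`. -/
abbrev sEmb (k : ℕ∞) (M : TopologicalSpace.Opens (Euc m)) : (EmbCat S k)ᵒᵖ ⥤ Type :=
  (inducedFunctor _).op ⋙ yoneda.obj (single M)

/-- The discrete poset of the subsets of `M` which are images of standard embeddings of `S A`
with `A` a finite set with at most `k` elements, ordered by inclusion. -/
abbrev ImagePoset (k : ℕ∞) (M : TopologicalSpace.Opens (Euc m)) : Type :=
  {U : Set (Euc m) // ∃ (A : FinLE k) (f : S A ⟶ single M), U = image f}

/-- The discrete poset `ᵟO^s_k(M)` of the disjoint unions of at most `k` standard balls in `M`. -/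
abbrev BallPoset (k : ℕ∞) (M : TopologicalSpace.Opens (Euc m)) : Type :=
  ImagePoset (balls m) k M

variable (m) in
/-- The discrete poset `ᵟÕ^s_k(ℝᵐ)` of the disjoint unions of the complement of a closed ball and
at most `k` standard balls in `ℝᵐ`. -/
abbrev AntiballPoset (k : ℕ∞) : Type := ImagePoset (ballsAndAntiball m) k ⊤

/-- The inclusion of posets, for `k ≤ j`. -/
def ImagePoset.incl {k j : ℕ∞} (h : k ≤ j) (M : TopologicalSpace.Opens (Euc m)) :
    ImagePoset S k M ⥤ ImagePoset S j M :=
  Monotone.functor (f := fun U => ⟨U.1, by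
    obtain ⟨A, f, hf⟩ := U.2
    exact ⟨FinLE.ofLE h A, f, hf⟩⟩) fun _ _ h => h

/-- The evaluation functor, `(A, f) ↦ f(S A)`. The category of pairs `(A, f)` with
`f ∈ sEmb(S A, M)`, which is `C ⋉ sEmb(-, M)` with `C = EmbCat S k`, is the opposite of the category
of elements of the contravariant functor `sEmb(-, M)`. -/
def ev (k : ℕ∞) (M : TopologicalSpace.Opens (Euc m)) :
    (sEmb S k M).Elements ⥤ (ImagePoset S k M)ᵒᵖ where
  obj p := .op ⟨image (M := M) p.2, p.1.unop, p.2, rfl⟩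
  map {p q} f := (homOfLE (by
    have h : f.1.unop.hom ≫ p.2 = q.2 := f.2
    change image (M := M) q.2 ⊆ image (M := M) p.2
    rw [← h]
    exact image_comp_subset _ _)).op

end Categories

section ModulesFromFunctors

variable (m : ℕ) (k : ℕ∞) (D : Type u) [Category.{v} D]

/-- The morphism of `ᵟF_k(B_m)` given by a standard embedding. -/
abbrev ballHom {m : ℕ} {k : ℕ∞} {A B : FinLE k} (f : balls m A ⟶ balls m B) :
    (show BallCat m k from A) ⟶ (show BallCat m k from B) := InducedCategory.homMk f

/-- The truncated right module over `ᵟB_m` given by a contravariant functor on `ᵟF_k(B_m)`: it has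
the same values, and the action of `p ∈ B_m(B)` is given by the standard embedding
`(A ∪ₐ B) × Dᵐ ⟶ A × Dᵐ` which is `p` on the balls indexed by `B` and the identity on the
others. -/
def toRightModule : ((BallCat m k)ᵒᵖ ⥤ D) ⥤ TruncRightModule (littleBalls m) k D where
  obj G :=
    { obj := fun A => G.obj (.op A)
      map := fun {A B} e => G.map (ballHom (A := B) (B := A) (ballsMap e.symm)).op
      map_refl := fun A => G.map_id _
      map_trans := fun e e' => by
        rw [← G.map_comp]
        rfl
      act := fun A a B _ h p => G.map (ballHom (A := A.ins a B h) (B := A) (insMor a p)).op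
      act_map := fun {A A' B B'} _ _ e a e' h h' p => by
        rw [← G.map_comp, ← G.map_comp]
        exact congrArg (fun f => G.map (ballHom (A := A'.ins (e a) B' h') (B := A) f).op)
          (ballsMap_insMor e a e' p)
      act_assoc := fun A a {B C} _ _ b h₁ h₂ h₃ p q => by
        rw [← G.map_comp, ← G.map_comp]
        exact congrArg (fun f => G.map (ballHom (A := A.ins a (Ins B b C) h₃) (B := A) f).op)
          (ballsMap_insMor_assoc a b p q)
      act_comm := fun A a a' hne {B C} _ _ h₁ h₂ h₃ h₄ p q => by
        rw [← G.map_comp, ← G.map_comp, ← G.map_comp]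
        exact congrArg (fun f => G.map
          (ballHom (A := (A.ins a' C h₂).ins (.inl ⟨a, hne⟩) B h₄) (B := A) f).op)
          (ballsMap_insMor_comm a a' hne p q)
      act_one := fun A a h => by
        rw [← G.map_comp]
        exact (congrArg (fun f => G.map (ballHom (A := A) (B := A) f).op)
          (ballsMap_insMor_one a)).trans (G.map_id _) }
  map τ :=
    { app := fun A => τ.app (.op A)
      map_app := fun e => τ.naturality _
      act_app := fun A a _ _ h p => τ.naturality _ }

/-- The morphism of `ᵟΓ̃_k(B_m)` given by a standard embedding. -/
abbrev antiballHom {m : ℕ} {k : ℕ∞} {A B : FinLE k}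
    (f : ballsAndAntiball m A ⟶ ballsAndAntiball m B) :
    (show AntiballCat m k from A) ⟶ (show AntiballCat m k from B) := InducedCategory.homMk f

/-- The functor `ᵟF_k(B_m) ⥤ ᵟΓ̃_k(B_m)` adding an antiball. -/
def addAntiball : BallCat m k ⥤ AntiballCat m k where
  obj A := A
  map f := antiballHom (addAnti.map f.hom)
  map_id A := InducedCategory.hom_ext (addAnti.map_id _)
  map_comp f g := InducedCategory.hom_ext (addAnti.map_comp _ _)

/-- The truncated weak bimodule over `ᵟB_m` given by a contravariant functor on `ᵟΓ̃_k(B_m)`. -/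
noncomputable def toWeakBimodule :
    ((AntiballCat m k)ᵒᵖ ⥤ D) ⥤ TruncWeakBimodule (littleBalls m) k D where
  obj G :=
    { toTruncRightModule := (toRightModule m k D).obj ((addAntiball m k).op ⋙ G)
      lact := fun {A} _ a B h o =>
        G.map (antiballHom (A := ⟨Ins A a B, h⟩) (B := B) (lMor o a B)).op
      lact_map := fun {A A'} _ _ {B B'} e a e' h h' o => by
        refine (G.map_comp _ _).symm.trans (Eq.trans ?_ (G.map_comp _ _))
        exact congrArg (fun f => G.map (antiballHom (A := ⟨Ins A' (e a) B', h'⟩) (B := B) f).op)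
          (addAnti_lMor e a e' o)
      lact_assoc := fun {A B} _ _ C a b h₁ h₂ h₃ o o' => by
        refine (G.map_comp _ _).symm.trans (Eq.trans ?_ (G.map_comp _ _))
        exact congrArg (fun f => G.map (antiballHom (A := ⟨Ins A a (Ins B b C), h₂⟩) (B := C) f).op)
          (addAnti_lMor_assoc a b o o')
      lact_one := fun B h => by
        refine (G.map_comp _ _).symm.trans (Eq.trans ?_ (G.map_id _))
        exact congrArg (fun f => G.map (antiballHom (A := B) (B := B) f).op) addAnti_one_lMor
      lact_act := fun {A C} _ _ B a b h₁ h₂ h₃ h₄ o p => by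
        refine (congrArg (_ ≫ ·) (G.map_comp _ _).symm).trans
          ((G.map_comp _ _).symm.trans (Eq.trans ?_ (G.map_comp _ _)))
        exact congrArg (fun f => G.map (antiballHom (A := ⟨Ins A a (Ins B b C), h₄⟩) (B := B) f).op)
          ((Category.assoc _ _ _).trans (addAnti_lMor_insMor a b o p))
      lact_act_comm := fun {A B} _ _ C a a' hne h₁ h₂ h₃ o p => by
        refine (G.map_comp _ _).symm.trans (Eq.trans ?_ (G.map_comp _ _))
        exact congrArg (fun f => G.map (antiballHom
          (A := (⟨Ins A a' C, h₁⟩ : FinLE k).ins (.inl ⟨a, hne⟩) B h₂) (B := C) f).op)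
          (addAnti_lMor_comm a a' hne o p) }
  map τ :=
    { right := (toRightModule m k D).map (Functor.whiskerLeft (addAntiball m k).op τ)
      lact_app := fun a B h o => τ.naturality _ }
  map_id G := rfl
  map_comp σ τ := rfl

end ModulesFromFunctors

section Derived

/-- For functors `L : A ⥤ H`, `T : I ⥤ H`, `L' : A ⥤ K`, `G : I ⥤ K`: bijections
`Hom(L a, T i) ≃ Hom(L' a, G i)` which are natural in `a` and `i`. -/
structure NatHomEquiv {A I H K : Type*} [Category A] [Category I] [Category H] [Category K]
    (L : A ⥤ H) (T : I ⥤ H) (L' : A ⥤ K) (G : I ⥤ K) where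
  /-- the bijections -/
  equiv : ∀ (a : A) (i : I), (L.obj a ⟶ T.obj i) ≃ (L'.obj a ⟶ G.obj i)
  naturality_left : ∀ {a a' : A} (f : a ⟶ a') (i : I) (x : L.obj a' ⟶ T.obj i),
    equiv a i (L.map f ≫ x) = L'.map f ≫ equiv a' i x
  naturality_right : ∀ (a : A) {i i' : I} (g : i ⟶ i') (x : L.obj a ⟶ T.obj i),
    equiv a i' (x ≫ T.map g) = equiv a i x ≫ G.map g

variable (D : Type u) [Category.{v} D] [ModelCategory D]

/-- The homotopy category of the model category `D`. -/
abbrev Ho : Type _ := (weakEquivalences D).Localization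

variable {D}

/-- The localization functor `(J ⥤ D) ⥤ Ho(J ⥤ D)` with respect to the objectwise weak
equivalences. -/
abbrev diagQ (J : Type*) [Category J] :
    (J ⥤ D) ⥤ ((weakEquivalences D).functorCategory J).Localization :=
  ((weakEquivalences D).functorCategory J).Q

/-- `T i` is a homotopy limit of the diagram `G i : J ⥤ D`, naturally in `i`: the functor
`holim : Ho(J ⥤ D) ⥤ Ho(D)` is right adjoint to the functor induced by the constant diagrams, so
that there are natural bijections `Hom_{Ho(D)}(d, T i) ≃ Hom_{Ho(J ⥤ D)}(const d, G i)`. -/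
abbrev HolimData {I J : Type*} [Category I] [Category J] (G : I ⥤ J ⥤ D) (T : I ⥤ Ho D) :=
  NatHomEquiv (weakEquivalences D).Q T (Functor.const J ⋙ diagQ J) (G ⋙ diagQ J)

/-- Let `X ⊗ - : D ⥤ E` be the functor of copowers of an object `X` in a category of set-valued
functors or modules, where `E` is the corresponding category of `D`-valued objects with the
levelwise weak equivalences `W`. The strict object of maps from `X` to `G` in `E` represents
`d ↦ Hom_E(X ⊗ d, G)`. The derived object of maps from `X` is right adjoint to the left derived
functor of `X ⊗ -`, which is computed by `X ⊗ d` for `d` cofibrant: `N i` is the derived object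
of maps from `X` to `G i`, naturally in `i`, if there are natural bijections
`Hom_{Ho(D)}(d, N i) ≃ Hom_{E[W⁻¹]}(X ⊗ d, G i)` for the cofibrant objects `d` of `D`. -/
abbrev DerivedMapData {I E : Type*} [Category I] [Category E] (tensor : D ⥤ E)
    (W : MorphismProperty E) (G : I ⥤ E) (N : I ⥤ Ho D) :=
  NatHomEquiv (CofibrantObject.ι ⋙ (weakEquivalences D).Q) N
    (CofibrantObject.ι ⋙ tensor ⋙ W.Q) (G ⋙ W.Q)

end Derived

section Copowers

variable {D : Type u} [Category.{v} D] [HasCoproducts.{0} D]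

/-- The functor `d ↦ X ⊗ d`, where `(X ⊗ d)(c) = ∐_{X(c)} d`, for a functor `X : J ⥤ Type`. -/
noncomputable abbrev diagTensor {J : Type*} [Category J] (X : J ⥤ Type) : D ⥤ (J ⥤ D) :=
  sigmaConst ⋙ (Functor.whiskeringLeft J Type D).obj X

variable {O : SetOperad} {k : ℕ∞}

/-- The functor `d ↦ X ⊗ d`, where `(X ⊗ d)(A) = ∐_{X(A)} d`, for a truncated right module `X`
with values in sets. -/
noncomputable def TruncRightModule.tensor (X : TruncRightModule O k Type) :
    D ⥤ TruncRightModule O k D where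
  obj d := X.mapObj (sigmaConst.obj d)
  map f :=
    { app := fun A => (sigmaConst.map f).app (X.obj A)
      map_app := fun _ => (sigmaConst.map f).naturality _
      act_app := fun _ _ _ _ _ _ => (sigmaConst.map f).naturality _ }
  map_id d := TruncRightModule.Hom.ext (by
    rw [sigmaConst.map_id]
    rfl)
  map_comp f g := TruncRightModule.Hom.ext (by
    rw [sigmaConst.map_comp]
    rfl)

/-- The functor `d ↦ X ⊗ d`, where `(X ⊗ d)(A) = ∐_{X(A)} d`, for a truncated weak bimodule `X`
with values in sets. -/
noncomputable def TruncWeakBimodule.tensor (X : TruncWeakBimodule O k Type) :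
    D ⥤ TruncWeakBimodule O k D where
  obj d := X.mapObj (sigmaConst.obj d)
  map f :=
    { right := X.toTruncRightModule.tensor.map f
      lact_app := fun _ _ _ _ => (sigmaConst.map f).naturality _ }
  map_id d := TruncWeakBimodule.Hom.ext (X.toTruncRightModule.tensor.map_id d)
  map_comp f g := TruncWeakBimodule.Hom.ext (X.toTruncRightModule.tensor.map_comp f g)

end Copowers

section WeakEquivalences

variable {D : Type u} [Category.{v} D] [ModelCategory D] (O : SetOperad) (k : ℕ∞)

variable (D) in
/-- The levelwise weak equivalences of truncated right modules. -/
def rightModuleWeq : MorphismProperty (TruncRightModule O k D) :=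
  fun _ _ f => ∀ A : FinLE k, weakEquivalences D (TruncRightModule.Hom.app f A)

variable (D) in
/-- The levelwise weak equivalences of truncated weak bimodules. -/
def weakBimoduleWeq : MorphismProperty (TruncWeakBimodule O k D) :=
  fun _ _ f => ∀ A : FinLE k, weakEquivalences D ((TruncWeakBimodule.Hom.right f).app A)

end WeakEquivalences

section ContextFree

variable {m : ℕ} (S : Type → SM m) (j : ℕ∞) (M : TopologicalSpace.Opens (Euc m))
  (D : Type u) [Category.{v} D] [ModelCategory D]

/-- A context-free functor `F`, that is, a contravariant functor on the poset of images of
standard embeddings in `M`, together with a contravariant functor `F'` on `C = EmbCat S j` such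
that `F ∘ ev` and `F' ∘ p` are naturally (weakly) equivalent functors on `C ⋉ sEmb(-, M)`, where
`p` is the projection to `C`. -/
structure ContextFree where
  /-- the functor `F` -/
  fn : (ImagePoset S j M)ᵒᵖ ⥤ D
  /-- the functor `F'` -/
  model : (EmbCat S j)ᵒᵖ ⥤ D
  /-- the equivalence between `F ∘ ev` and `F' ∘ p` -/
  equivalence : (diagQ _).obj (ev S j M ⋙ fn) ≅
    (diagQ _).obj (CategoryOfElements.π (sEmb S j M) ⋙ model)

namespace ContextFree

variable {S j M D}

/-- Morphisms of context-free functors: natural transformations of `F` and `F'` compatible with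
the equivalences. -/
@[ext]
structure Hom (F G : ContextFree S j M D) where
  /-- the natural transformation of functors on the poset -/
  fn : F.fn ⟶ G.fn
  /-- the natural transformation of functors on `EmbCat S j` -/
  model : F.model ⟶ G.model
  comm : (diagQ _).map (Functor.whiskerLeft (ev S j M) fn) ≫ G.equivalence.hom =
    F.equivalence.hom ≫
      (diagQ _).map (Functor.whiskerLeft (CategoryOfElements.π (sEmb S j M)) model)

instance : Category (ContextFree S j M D) where
  Hom := Hom
  id F := ⟨𝟙 _, 𝟙 _, by
    rw [Functor.whiskerLeft_id', Functor.whiskerLeft_id', CategoryTheory.Functor.map_id,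
      CategoryTheory.Functor.map_id, Category.id_comp, Category.comp_id]⟩
  comp f g := ⟨f.fn ≫ g.fn, f.model ≫ g.model, by
    rw [Functor.whiskerLeft_comp, Functor.whiskerLeft_comp, CategoryTheory.Functor.map_comp,
      CategoryTheory.Functor.map_comp, Category.assoc, g.comm, ← Category.assoc, f.comm, Category.assoc]⟩
  id_comp f := Hom.ext (Category.id_comp _) (Category.id_comp _)
  comp_id f := Hom.ext (Category.comp_id _) (Category.comp_id _)
  assoc f g h := Hom.ext (Category.assoc _ _ _) (Category.assoc _ _ _)

variable {k : ℕ∞} (h : k ≤ j)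

/-- The restriction of `F` to the subposet of the images of `S A` with `A` of cardinality at most
`k`, as a functor of `F`. -/
def fnAt : ContextFree S j M D ⥤ ((ImagePoset S k M)ᵒᵖ ⥤ D) where
  obj F := (ImagePoset.incl S h M).op ⋙ F.fn
  map f := Functor.whiskerLeft (ImagePoset.incl S h M).op f.fn

/-- The restriction of `F'` to the full subcategory of the sets of cardinality at most `k`, as a
functor of `F`. -/
def modelAt : ContextFree S j M D ⥤ ((EmbCat S k)ᵒᵖ ⥤ D) where
  obj F := (EmbCat.incl S h).op ⋙ F.model
  map f := Functor.whiskerLeft (EmbCat.incl S h).op f.model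

/-- `T F` is the Taylor approximation `T_k F`, naturally in `F`: the homotopy limit of `F` over
the discrete poset of the images of `S A` in `M` with `A` of cardinality at most `k`. -/
abbrev TaylorData (T : ContextFree S j M D ⥤ Ho D) := HolimData (fnAt h) T

variable [HasCoproducts.{0} D]

/-- `N F` is the derived object `hNat(ᵟsEmb(-, M), F)` of natural transformations between
contravariant functors on the category `EmbCat S k`, naturally in `F`. -/
abbrev HNatData (N : ContextFree S j M D ⥤ Ho D) :=
  DerivedMapData (diagTensor (sEmb S k M)) ((weakEquivalences D).functorCategory _) (modelAt h) N

/-- `N F` is the derived object `hRmod_{≤ k}(ᵟsEmb(-, M), F)` of maps of truncated right modules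
over `ᵟB_m`, naturally in `F`. -/
abbrev HRmodData (N : ContextFree (balls m) j M D ⥤ Ho D) :=
  DerivedMapData ((toRightModule m k Type).obj (sEmb (balls m) k M)).tensor
    (rightModuleWeq D (littleBalls m) k) (modelAt h ⋙ toRightModule m k D) N

/-- `N F` is the derived object `hWBimod_{≤ k}(ᵟsEmb(-, ℝᵐ), F)` of maps of truncated weak
bimodules over `ᵟB_m`, naturally in `F`. -/
abbrev HWBimodData (N : ContextFree (ballsAndAntiball m) j ⊤ D ⥤ Ho D) :=
  DerivedMapData ((toWeakBimodule m k Type).obj (sEmb (ballsAndAntiball m) k ⊤)).tensor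
    (weakBimoduleWeq D (littleBalls m) k) (modelAt h ⋙ toWeakBimodule m k D) N

end ContextFree

end ContextFree

end EmbCalc

open EmbCalc EmbCalc.SM

/-! Homotopy limits and derived mapping objects are characterized by functors they represent on `Ho
D`, so parts 2 and 3 reduce to natural bijections between Hom-sets of localized categories. These
bijections are obtained in three moves.

(a) The functor `ev` from pairs (A, f) to images is an equivalence (`ev_isEquivalence`). An
inclusion of images of standard embeddings comes from exactly one factorization: a ball is
connected, so it lands in one piece, and the antiball cannot land in a ball because each of its
points lies on an unbounded ray. Hence maps const d → F over the poset are maps const d → F ∘ ev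
over the pairs, and there F ∘ ev may be exchanged for F' ∘ p (`contextFreeIso`).

(b) Restriction along the projection p has a left adjoint. Since p comes from a category of
elements, this left Kan extension is a plain coproduct over X(c), with X = sEmb(-, M), and it sends
const d to X ⊗ d. The adjunction is derived by hand (`derived_bijective`): objectwise cofibrant
replacement suffices, because coproducts of weak equivalences between cofibrant objects are weak
equivalences (`weakEquivalence_sigmaMap`). No model structure on diagrams enters.

(c) Functors on C_k are replaced by truncated modules through part 1. Bijections for cofibrant d
extend to all d by functorial cofibrant replacement, and representing functors are unique by a
Yoneda argument on the localization.

Part 1 says that the module structure maps present the category of embeddings. An embedding of balls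
is a composite of bijections and of insertions `insMor`, each changing what lies in a single ball.
The truncation is the difficulty: intermediate sets must have at most k elements, and a careless
order of insertions violates this. In the normal form `TruncRightModule.Acts`, read from N(B) to
N(A), nullary insertions (which shrink the set) come before the others (which do not), and each
insertion is made at a ball that is still untouched. Normal forms exist (`exists_acts`), are closed
under composition (`Acts.comp`) and determine the action (`Acts.unique`). The last point is a
confluence argument: any admissible last insertion can be peeled off (`Acts.exists_of_fac`), by
associativity, commutativity and equivariance.

With an antiball, every embedding factors, uniquely up to bijections, as a map `lMor` coming from a
left operation followed by an embedding of balls (`exists_lMor_fac`,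
`exists_equiv_of_lMor_comp_eq`). The weak bimodule axioms are what is needed to bring composites
back to this form. -/

namespace EmbCalc

/-! ### Natural bijections between Hom-sets, and uniqueness of representing functors. -/

namespace NatHomEquiv

variable {A I H K K' : Type*} [Category A] [Category I] [Category H] [Category K] [Category K']
  {L : A ⥤ H} {T : I ⥤ H} {L' : A ⥤ K} {G : I ⥤ K} {L'' : A ⥤ K'} {G' : I ⥤ K'}

/-- The inverse bijections. -/
def symm (e : NatHomEquiv L T L' G) : NatHomEquiv L' G L T where
  equiv a i := (e.equiv a i).symm
  naturality_left f i x := by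
    rw [Equiv.symm_apply_eq, e.naturality_left, Equiv.apply_symm_apply]
  naturality_right a _ _ g x := by
    rw [Equiv.symm_apply_eq, e.naturality_right, Equiv.apply_symm_apply]

/-- The composite bijections. -/
def trans (e : NatHomEquiv L T L' G) (e' : NatHomEquiv L' G L'' G') : NatHomEquiv L T L'' G' where
  equiv a i := (e.equiv a i).trans (e'.equiv a i)
  naturality_left f i x := by
    simp only [Equiv.trans_apply, e.naturality_left, e'.naturality_left]
  naturality_right a _ _ g x := by
    simp only [Equiv.trans_apply, e.naturality_right, e'.naturality_right]

/-- The bijections given by isomorphisms of functors. -/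
def ofIso {L₁ L₂ : A ⥤ H} {T₁ T₂ : I ⥤ H} (e : L₁ ≅ L₂) (e' : T₁ ≅ T₂) :
    NatHomEquiv L₁ T₁ L₂ T₂ where
  equiv a i := (e.app a).homCongr (e'.app i)
  naturality_left f i x := by simp [Iso.homCongr]
  naturality_right a _ _ g x := by simp [Iso.homCongr]

/-- Restriction along a functor. -/
def precomp {B : Type*} [Category B] (Φ : B ⥤ A) (e : NatHomEquiv L T L' G) :
    NatHomEquiv (Φ ⋙ L) T (Φ ⋙ L') G where
  equiv b i := e.equiv (Φ.obj b) i
  naturality_left f i x := e.naturality_left (Φ.map f) i x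
  naturality_right b _ _ g x := e.naturality_right (Φ.obj b) g x

/-- Two functors which represent the same functor on the source of a localization functor are
isomorphic. -/
lemma nonempty_iso {A I H : Type*} [Category A] [Category I] [Category.{v} H]
    {L : A ⥤ H} (W : MorphismProperty A) [L.IsLocalization W] {T N : I ⥤ H}
    (e : NatHomEquiv L T L N) : Nonempty (T ≅ N) := by
  have h1 := Localization.full_whiskeringLeft L.op W.op (Type v)
  have h2 := Localization.faithful_whiskeringLeft L.op W.op (Type v)
  -- Precomposition with the opposite of the localization functor is fully faithful on presheaves,
  -- so ψ is fully faithful. An isomorphism T ≅ N may therefore be constructed after applying ψ,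
  -- where it is the given family of bijections.
  let ψ : H ⥤ (Aᵒᵖ ⥤ Type v) := yoneda ⋙ (Functor.whiskeringLeft _ _ (Type v)).obj L.op
  have hψ : ψ.FullyFaithful := Functor.FullyFaithful.ofFullyFaithful ψ
  refine ⟨(hψ.whiskeringRight I).preimageIso (X := T) (Y := N) ?_⟩
  refine NatIso.ofComponents (fun i => NatIso.ofComponents
    (fun a => (e.equiv a.unop i).toIso) ?_) ?_
  · intro a b f
    ext x
    exact e.naturality_left f.unop i x
  · intro i i' g
    ext a x
    exact e.naturality_right a.unop g x

end NatHomEquiv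

/-! ### Functors and transformations between localized categories. -/

section Localizers

variable {C₁ C₂ C₃ : Type*} [Category C₁] [Category C₂] [Category C₃]
  {W₁ : MorphismProperty C₁} {W₂ : MorphismProperty C₂} {W₃ : MorphismProperty C₃}

/-- Natural transformations between localizer morphisms are natural with respect to the morphisms
of the localized categories. -/
lemma homMap_naturality (Φ Ψ : LocalizerMorphism W₁ W₂) (τ : Φ.functor ⟶ Ψ.functor) {X Y : C₁}
    (f : W₁.Q.obj X ⟶ W₁.Q.obj Y) :
    Φ.homMap W₁.Q W₂.Q f ≫ W₂.Q.map (τ.app Y) =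
      W₂.Q.map (τ.app X) ≫ Ψ.homMap W₁.Q W₂.Q f := by
  let G := Φ.localizedFunctor W₁.Q W₂.Q
  let G' := Ψ.localizedFunctor W₁.Q W₂.Q
  let e : Φ.functor ⋙ W₂.Q ≅ W₁.Q ⋙ G := CatCommSq.iso _ _ _ _
  let e' : Ψ.functor ⋙ W₂.Q ≅ W₁.Q ⋙ G' := CatCommSq.iso _ _ _ _
  let : Localization.Lifting W₁.Q W₁ (Φ.functor ⋙ W₂.Q) G := ⟨e.symm⟩
  let : Localization.Lifting W₁.Q W₁ (Ψ.functor ⋙ W₂.Q) G' := ⟨e'.symm⟩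
  -- τ descends to the localized functors. The naturality square of σ at f is the claim, up to the
  -- comparison isomorphisms e and e'.
  let σ : G ⟶ G' := Localization.liftNatTrans W₁.Q W₁ _ _ G G' (Functor.whiskerRight τ W₂.Q)
  have hσ : ∀ Z, σ.app (W₁.Q.obj Z) = e.inv.app Z ≫ W₂.Q.map (τ.app Z) ≫ e'.hom.app Z :=
    fun Z => Localization.liftNatTrans_app _ _ _ _ _ _ _ _
  have hn := σ.naturality f
  rw [hσ, hσ] at hn
  rw [Φ.homMap_apply _ _ G e, Ψ.homMap_apply _ _ G' e']
  rw [← cancel_mono (e'.hom.app Y), ← cancel_epi (e.inv.app X)]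
  simpa using hn

/-- A functor which is an equivalence and reflects and preserves the morphisms to be inverted
induces bijections between the morphisms of the localized categories. -/
noncomputable def homEquivOfEquivalence (Φ : C₁ ⥤ C₂) [Φ.IsEquivalence]
    (h : W₁ = W₂.inverseImage Φ) (hW₂ : W₂.RespectsIso)
    {A I : Type*} [Category A] [Category I] (L : A ⥤ C₁) (T : I ⥤ C₁) :
    NatHomEquiv (L ⋙ W₁.Q) (T ⋙ W₁.Q) (L ⋙ Φ ⋙ W₂.Q) (T ⋙ Φ ⋙ W₂.Q) := by
  -- An equivalence under which the two classes correspond turns the localization functor of the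
  -- target into one of the source. Hom-sets of any two localizations at the same class agree.
  have hloc : (Φ ⋙ W₂.Q).IsLocalization W₁ := by
    refine Functor.IsLocalization.of_equivalence_source W₂.Q W₂ (Φ ⋙ W₂.Q) W₁
      Φ.asEquivalence.symm ?_ ?_ ?_
    · rw [h]
      intro X Y f hf
      refine MorphismProperty.le_isoClosure _ _ ?_
      exact (MorphismProperty.arrow_mk_iso_iff W₂
        (Arrow.isoMk (Φ.asEquivalence.counitIso.app X) (Φ.asEquivalence.counitIso.app Y)
          (Φ.asEquivalence.counit.naturality f).symm)).2 hf
    · intro X Y f hf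
      rw [h] at hf
      exact Localization.inverts W₂.Q W₂ _ hf
    · exact (Functor.associator _ _ _).symm ≪≫
        Functor.isoWhiskerRight Φ.asEquivalence.counitIso _ ≪≫ Functor.leftUnitor _
  exact
    { equiv := fun a i => Localization.homEquiv W₁ W₁.Q (Φ ⋙ W₂.Q)
      naturality_left := fun f i x => by
        rw [Functor.comp_map, Localization.homEquiv_comp, Localization.homEquiv_map]
        rfl
      naturality_right := fun a _ _ g x => by
        rw [Functor.comp_map, Localization.homEquiv_comp, Localization.homEquiv_map]
        rfl }

end Localizers

/-! ### Deriving an adjunction by a functorial replacement. -/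

section DerivedAdjunction

variable {E E' : Type*} [Category E] [Category E'] {W : MorphismProperty E}
  {W' : MorphismProperty E'} {L : E ⥤ E'} {R : LocalizerMorphism W' W} (adj : L ⊣ R.functor)
  (P : LocalizerMorphism W W) (q : P.functor ⟶ 𝟭 E) (LP : LocalizerMorphism W W')
  (hLP : LP.functor = P.functor ⋙ L)

-- The inverse sends y to the inverse of L(q_c), followed by LP(y) and the derived counit L(q) ≫ ε.
-- The left adjoint itself need not preserve weak equivalences, only its composite with the
-- replacement P. The condition `hc` says that L already has its derived value at c.
include adj hLP in
lemma derived_bijective (hq : ∀ X, W (q.app X)) (c : E) (hc : W' (L.map (q.app c))) (G : E') :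
    Function.Bijective (fun x : W'.Q.obj (L.obj c) ⟶ W'.Q.obj G =>
      W.Q.map (adj.unit.app c) ≫ R.homMap W'.Q W.Q x) := by
  obtain ⟨F, hF⟩ := LP
  obtain rfl : F = P.functor ⋙ L := hLP
  set LP : LocalizerMorphism W W' := ⟨P.functor ⋙ L, hF⟩
  have i1 : IsIso (W'.Q.map (L.map (q.app c))) := Localization.inverts W'.Q W' _ hc
  have i2 : IsIso (W.Q.map (q.app c)) := Localization.inverts W.Q W _ (hq c)
  let ψ : (W.Q.obj c ⟶ W.Q.obj (R.functor.obj G)) → (W'.Q.obj (L.obj c) ⟶ W'.Q.obj G) :=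
    fun y => inv (W'.Q.map (L.map (q.app c))) ≫ LP.homMap W.Q W'.Q y ≫
      W'.Q.map (L.map (q.app (R.functor.obj G)) ≫ adj.counit.app G)
  refine Function.bijective_iff_has_inverse.2 ⟨ψ, fun x => ?_, fun y => ?_⟩
  · let τ : (R.comp LP).functor ⟶ (LocalizerMorphism.id W').functor :=
      { app := fun G => L.map (q.app (R.functor.obj G)) ≫ adj.counit.app G
        naturality := fun X Y f => by
          have h1 := q.naturality (R.functor.map f)
          have h2 := adj.counit.naturality f
          dsimp at h1 h2
          have h3 : L.map (P.functor.map (R.functor.map f)) ≫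
              L.map (q.app (R.functor.obj Y)) ≫ adj.counit.app Y =
              (L.map (q.app (R.functor.obj X)) ≫ adj.counit.app X) ≫ f := by
            rw [← L.map_comp_assoc, h1, L.map_comp_assoc, h2, Category.assoc]
          exact h3 }
    have hτ := homMap_naturality _ _ τ x
    rw [LocalizerMorphism.id_homMap] at hτ
    dsimp only [ψ]
    rw [IsIso.inv_comp_eq, LocalizerMorphism.homMap_comp, LocalizerMorphism.homMap_map,
      LocalizerMorphism.homMap_homMap]
    refine (Category.assoc _ _ _).trans ((congrArg _ hτ).trans ((Category.assoc _ _ _).symm.trans ?_))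
    refine congrArg (· ≫ x) ((W'.Q.map_comp _ _).symm.trans (congrArg W'.Q.map ?_))
    have h1 := q.naturality (adj.unit.app c)
    dsimp at h1
    have h2 : L.map (P.functor.map (adj.unit.app c)) ≫
        L.map (q.app (R.functor.obj (L.obj c))) ≫ adj.counit.app (L.obj c) = L.map (q.app c) := by
      rw [← L.map_comp_assoc, h1, L.map_comp_assoc, adj.left_triangle_components, Category.comp_id]
    exact h2
  · let τ : P.functor ⟶ (LP.comp R).functor :=
      { app := fun X => adj.unit.app (P.functor.obj X)
        naturality := fun X Y f => adj.unit.naturality (P.functor.map f) }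
    have hτ := homMap_naturality P (LP.comp R) τ y
    have hq' := homMap_naturality P (LocalizerMorphism.id W) q y
    rw [LocalizerMorphism.id_homMap] at hq'
    -- After precomposition with the invertible q_c, the comparison takes place on P c, where the
    -- unit is natural with respect to y.
    rw [← cancel_epi (W.Q.map (q.app c))]
    refine Eq.trans ?_ hq'
    have h1 : W.Q.map (q.app c) ≫ W.Q.map (adj.unit.app c) =
        W.Q.map (adj.unit.app (P.functor.obj c)) ≫
          R.homMap W'.Q W.Q (W'.Q.map (L.map (q.app c))) := by
      rw [LocalizerMorphism.homMap_map, ← Functor.map_comp, ← Functor.map_comp]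
      congr 1
      exact adj.unit.naturality (q.app c)
    change W.Q.map (q.app c) ≫ W.Q.map (adj.unit.app c) ≫ R.homMap W'.Q W.Q (ψ y) = _
    rw [reassoc_of% h1, ← LocalizerMorphism.homMap_comp]
    dsimp only [ψ]
    rw [IsIso.hom_inv_id_assoc, LocalizerMorphism.homMap_comp, LocalizerMorphism.homMap_homMap,
      LocalizerMorphism.homMap_map]
    refine (Category.assoc _ _ _).symm.trans ((congrArg (· ≫ _) hτ.symm).trans
      ((Category.assoc _ _ _).trans (congrArg (_ ≫ ·)
        ((W.Q.map_comp _ _).symm.trans (congrArg W.Q.map ?_)))))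
    have h3 := adj.unit.naturality (q.app (R.functor.obj G))
    dsimp at h3
    have h4 : adj.unit.app (P.functor.obj (R.functor.obj G)) ≫
        R.functor.map (L.map (q.app (R.functor.obj G)) ≫ adj.counit.app G) =
          q.app (R.functor.obj G) := by
      rw [Functor.map_comp, ← reassoc_of% h3, adj.right_triangle_components, Category.comp_id]
    exact h4

/-- The derived adjunction bijections for objects on which the left adjoint needs no
correction. -/
noncomputable def derivedHomEquiv (hq : ∀ X, W (q.app X)) {A I : Type*} [Category A] [Category I]
    (c : A ⥤ E) (hc : ∀ a, W' (L.map (q.app (c.obj a)))) (G : I ⥤ E') :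
    NatHomEquiv (c ⋙ L ⋙ W'.Q) (G ⋙ W'.Q) (c ⋙ W.Q) (G ⋙ R.functor ⋙ W.Q) where
  equiv a i := Equiv.ofBijective _ (derived_bijective adj P q LP hLP hq (c.obj a) (hc a) (G.obj i))
  naturality_left f i x := by
    dsimp
    rw [LocalizerMorphism.homMap_comp, LocalizerMorphism.homMap_map, ← Functor.map_comp_assoc,
      ← Functor.map_comp_assoc]
    congr 2
    exact (adj.unit.naturality (c.map f)).symm
  naturality_right a _ _ g x := by
    dsimp
    rw [LocalizerMorphism.homMap_comp, LocalizerMorphism.homMap_map, Category.assoc]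

end DerivedAdjunction

/-! ### Passing between cofibrant objects and all objects. -/

section CofibrantReplacement

variable (D : Type u) [Category.{v} D] [ModelCategory D]

/-- A functorial cofibrant replacement. -/
structure CofibrantReplacement where
  /-- the functor -/
  functor : D ⥤ CofibrantObject D
  /-- the augmentation -/
  aug : functor ⋙ CofibrantObject.ι ⟶ 𝟭 D
  weq (d : D) : weakEquivalences D (aug.app d)

lemma nonempty_cofibrantReplacement
    [h : (cofibrations D).HasFunctorialFactorization (trivialFibrations D)] :
    Nonempty (CofibrantReplacement D) := by
  obtain ⟨data⟩ := h.nonempty_functorialFactorizationData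
  -- The replacement of d is the middle object in the functorial factorization of the map from the
  -- initial object to d.
  let Φ : D ⥤ Arrow D :=
    { obj := fun d => Arrow.mk (initial.to d)
      map := fun f => Arrow.homMk (𝟙 _) f (by simp) }
  have hcof : ∀ d, IsCofibrant ((Φ ⋙ data.Z).obj d) := fun d => by
    have := data.hi (Arrow.mk (initial.to d))
    rw [← cofibration_iff] at this
    exact (isCofibrant_iff_of_isInitial (data.i.app (Arrow.mk (initial.to d)))
      initialIsInitial).2 this
  refine ⟨⟨(cofibrantObjects D).lift (Φ ⋙ data.Z) hcof,
    { app := fun d => data.p.app (Φ.obj d)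
      naturality := fun _ _ f => data.p.naturality (Φ.map f) }, fun d => ?_⟩⟩
  exact (data.hp (Arrow.mk (initial.to d))).2

variable {D}

/-- The augmentation is an isomorphism after inverting weak equivalences. -/
noncomputable def CofibrantReplacement.compIso (c : CofibrantReplacement D) {H : Type*}
    [Category H] {L : D ⥤ H} (hL : (weakEquivalences D).IsInvertedBy L) :
    c.functor ⋙ CofibrantObject.ι ⋙ L ≅ L :=
  NatIso.ofComponents (fun d => haveI := hL _ (c.weq d); asIso (L.map (c.aug.app d)))
    (fun f => by
      have h := congrArg L.map (c.aug.naturality f)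
      rw [L.map_comp, L.map_comp] at h
      exact h)

/-- Bijections which are natural in cofibrant objects extend to all objects. -/
noncomputable def NatHomEquiv.extend (c : CofibrantReplacement D) {I H K : Type*} [Category I]
    [Category H] [Category K] {L : D ⥤ H} {T : I ⥤ H} {L' : D ⥤ K} {G : I ⥤ K}
    (hL : (weakEquivalences D).IsInvertedBy L) (hL' : (weakEquivalences D).IsInvertedBy L')
    (e : NatHomEquiv (CofibrantObject.ι ⋙ L) T (CofibrantObject.ι ⋙ L') G) :
    NatHomEquiv L T L' G :=
  (NatHomEquiv.ofIso (c.compIso hL).symm (Iso.refl T)).trans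
    ((e.precomp c.functor).trans (NatHomEquiv.ofIso (c.compIso hL') (Iso.refl G)))

end CofibrantReplacement

/-! ### Coproducts of weak equivalences between cofibrant objects. -/

section Coproducts

variable {D : Type u} [Category.{v} D] [ModelCategory D] [HasCoproducts.{0} D]

/-- Ken Brown's argument: each map is i ≫ p where p has a section s, and both i and s are trivial
cofibrations. Trivial cofibrations are closed under coproducts, and two-out-of-three applied to s ≫
p = 𝟙 handles the coproduct of the p. -/
lemma weakEquivalence_sigmaMap {J : Type} {X Y : J → D} (f : ∀ j, X j ⟶ Y j)
    (hX : ∀ j, IsCofibrant (X j)) (hY : ∀ j, IsCofibrant (Y j))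
    (hf : ∀ j, weakEquivalences D (f j)) : weakEquivalences D (Limits.Sigma.map f) := by
  have key : ∀ {A B : J → D} (g : ∀ j, A j ⟶ B j), (∀ j, trivialCofibrations D (g j)) →
      weakEquivalences D (Limits.Sigma.map g) := fun g hg =>
    (MorphismProperty.colimMap (W := trivialCofibrations D)
      (Discrete.natTrans (F := Discrete.functor _) (G := Discrete.functor _) fun j => g j.as)
      (fun j => hg j.as)).2
  have hw : ∀ j, WeakEquivalence (f j) := fun j => (weakEquivalence_iff _).2 (hf j)
  let b (j : J) : CofibrantBrownFactorization (f j) := Classical.arbitrary _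
  have hi := key (fun j => (b j).i) fun j =>
    (mem_trivialCofibrations_iff _).2 ⟨(cofibration_iff _).2 (b j).hi, inferInstance⟩
  have hs := key (fun j => (b j).s) fun j => (mem_trivialCofibrations_iff _).2
    ⟨inferInstance, inferInstance⟩
  have hp : weakEquivalences D (Limits.Sigma.map fun j => (b j).p) := by
    refine MorphismProperty.of_precomp _ (Limits.Sigma.map fun j => (b j).s) _ hs ?_
    have : (Limits.Sigma.map fun j => (b j).s) ≫ (Limits.Sigma.map fun j => (b j).p) = 𝟙 _ := by
      ext j
      simp
    rw [this]
    exact MorphismProperty.id_mem _ _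
  have : Limits.Sigma.map f = (Limits.Sigma.map fun j => (b j).i) ≫
      (Limits.Sigma.map fun j => (b j).p) := by
    ext j
    simp
  rw [this]
  exact MorphismProperty.comp_mem _ _ _ hi hp

end Coproducts

/-! ### The left Kan extension along a category of elements, as a coproduct. -/

section KanExtension

variable {D : Type u} [Category.{v} D] [HasCoproducts.{0} D] {C : Type*} [Category C]
  (X : C ⥤ Type)

/-- A pair `(c, x)` as an object of the category of elements. -/
abbrev elt {c : C} (x : X.obj c) : X.Elements := ⟨c, x⟩

variable {X} in
/-- A morphism in the category of elements. -/
abbrev eltHom {c c' : C} (f : c ⟶ c') {x : X.obj c} {x' : X.obj c'} (h : X.map f x = x') :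
    elt X x ⟶ elt X x' := CategoryOfElements.homMk _ _ f h

-- The functor laws below produce summand indices that are equal only propositionally. Substituting
-- here, once, avoids transports there.
variable {X} in
lemma map_eltHom_ι (H : X.Elements ⥤ D) {c c' : C} (f : c ⟶ c') {x : X.obj c} {x' : X.obj c'}
    (h : X.map f x = x') :
    H.map (eltHom f (rfl : X.map f x = X.map f x)) ≫
      Limits.Sigma.ι (fun x : X.obj c' => H.obj (elt X x)) (X.map f x) =
    H.map (eltHom f h) ≫ Limits.Sigma.ι (fun x : X.obj c' => H.obj (elt X x)) x' := by
  subst h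
  rfl

/-- The left Kan extension of a functor along the discrete opfibration of elements of `X`. -/
noncomputable def elementsLanObj (H : X.Elements ⥤ D) : C ⥤ D where
  obj c := ∐ fun x : X.obj c => H.obj (elt X x)
  map {c c'} f := Limits.Sigma.desc fun x =>
    H.map (eltHom f rfl) ≫ Limits.Sigma.ι (fun x : X.obj c' => H.obj (elt X x)) (X.map f x)
  map_id c := by
    refine Limits.Sigma.hom_ext _ _ fun x => ?_
    rw [Limits.Sigma.ι_desc, map_eltHom_ι H (𝟙 c) (x' := x) (by simp)]
    have : eltHom (𝟙 c) (by simp : X.map (𝟙 c) x = x) = 𝟙 (elt X x) := rfl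
    rw [this, H.map_id, Category.id_comp, Category.comp_id]
  map_comp {c c' c''} f g := by
    refine Limits.Sigma.hom_ext _ _ fun x => ?_
    rw [Limits.Sigma.ι_desc, Limits.Sigma.ι_desc_assoc, Category.assoc, Limits.Sigma.ι_desc,
      map_eltHom_ι H (f ≫ g) (x' := X.map g (X.map f x)) (by simp), ← Category.assoc,
      ← H.map_comp]
    rfl

variable {X}

/-- The structure maps of the left Kan extension. -/
noncomputable def lanι (H : X.Elements ⥤ D) {c : C} (x : X.obj c) :
    H.obj (elt X x) ⟶ (elementsLanObj X H).obj c :=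
  Limits.Sigma.ι (fun x : X.obj c => H.obj (elt X x)) x

lemma lanι_map (H : X.Elements ⥤ D) {c c' : C} (f : c ⟶ c') {x : X.obj c} {x' : X.obj c'}
    (h : X.map f x = x') :
    lanι H x ≫ (elementsLanObj X H).map f = H.map (eltHom f h) ≫ lanι H x' := by
  subst h
  exact Limits.Sigma.ι_desc _ _

lemma lan_hom_ext {H : X.Elements ⥤ D} {c : C} {d : D} {f g : (elementsLanObj X H).obj c ⟶ d}
    (h : ∀ x : X.obj c, lanι H x ≫ f = lanι H x ≫ g) : f = g :=
  Limits.Sigma.hom_ext _ _ h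

/-- The universal property of the left Kan extension. -/
noncomputable def lanDesc {H : X.Elements ⥤ D} {c : C} {d : D}
    (s : ∀ x : X.obj c, H.obj (elt X x) ⟶ d) : (elementsLanObj X H).obj c ⟶ d :=
  Limits.Sigma.desc s

lemma lanι_desc {H : X.Elements ⥤ D} {c : C} {d : D} (s : ∀ x : X.obj c, H.obj (elt X x) ⟶ d)
    (x : X.obj c) : lanι H x ≫ lanDesc s = s x :=
  Limits.Sigma.ι_desc _ _

lemma lanι_desc_assoc {H : X.Elements ⥤ D} {c : C} {d d' : D}
    (s : ∀ x : X.obj c, H.obj (elt X x) ⟶ d) (x : X.obj c) (g : d ⟶ d') :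
    lanι H x ≫ lanDesc s ≫ g = s x ≫ g := by
  rw [← Category.assoc, lanι_desc]

/-- Functoriality of the left Kan extension. -/
noncomputable def elementsLanMap {H H' : X.Elements ⥤ D} (τ : H ⟶ H') :
    elementsLanObj X H ⟶ elementsLanObj X H' where
  app c := lanDesc fun x => τ.app (elt X x) ≫ lanι H' x
  naturality c c' f := by
    refine lan_hom_ext fun x => ?_
    rw [← Category.assoc, lanι_map H f rfl, Category.assoc, lanι_desc, lanι_desc_assoc,
      Category.assoc, lanι_map H' f rfl, τ.naturality_assoc]

lemma lanι_elementsLanMap {H H' : X.Elements ⥤ D} (τ : H ⟶ H') {c : C} (x : X.obj c) :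
    lanι H x ≫ (elementsLanMap τ).app c = τ.app (elt X x) ≫ lanι H' x :=
  lanι_desc _ _

lemma lanι_elementsLanMap_assoc {H H' : X.Elements ⥤ D} (τ : H ⟶ H') {c : C} (x : X.obj c) {d : D}
    (g : (elementsLanObj X H').obj c ⟶ d) :
    lanι H x ≫ (elementsLanMap τ).app c ≫ g = τ.app (elt X x) ≫ lanι H' x ≫ g := by
  rw [← Category.assoc, lanι_elementsLanMap, Category.assoc]

/-- Brings the map into the form to which the result on coproducts of weak equivalences applies. -/
lemma elementsLanMap_app {H H' : X.Elements ⥤ D} (τ : H ⟶ H') (c : C) :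
    (elementsLanMap τ).app c = Limits.Sigma.map fun x : X.obj c => τ.app (elt X x) :=
  lan_hom_ext fun x => (lanι_elementsLanMap τ x).trans
    (Limits.Sigma.ι_map (f := fun x : X.obj c => H.obj (elt X x))
      (g := fun x : X.obj c => H'.obj (elt X x)) (fun x => τ.app (elt X x)) x).symm

variable (X) in
/-- The left Kan extension along the discrete opfibration of elements of `X`. -/
noncomputable def elementsLan : (X.Elements ⥤ D) ⥤ (C ⥤ D) where
  obj H := elementsLanObj X H
  map τ := elementsLanMap τ
  map_id H := by
    refine NatTrans.ext (funext fun c => lan_hom_ext fun x => ?_)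
    rw [lanι_elementsLanMap, NatTrans.id_app, NatTrans.id_app, Category.id_comp, Category.comp_id]
  map_comp σ τ := by
    refine NatTrans.ext (funext fun c => lan_hom_ext fun x => ?_)
    rw [lanι_elementsLanMap, NatTrans.comp_app, NatTrans.comp_app, lanι_elementsLanMap_assoc,
      lanι_elementsLanMap, Category.assoc]

/-- The morphism out of the left Kan extension given by a morphism to the restriction. -/
noncomputable def lanDescTrans {H : X.Elements ⥤ D} {G : C ⥤ D}
    (σ : H ⟶ CategoryOfElements.π X ⋙ G) : elementsLanObj X H ⟶ G where
  app c := lanDesc (d := G.obj c) fun x => σ.app (elt X x)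
  naturality c c' f := by
    refine lan_hom_ext fun x => ?_
    let s (c : C) (x : X.obj c) : H.obj (elt X x) ⟶ G.obj c := σ.app (elt X x)
    have h : H.map (eltHom f rfl) ≫ s c' (X.map f x) = s c x ≫ G.map f :=
      σ.naturality (eltHom f (rfl : X.map f x = X.map f x))
    change lanι H x ≫ (elementsLanObj X H).map f ≫ lanDesc (s c') =
      lanι H x ≫ lanDesc (s c) ≫ G.map f
    rw [← Category.assoc, lanι_map H f rfl, Category.assoc, lanι_desc, lanι_desc_assoc, h]

/-- The morphism to the restriction given by a morphism out of the left Kan extension. -/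
noncomputable def lanRestrict {H : X.Elements ⥤ D} {G : C ⥤ D}
    (τ : elementsLanObj X H ⟶ G) : H ⟶ CategoryOfElements.π X ⋙ G where
  app p := lanι H p.2 ≫ τ.app p.1
  naturality p p' f := by
    have h : lanι H p.2 ≫ (elementsLanObj X H).map f.1 = H.map f ≫ lanι H p'.2 :=
      lanι_map H f.1 f.2
    refine (Category.assoc _ _ _).symm.trans ((congrArg (· ≫ τ.app p'.1) h.symm).trans ?_)
    exact (Category.assoc _ _ _).trans ((congrArg (lanι H p.2 ≫ ·) (τ.naturality f.1)).trans
      (Category.assoc _ _ _).symm)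

variable (X) in
/-- The left Kan extension is left adjoint to the restriction. -/
noncomputable def elementsLanAdj : elementsLan (D := D) X ⊣
    (Functor.whiskeringLeft _ _ D).obj (CategoryOfElements.π X) :=
  Adjunction.mkOfHomEquiv
    { homEquiv := fun H G =>
        { toFun := fun τ => lanRestrict τ
          invFun := fun σ => lanDescTrans σ
          left_inv := fun τ => NatTrans.ext (funext fun c => lan_hom_ext fun x => lanι_desc _ _)
          right_inv := fun σ => NatTrans.ext (funext fun p => lanι_desc _ _) }
      homEquiv_naturality_left_symm := fun {H' H G} f g => by
        refine NatTrans.ext (funext fun c => lan_hom_ext fun x => ?_)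
        refine (lanι_desc _ _).trans ?_
        refine Eq.trans ?_ (lanι_elementsLanMap_assoc f x _).symm
        exact congrArg (f.app (elt X x) ≫ ·)
          (lanι_desc (d := G.obj c) (fun x => g.app (elt X x)) x).symm
      homEquiv_naturality_right := fun f g =>
        NatTrans.ext (funext fun p => (Category.assoc _ _ _).symm) }

variable (X) in
/-- The left Kan extension of a constant functor is a copower of `X`. -/
noncomputable def elementsLanConst :
    Functor.const X.Elements ⋙ elementsLan X ≅ diagTensor (D := D) X :=
  -- At c both sides are the same coproduct of copies of d over X(c), so only the transition maps
  -- have to be compared.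
  NatIso.ofComponents (fun d => NatIso.ofComponents
    (fun c => (Iso.refl _ : (∐ fun _ : X.obj c => d) ≅ ∐ fun _ : X.obj c => d)) (fun f => by
      refine lan_hom_ext fun x => ?_
      refine (congrArg (_ ≫ ·) (Category.comp_id _)).trans ?_
      refine Eq.trans ?_ (congrArg (_ ≫ ·) (Category.id_comp _).symm)
      refine (lanι_map ((Functor.const X.Elements).obj d) f rfl).trans ?_
      exact (Limits.Sigma.ι_comp_map' (f := fun _ => d) (g := fun _ => d) (X.map f)
        (fun _ => 𝟙 d) x).symm)) (fun f => by
    refine NatTrans.ext (funext fun c => ?_)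
    exact (Category.comp_id _).trans (Category.id_comp _).symm)

end KanExtension

/-! ### Derived maps over the category of elements as derived maps out of copowers. -/

section HomotopyKanExtension

variable {D : Type u} [Category.{v} D] [ModelCategory D] [HasCoproducts.{0} D]
  {C : Type*} [Category C] (X : C ⥤ Type)

/-- Restriction along a functor, as a morphism of localizers of diagram categories. -/
def whiskerLocalizer {J J' : Type*} [Category J] [Category J'] (Φ : J ⥤ J') :
    LocalizerMorphism ((weakEquivalences D).functorCategory J')
      ((weakEquivalences D).functorCategory J) where
  functor := (Functor.whiskeringLeft _ _ D).obj Φ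
  map := fun _ _ _ h j => h (Φ.obj j)

variable {X} in
lemma elementsLanMap_weakEquivalence {H H' : X.Elements ⥤ D} (τ : H ⟶ H') (c : C)
    (hH : ∀ p, IsCofibrant (H.obj p)) (hH' : ∀ p, IsCofibrant (H'.obj p))
    (hτ : ∀ p, weakEquivalences D (τ.app p)) :
    weakEquivalences D ((elementsLanMap τ).app c) := by
  rw [elementsLanMap_app]
  exact weakEquivalence_sigmaMap _ (fun x => hH _) (fun x => hH' _) (fun x => hτ _)

/-- Derived maps from the constant functors on the category of elements of `X` are derived maps
from the copowers of `X`. -/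
noncomputable def elementsNatHomEquiv (c : CofibrantReplacement D) {I : Type*} [Category I]
    (G : I ⥤ C ⥤ D) :
    NatHomEquiv (CofibrantObject.ι ⋙ diagTensor X ⋙ diagQ (D := D) C) (G ⋙ diagQ C)
      (CofibrantObject.ι ⋙ Functor.const X.Elements ⋙ diagQ (D := D) _)
      (G ⋙ (Functor.whiskeringLeft _ _ D).obj (CategoryOfElements.π X) ⋙ diagQ _) :=
  -- Objectwise cofibrant replacement. It makes the coproducts in the Kan extension homotopy
  -- invariant.
  let P : LocalizerMorphism ((weakEquivalences D).functorCategory X.Elements)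
      ((weakEquivalences D).functorCategory X.Elements) :=
    { functor := (Functor.whiskeringRight _ _ _).obj (c.functor ⋙ CofibrantObject.ι)
      map := fun H H' f h p => by
        have h1 := c.aug.naturality (f.app p)
        have h2 : weakEquivalences D (c.aug.app (H.obj p) ≫ f.app p) :=
          MorphismProperty.comp_mem _ _ _ (c.weq _) (h p)
        exact MorphismProperty.of_postcomp _ _ _ (c.weq (H'.obj p)) (h1 ▸ h2) }
  let LP : LocalizerMorphism ((weakEquivalences D).functorCategory X.Elements)
      ((weakEquivalences D).functorCategory C) :=
    { functor := P.functor ⋙ elementsLan X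
      map := fun H H' f h a => elementsLanMap_weakEquivalence _ a
        (fun p => (c.functor.obj (H.obj p)).2) (fun p => (c.functor.obj (H'.obj p)).2)
        (fun p => P.map _ h p) }
  let q : P.functor ⟶ 𝟭 _ :=
    { app := fun H =>
        { app := fun p => c.aug.app (H.obj p)
          naturality := fun _ _ f => c.aug.naturality (H.map f) }
      naturality := fun H H' f => NatTrans.ext (funext fun p => c.aug.naturality (f.app p)) }
  (NatHomEquiv.ofIso (Functor.isoWhiskerLeft CofibrantObject.ι
      (Functor.isoWhiskerRight (elementsLanConst X).symm (diagQ C))) (Iso.refl _)).trans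
    (derivedHomEquiv (R := whiskerLocalizer (CategoryOfElements.π X)) (elementsLanAdj X) P q LP rfl
      (fun H p => c.weq (H.obj p)) (CofibrantObject.ι ⋙ Functor.const X.Elements)
      -- For a constant diagram with cofibrant value, the augmentation is an objectwise weak
      -- equivalence between objectwise cofibrant diagrams, so the Kan extension needs no correction
      -- there.
      (fun d a => elementsLanMap_weakEquivalence _ a (fun _ => (c.functor.obj d.1).2)
        (fun _ => d.2) (fun _ => c.weq d.1)) G)

end HomotopyKanExtension

/-! ### Exchanging F for F' and comparing Taylor approximations. -/

section ContextFreeComparison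

variable {D : Type u} [Category.{v} D] [ModelCategory D]

instance functorCategory_respectsIso (J : Type*) [Category J] :
    ((weakEquivalences D).functorCategory J).RespectsIso :=
  MorphismProperty.RespectsIso.mk _
    (fun e f hf j => (MorphismProperty.cancel_left_of_respectsIso (weakEquivalences D)
      (e.hom.app j) (f.app j)).2 (hf j))
    (fun e f hf j => (MorphismProperty.cancel_right_of_respectsIso (weakEquivalences D)
      (f.app j) (e.hom.app j)).2 (hf j))

/-- Every object of J' is isomorphic to one of the form Φ(j), and weak equivalences are invariant
under isomorphism of arrows. -/
lemma functorCategory_eq_inverseImage {J J' : Type*} [Category J] [Category J'] (Φ : J ⥤ J')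
    [Φ.EssSurj] : (weakEquivalences D).functorCategory J' =
      ((weakEquivalences D).functorCategory J).inverseImage
        ((Functor.whiskeringLeft J J' D).obj Φ) := by
  ext F G τ
  refine ⟨fun h j => h _, fun h j => ?_⟩
  have e := Φ.objObjPreimageIso j
  refine (MorphismProperty.arrow_mk_iso_iff (weakEquivalences D)
    (Arrow.isoMk (F.mapIso e) (G.mapIso e) (τ.naturality e.hom))).1 (h (Φ.objPreimage j))

variable {m : ℕ} {S : Type → SM m} {j k : ℕ∞} {M : TopologicalSpace.Opens (Euc m)} (h : k ≤ j)

/-- The inclusion of the category of pairs `(A, f)` with `A` of cardinality at most `k`. -/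
def elementsIncl : (sEmb S k M).Elements ⥤ (sEmb S j M).Elements where
  obj p := ⟨(EmbCat.incl S h).op.obj p.1, p.2⟩
  map f := CategoryOfElements.homMk _ _ ((EmbCat.incl S h).op.map f.1) f.2

/-- On a context-free functor, the restriction of `F ∘ ev` and `F' ∘ p` to the pairs `(A, f)` with
`A` of cardinality at most `k` are isomorphic after localization, naturally. -/
noncomputable def contextFreeIso :
    ContextFree.fnAt (S := S) (M := M) (D := D) h ⋙
        (Functor.whiskeringLeft _ _ D).obj (ev S k M) ⋙ diagQ _ ≅
      ContextFree.modelAt h ⋙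
        (Functor.whiskeringLeft _ _ D).obj (CategoryOfElements.π (sEmb S k M)) ⋙ diagQ _ :=
  let R := whiskerLocalizer (D := D) (elementsIncl (S := S) (M := M) h)
  -- Restriction to the smaller category of pairs preserves objectwise weak equivalences, so it acts
  -- on morphisms of the localized category, in particular on the structure isomorphism of F.
  let r {X Y} := R.homMap ((weakEquivalences D).functorCategory _).Q
    ((weakEquivalences D).functorCategory _).Q (X := X) (Y := Y)
  NatIso.ofComponents (fun F =>
    { hom := r F.equivalence.hom
      inv := r F.equivalence.inv
      hom_inv_id := by
        refine (LocalizerMorphism.homMap_comp _ _ _ _ _).symm.trans ?_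
        rw [Iso.hom_inv_id]
        exact LocalizerMorphism.homMap_id _ _ _ _
      inv_hom_id := by
        refine (LocalizerMorphism.homMap_comp _ _ _ _ _).symm.trans ?_
        rw [Iso.inv_hom_id]
        exact LocalizerMorphism.homMap_id _ _ _ _ })
    (fun {F G} f => by
      have h1 := congrArg r f.comm
      have h2 : r ((diagQ _).map (Functor.whiskerLeft (ev S j M) f.fn)) =
          (diagQ _).map (R.functor.map (Functor.whiskerLeft (ev S j M) f.fn)) :=
        LocalizerMorphism.homMap_map R _ _ _
      have h3 : r ((diagQ _).map (Functor.whiskerLeft (CategoryOfElements.π (sEmb S j M))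
            f.model)) = (diagQ _).map (R.functor.map
              (Functor.whiskerLeft (CategoryOfElements.π (sEmb S j M)) f.model)) :=
        LocalizerMorphism.homMap_map R _ _ _
      have h4 : r ((diagQ _).map (Functor.whiskerLeft (ev S j M) f.fn)) ≫ r G.equivalence.hom =
          r F.equivalence.hom ≫ r ((diagQ _).map (Functor.whiskerLeft
            (CategoryOfElements.π (sEmb S j M)) f.model)) :=
        (LocalizerMorphism.homMap_comp _ _ _ _ _).symm.trans (h1.trans
          (LocalizerMorphism.homMap_comp _ _ _ _ _))
      exact (congrArg (· ≫ r G.equivalence.hom) h2.symm).trans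
        (h4.trans (congrArg (r F.equivalence.hom ≫ ·) h3)))

/-- One direction restricts the bijections to cofibrant d and composes with e. The other extends
them from cofibrant d to all d, which is possible because d ↦ d and d ↦ const d both invert weak
equivalences after localization. -/
lemma nonempty_taylorData_iff (c : CofibrantReplacement D) {E : Type*} [Category E]
    (tensor : D ⥤ E) (W : MorphismProperty E) (G : ContextFree S j M D ⥤ E)
    (e : NatHomEquiv
      (CofibrantObject.ι ⋙ Functor.const (ImagePoset S k M)ᵒᵖ ⋙ diagQ (D := D) _)
      (ContextFree.fnAt (S := S) (M := M) (D := D) h ⋙ diagQ _)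
      (CofibrantObject.ι ⋙ tensor ⋙ W.Q) (G ⋙ W.Q)) (T : ContextFree S j M D ⥤ Ho D) :
    Nonempty (ContextFree.TaylorData h T) ↔ Nonempty (DerivedMapData tensor W G T) := by
  refine ⟨fun ⟨t⟩ => ⟨(t.precomp CofibrantObject.ι).trans e⟩, fun ⟨t⟩ => ⟨?_⟩⟩
  refine NatHomEquiv.extend c (Localization.inverts _ _) (fun X Y f hf => ?_) (t.trans e.symm)
  exact Localization.inverts (diagQ _) ((weakEquivalences D).functorCategory (ImagePoset S k M)ᵒᵖ)
    ((Functor.const (ImagePoset S k M)ᵒᵖ).map f) (fun _ => hf)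

lemma nonempty_iso_of_taylorData {T N : ContextFree S j M D ⥤ Ho D}
    (t : ContextFree.TaylorData h T) (n : ContextFree.TaylorData h N) : Nonempty (T ≅ N) :=
  (t.trans n.symm).nonempty_iso (weakEquivalences D)

variable [HasCoproducts.{0} D]

/-- Derived maps from constant functors on the poset of images are derived maps from the copowers
of `sEmb(-, M)`, naturally in context-free functors. -/
noncomputable def taylorNatHomEquiv (c : CofibrantReplacement D) [(ev S k M).IsEquivalence] :
    NatHomEquiv
      (CofibrantObject.ι ⋙ Functor.const (ImagePoset S k M)ᵒᵖ ⋙ diagQ (D := D) _)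
      (ContextFree.fnAt (S := S) (M := M) (D := D) h ⋙ diagQ _)
      (CofibrantObject.ι ⋙ diagTensor (sEmb S k M) ⋙ diagQ (D := D) _)
      (ContextFree.modelAt h ⋙ diagQ _) :=
  -- Pull back along the equivalence `ev`, exchange F ∘ ev for F' ∘ p, then apply the derived Kan
  -- extension adjunction along p.
  (homEquivOfEquivalence ((Functor.whiskeringLeft _ _ D).obj (ev S k M))
    (functorCategory_eq_inverseImage (ev S k M)) inferInstance
    (CofibrantObject.ι ⋙ Functor.const (ImagePoset S k M)ᵒᵖ) (ContextFree.fnAt h)).trans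
  ((NatHomEquiv.ofIso (Iso.refl _) (contextFreeIso h)).trans
    (elementsNatHomEquiv (sEmb S k M) c (ContextFree.modelAt h)).symm)

end ContextFreeComparison

/-! ### Inclusions of images are factorizations of embeddings. -/

namespace SM

variable {m : ℕ}

section

variable {S T : SM m} {M : TopologicalSpace.Opens (Euc m)}

/-- The value of an embedding into an open subset of `ℝᵐ`. -/
abbrev val (f : S ⟶ single M) (p : S.Pt) : Euc m := (f.toFun p).2

lemma val_injective (f : S ⟶ single M) : Function.Injective (val f) := fun _ _ h =>
  f.injective (pt_ext rfl h)

lemma single_hom_ext {f g : S ⟶ single M} (h : ∀ p, val f p = val g p) : f = g :=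
  hom_ext (fun _ _ => rfl) (fun i x => h ⟨i, x⟩)

/-- The image of a piece is the preimage of that open piece under the inverse affine map.
Connectedness arguments use these open images to separate the pieces. -/
lemma isOpen_val_piece (f : S ⟶ single M) (i : S.ι) :
    IsOpen (Set.range fun x : S.piece i => val f ⟨i, x⟩) := by
  obtain ⟨_, r, c, hr, h⟩ := f.standard i
  have : (Set.range fun x : S.piece i => val f ⟨i, x⟩) =
      (fun z => r⁻¹ • (z - c)) ⁻¹' S.piece i := by
    ext z
    constructor
    · rintro ⟨x, rfl⟩
      change r⁻¹ • (val f ⟨i, x⟩ - c) ∈ S.piece i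
      rw [show val f ⟨i, x⟩ = _ from (h x).2, add_sub_cancel_right, inv_smul_smul₀ hr.ne']
      exact x.2
    · intro hz
      refine ⟨⟨_, hz⟩, (h _).2.trans ?_⟩
      change r • r⁻¹ • (z - c) + c = z
      rw [smul_inv_smul₀ hr.ne', sub_add_cancel]
  rw [this]
  exact (S.isOpen i).preimage (by fun_prop)

/-- A preconnected subset of the image of an embedding lies in the image of a single piece. -/
lemma exists_val_eq_of_isPreconnected (f : S ⟶ single M) {Z : Set (Euc m)}
    (hZ : IsPreconnected Z) (hsub : Z ⊆ image f) {j : S.ι} {y : S.piece j}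
    (hy : val f ⟨j, y⟩ ∈ Z) : ∀ z ∈ Z, ∃ x : S.piece j, val f ⟨j, x⟩ = z := by
  suffices h : Z ⊆ Set.range fun x : S.piece j => val f ⟨j, x⟩ from fun z hz => h hz
  -- The image of piece j and the union of the images of the other pieces are disjoint open sets
  -- covering Z.
  refine hZ.subset_left_of_subset_union (isOpen_val_piece f j)
    (isOpen_iUnion fun i : {i : S.ι // i ≠ j} => isOpen_val_piece f i.1) ?_ ?_
    ⟨_, hy, ⟨y, rfl⟩⟩
  · rw [Set.disjoint_left]
    rintro _ ⟨x, rfl⟩ h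
    obtain ⟨⟨i, hi⟩, x', h⟩ := Set.mem_iUnion.1 h
    exact hi (fst_eq (val_injective f h))
  · intro z hz
    obtain ⟨⟨i, x⟩, rfl⟩ := hsub hz
    by_cases h : i = j
    · subst h
      exact .inl ⟨x, rfl⟩
    · exact .inr (Set.mem_iUnion.2 ⟨⟨i, h⟩, x, rfl⟩)

/-- An embedding factors through another one if it carries each piece into a piece. -/
lemma exists_comp_eq (f : S ⟶ single M) (g : T ⟶ single M)
    (h : ∀ i : S.ι, ∃ j : T.ι, ∀ x : S.piece i, ∃ y : T.piece j, val g ⟨j, y⟩ = val f ⟨i, x⟩) :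
    ∃ α : S ⟶ T, α ≫ g = f := by
  choose j y hy using h
  refine ⟨{ toFun := fun p => ⟨j p.1, y p.1 p.2⟩
            injective := ?_
            standard := ?_ }, ?_⟩
  · intro p q e
    refine val_injective f ?_
    rw [show val f p = _ from (hy p.1 p.2).symm, show val f q = _ from (hy q.1 q.2).symm]
    exact congrArg (val g) e
  · intro i
    obtain ⟨_, r, c, hr, hf⟩ := f.standard i
    obtain ⟨_, s, d, hs, hg⟩ := g.standard (j i)
    -- The constants solve s y + d = r x + c for y.
    refine ⟨j i, s⁻¹ * r, s⁻¹ • (c - d), mul_pos (inv_pos.2 hs) hr, fun x => ⟨rfl, ?_⟩⟩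
    have h1 := hy i x
    rw [show val g _ = _ from (hg _).2, show val f _ = _ from (hf _).2] at h1
    change (y i x : Euc m) = _
    rw [mul_smul, ← smul_add, ← add_sub_assoc, ← h1, add_sub_cancel_right, inv_smul_smul₀ hs.ne']
  · exact single_hom_ext fun p => hy p.1 p.2

/-- An injective g can be cancelled. This is what makes `ev` faithful. -/
lemma eq_of_comp_eq {f f' : S ⟶ T} (g : T ⟶ single M) (h : f ≫ g = f' ≫ g) : f = f' := by
  have h1 : ∀ p, f.toFun p = f'.toFun p := fun p =>
    g.injective (congrFun (congrArg Hom.toFun h) p)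
  exact hom_ext (fun i x => fst_eq (h1 ⟨i, x⟩)) (fun i x => val_eq (h1 ⟨i, x⟩))

end

/-- The image of the piece under f is an affine image of a preconnected set. The piece of g
containing the image of one point therefore contains all of it. -/
lemma exists_piece_of_isPreconnected {S T : SM m} {M : TopologicalSpace.Opens (Euc m)}
    (f : S ⟶ single M) (g : T ⟶ single M) (h : image f ⊆ image g) (i : S.ι)
    (hc : IsPreconnected (S.piece i)) (hn : (S.piece i).Nonempty) :
    ∃ j : T.ι, ∀ x : S.piece i, ∃ y : T.piece j, val g ⟨j, y⟩ = val f ⟨i, x⟩ := by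
  obtain ⟨x₀, hx₀⟩ := hn
  obtain ⟨⟨j, y⟩, hy⟩ := h ⟨⟨i, ⟨x₀, hx₀⟩⟩, rfl⟩
  obtain ⟨_, r, c, hr, hf⟩ := f.standard i
  have hZ : IsPreconnected (Set.range fun x : S.piece i => val f ⟨i, x⟩) := by
    have : (Set.range fun x : S.piece i => val f ⟨i, x⟩) =
        (fun x : Euc m => r • x + c) '' S.piece i := by
      ext z
      constructor
      · rintro ⟨x, rfl⟩
        exact ⟨x, x.2, (hf x).2.symm⟩
      · rintro ⟨x, hx, rfl⟩
        exact ⟨⟨x, hx⟩, (hf ⟨x, hx⟩).2⟩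
    rw [this]
    exact hc.image _ (by fun_prop)
  refine ⟨j, fun x => exists_val_eq_of_isPreconnected g hZ ?_ (y := y) ⟨⟨x₀, hx₀⟩, hy.symm⟩ _
    ⟨x, rfl⟩⟩
  rintro _ ⟨x, rfl⟩
  exact h ⟨⟨i, x⟩, rfl⟩

lemma isPreconnected_disc : IsPreconnected (disc m) := (convex_ball _ _).isPreconnected

lemma disc_nonempty : (disc m).Nonempty := ⟨0, by simp⟩

lemma balls_exists_comp_eq {A B : Type} {M : TopologicalSpace.Opens (Euc m)}
    (f : balls m A ⟶ single M) (g : balls m B ⟶ single M) (h : image f ⊆ image g) :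
    ∃ α, α ≫ g = f :=
  exists_comp_eq f g fun i =>
    exists_piece_of_isPreconnected f g h i isPreconnected_disc disc_nonempty

/-- The image of the antiball contains the rays away from its centre. -/
lemma antiball_exists_val_eq {A B : Type} {M : TopologicalSpace.Opens (Euc m)}
    (f : ballsAndAntiball m A ⟶ single M) (g : ballsAndAntiball m B ⟶ single M)
    (h : image f ⊆ image g) (x : antidisc m) :
    ∃ y : antidisc m, val g ⟨none, y⟩ = val f ⟨none, x⟩ := by
  obtain ⟨_, r, c, hr, hf⟩ := f.standard none
  have hx : 1 < ‖(x : Euc m)‖ := not_le.1 fun h => x.2 (by simpa using h)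
  have hmem : ∀ t : ℝ, 1 ≤ t → t • (x : Euc m) ∈ antidisc m := fun t ht => by
    have : 1 < t * ‖(x : Euc m)‖ := by nlinarith
    simpa [norm_smul, abs_of_pos (lt_of_lt_of_le one_pos ht)] using this
  -- The image of the ray from x away from 0. It is connected in every dimension, whereas the
  -- antiball is disconnected for m = 1.
  let Z : Set (Euc m) := (fun t : ℝ => r • t • (x : Euc m) + c) '' Set.Ici 1
  have hZ : IsPreconnected Z := isPreconnected_Ici.image _ (by fun_prop)
  have hval : ∀ t (ht : 1 ≤ t), val f ⟨none, ⟨_, hmem t ht⟩⟩ = r • t • (x : Euc m) + c :=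
    fun t ht => (hf ⟨_, hmem t ht⟩).2
  have hsub : Z ⊆ image g := by
    rintro _ ⟨t, ht, rfl⟩
    exact h ⟨⟨none, ⟨_, hmem t ht⟩⟩, hval t ht⟩
  have hfx : val f ⟨none, x⟩ = r • (x : Euc m) + c := (hf x).2
  have hxZ : val f ⟨none, x⟩ ∈ Z := ⟨1, Set.mem_Ici.2 le_rfl, by
    rw [hfx]
    simp⟩
  obtain ⟨⟨j, y⟩, hy⟩ := h ⟨⟨none, x⟩, rfl⟩
  replace hy : val g ⟨j, y⟩ = val f ⟨none, x⟩ := hy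
  have key := exists_val_eq_of_isPreconnected g hZ hsub (j := j) (y := y) (hy ▸ hxZ)
  match j, y, hy, key with
  | none, y, hy, _ => exact ⟨y, hy⟩
  | some b, y, hy, key =>
    exfalso
    obtain ⟨_, s, d, hs, hg⟩ := g.standard (some b)
    -- Then r t = s + ‖c - d‖ + r. As ‖x‖ > 1, the point r t x + c lies outside the ball of radius s
    -- around d, which is the image of the ball b under g.
    let t : ℝ := (s + ‖c - d‖) / r + 1
    have ht : 1 ≤ t := by
      have : 0 ≤ (s + ‖c - d‖) / r := by positivity
      simp only [t]
      linarith
    obtain ⟨z, hz⟩ := key _ ⟨t, ht, rfl⟩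
    have hz1 : ‖(z : Euc m)‖ < 1 := by
      have := z.2
      change (z : Euc m) ∈ disc m at this
      simpa using this
    have e : s • (z : Euc m) + d = r • t • (x : Euc m) + c := (hg z).2.symm.trans hz
    have e' : r • t • (x : Euc m) = s • (z : Euc m) - (c - d) := by
      rw [sub_sub_eq_add_sub, e, add_sub_cancel_right]
    have h1 : r * t * ‖(x : Euc m)‖ ≤ s * ‖(z : Euc m)‖ + ‖c - d‖ := by
      have := norm_sub_le (s • (z : Euc m)) (c - d)
      rw [← e'] at this
      rwa [norm_smul, norm_smul, norm_smul, Real.norm_of_nonneg hr.le, Real.norm_of_nonneg hs.le,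
        Real.norm_of_nonneg (zero_le_one.trans ht), ← mul_assoc] at this
    have h2 : r * t = s + ‖c - d‖ + r := by
      simp only [t]
      field_simp
    nlinarith [norm_nonneg (c - d), norm_nonneg (z : Euc m)]

lemma ballsAndAntiball_exists_comp_eq {A B : Type} {M : TopologicalSpace.Opens (Euc m)}
    (f : ballsAndAntiball m A ⟶ single M) (g : ballsAndAntiball m B ⟶ single M)
    (h : image f ⊆ image g) : ∃ α, α ≫ g = f :=
  exists_comp_eq f g fun
    | none => ⟨none, antiball_exists_val_eq f g h⟩
    | some i => exists_piece_of_isPreconnected f g h (some i) isPreconnected_disc disc_nonempty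

end SM

/-- A morphism of pairs is a factorization of one embedding through another: it is unique since
embeddings are injective, and by `h` it exists once the images are nested. The objects of the poset
are images by definition. -/
lemma ev_isEquivalence {m : ℕ} {S : Type → SM m} (k : ℕ∞) (M : TopologicalSpace.Opens (Euc m))
    (h : ∀ {A B : Type} (f : S A ⟶ single M) (g : S B ⟶ single M), image f ⊆ image g →
      ∃ α, α ≫ g = f) : (ev S k M).IsEquivalence where
  faithful := ⟨fun {p q} α β _ => by
    have h1 : α.1.unop.hom ≫ p.2 = q.2 := α.2
    have h2 : β.1.unop.hom ≫ p.2 = q.2 := β.2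
    have h3 : α.1.unop = β.1.unop := InducedCategory.hom_ext (eq_of_comp_eq _ (h1.trans h2.symm))
    exact Subtype.ext (Quiver.Hom.unop_inj h3)⟩
  full := ⟨fun {p q} α => by
    have h1 : image (M := M) q.2 ⊆ image (M := M) p.2 := leOfHom α.unop
    obtain ⟨β, hβ⟩ := h _ _ h1
    exact ⟨CategoryOfElements.homMk _ _
      (InducedCategory.homMk β : q.1.unop ⟶ p.1.unop).op hβ, rfl⟩⟩
  essSurj := ⟨fun U => by
    obtain ⟨A, f, hf⟩ := U.unop.2
    exact ⟨⟨.op A, f⟩, ⟨eqToIso (congrArg Opposite.op (Subtype.ext hf.symm))⟩⟩⟩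

instance {m : ℕ} (k : ℕ∞) (M : TopologicalSpace.Opens (Euc m)) :
    (ev (balls m) k M).IsEquivalence :=
  ev_isEquivalence k M balls_exists_comp_eq

instance {m : ℕ} (k : ℕ∞) (M : TopologicalSpace.Opens (Euc m)) :
    (ev (ballsAndAntiball m) k M).IsEquivalence :=
  ev_isEquivalence k M ballsAndAntiball_exists_comp_eq

/-! ### Embeddings of balls as index maps with self-maps of the disc; splitting off one fibre. -/

namespace SM

variable {m : ℕ} {A B C : Type}

/-- The index of the ball into which the ball with index `a` is mapped. -/
def idx (f : balls m A ⟶ balls m B) (a : A) : B := (f.toFun ⟨a, ⟨0, by simp⟩⟩).1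

/-- The self-map of the unit ball which an embedding restricts to on the ball with index `a`. -/
def dsk (f : balls m A ⟶ balls m B) (a : A) (x : disc m) : disc m := (f.toFun ⟨a, x⟩).2

/-- The target index is constant on each ball, so it can be read off at the centre. -/
lemma toFun_eq (f : balls m A ⟶ balls m B) (a : A) (x : disc m) :
    f.toFun ⟨a, x⟩ = ⟨idx f a, dsk f a x⟩ := by
  obtain ⟨j, r, c, -, h⟩ := f.standard a
  exact pt_ext ((h x).1.trans (h _).1.symm) rfl

lemma dsk_standard (f : balls m A ⟶ balls m B) (a : A) :
    ∃ (r : ℝ) (c : Euc m), 0 < r ∧ ∀ x, (dsk f a x : Euc m) = r • (x : Euc m) + c := by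
  obtain ⟨j, r, c, hr, h⟩ := f.standard a
  exact ⟨r, c, hr, fun x => (h x).2⟩

lemma eq_of_idx_eq_of_dsk_eq (f : balls m A ⟶ balls m B) {a a' : A} {x x' : disc m}
    (h : idx f a = idx f a') (h' : dsk f a x = dsk f a' x') : a = a' := by
  have : f.toFun ⟨a, x⟩ = f.toFun ⟨a', x'⟩ := by
    rw [toFun_eq, toFun_eq]
    exact pt_ext h (congrArg Subtype.val h')
  exact fst_eq (f.injective this)

lemma balls_ext {f g : balls m A ⟶ balls m B} (h : ∀ a, idx f a = idx g a)
    (h' : ∀ a x, dsk f a x = dsk g a x) : f = g :=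
  hom_ext (fun a x => by rw [toFun_eq, toFun_eq]; exact h a)
    (fun a x => congrArg Subtype.val (h' a x))

@[simp] lemma idx_comp (f : balls m A ⟶ balls m B) (g : balls m B ⟶ balls m C) (a : A) :
    idx (f ≫ g) a = idx g (idx f a) := by
  change (g.toFun (f.toFun _)).1 = _
  rw [toFun_eq f, toFun_eq g]

@[simp] lemma dsk_comp (f : balls m A ⟶ balls m B) (g : balls m B ⟶ balls m C) (a : A)
    (x : disc m) : dsk (f ≫ g) a x = dsk g (idx f a) (dsk f a x) := by
  refine Subtype.ext ?_
  change ((g.toFun (f.toFun _)).2 : Euc m) = _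
  rw [toFun_eq f]
  rfl

@[simp] lemma idx_ballsMap (e : A ≃ B) (a : A) : idx (m := m) (ballsMap e) a = e a := rfl

@[simp] lemma dsk_ballsMap (e : A ≃ B) (a : A) (x : disc m) : dsk (ballsMap e) a x = x := rfl

@[simp] lemma idx_insMor_inl (a : A) (q : balls m B ⟶ balls m Unit) (x : {x : A // x ≠ a}) :
    idx (insMor a q) (.inl x) = x.1 := rfl

@[simp] lemma idx_insMor_inr (a : A) (q : balls m B ⟶ balls m Unit) (b : B) :
    idx (insMor a q) (.inr b) = a := rfl

@[simp] lemma dsk_insMor_inl (a : A) (q : balls m B ⟶ balls m Unit) (x : {x : A // x ≠ a})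
    (y : disc m) : dsk (insMor a q) (.inl x) y = y := rfl

@[simp] lemma dsk_insMor_inr (a : A) (q : balls m B ⟶ balls m Unit) (b : B)
    (y : disc m) : dsk (insMor a q) (.inr b) y = dsk q b y := rfl

/-- The embedding given by a map of index sets and standard self-maps of the unit ball. -/
def ballsMk (φ : A → B) (δ : A → disc m → disc m)
    (hs : ∀ a, ∃ (r : ℝ) (c : Euc m), 0 < r ∧ ∀ x, (δ a x : Euc m) = r • (x : Euc m) + c)
    (hi : ∀ a a' x x', φ a = φ a' → δ a x = δ a' x' → a = a') : balls m A ⟶ balls m B where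
  toFun p := ⟨φ p.1, δ p.1 p.2⟩
  injective := by
    rintro ⟨a, x⟩ ⟨a', x'⟩ h
    have h1 := fst_eq h
    have h2 : (δ a x : Euc m) = δ a' x' := val_eq h
    obtain rfl := hi a a' x x' h1 (Subtype.ext h2)
    obtain ⟨r, c, hr, hd⟩ := hs a
    rw [hd, hd] at h2
    exact pt_ext rfl (smul_right_injective _ hr.ne' (add_right_cancel h2))
  standard a := by
    obtain ⟨r, c, hr, hd⟩ := hs a
    exact ⟨φ a, r, c, hr, fun x => ⟨rfl, hd x⟩⟩

@[simp] lemma idx_ballsMk (φ : A → B) (δ : A → disc m → disc m) (hs hi) (a : A) :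
    idx (ballsMk φ δ hs hi) a = φ a := rfl

@[simp] lemma dsk_ballsMk (φ : A → B) (δ : A → disc m → disc m) (hs hi) (a : A) (x : disc m) :
    dsk (ballsMk φ δ hs hi) a x = δ a x := rfl

/-- The embedding is the identity of the unit ball on the ball with index `a`. -/
def Fix (f : balls m A ⟶ balls m B) (a : A) : Prop := ∀ x, dsk f a x = x

lemma exists_std_id (x : disc m) : ((x : disc m) : Euc m) = (1 : ℝ) • (x : Euc m) + 0 := by simp

/-- The embedding `w` is the identity outside of the ball with index `x`. -/
def SuppAt (w : balls m A ⟶ balls m B) (x : B) : Prop :=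
  ∀ y, y ≠ x → ∃ a, idx w a = y ∧ Fix w a ∧ ∀ a', idx w a' = y → a' = a

/-- The embedding `v` is an isomorphism over the ball into which `x` is mapped. -/
def Clean (v : balls m A ⟶ balls m B) (x : A) : Prop :=
  Fix v x ∧ ∀ x', idx v x' = idx v x → x' = x

/-- The embedding is an inclusion of balls. -/
def IsIncl (v : balls m A ⟶ balls m B) : Prop := ∀ x, Clean v x

lemma suppAt_insMor (e : Ins B x C ≃ A) (q : balls m C ⟶ balls m Unit) :
    SuppAt (ballsMap e.symm ≫ insMor x q) x := by
  intro y hy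
  refine ⟨e (.inl ⟨y, hy⟩), by simp, fun z => by simp, fun a' h => ?_⟩
  obtain ⟨i, rfl⟩ := e.surjective a'
  congr 1
  rcases i with ⟨z, hz⟩ | c
  · simp at h
    subst h
    rfl
  · simp at h
    exact absurd h.symm hy

/-- The part of an embedding over the ball with index `x`. -/
def part (w : balls m A ⟶ balls m B) (x : B) :
    balls m {a : A // idx w a = x} ⟶ balls m Unit :=
  ballsMk (fun _ => ()) (fun a => dsk w a.1) (fun a => dsk_standard w a.1)
    (fun a a' _ _ _ h => Subtype.ext (eq_of_idx_eq_of_dsk_eq w (a.2.trans a'.2.symm) h))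

/-- Converse to `suppAt_insMor`. The embeddings supported at x are exactly those, up to bijections
of the source, through which the right structure maps at x act. -/
lemma SuppAt.exists_eq {w : balls m A ⟶ balls m B} {x : B} (hw : SuppAt w x) :
    ∃ e : Ins B x {a : A // idx w a = x} ≃ A, w = ballsMap e.symm ≫ insMor x (part w x) := by
  classical
  let φ : A → Ins B x {a : A // idx w a = x} := fun a =>
    if h : idx w a = x then .inr ⟨a, h⟩ else .inl ⟨idx w a, h⟩
  have hφ : Function.Bijective φ := by
    constructor
    · intro a a' h
      simp only [φ] at h
      split_ifs at h with h1 h2 h2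
      · exact congrArg Subtype.val (Sum.inr_injective h)
      · have := congrArg Subtype.val (Sum.inl_injective h)
        obtain ⟨a₀, -, -, h3⟩ := hw _ h1
        rw [h3 a rfl, h3 a' this.symm]
    · rintro (⟨y, hy⟩ | ⟨a, ha⟩)
      · obtain ⟨a, rfl, -⟩ := hw y hy
        exact ⟨a, by simp [φ, hy]⟩
      · exact ⟨a, by simp [φ, ha]⟩
  refine ⟨(Equiv.ofBijective φ hφ).symm, balls_ext (fun a => ?_) (fun a z => ?_)⟩
  · rw [idx_comp]
    change _ = idx (insMor x (part w x)) (φ a)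
    by_cases h : idx w a = x <;> simp [φ, h]
  · rw [dsk_comp]
    change _ = dsk (insMor x (part w x)) (φ a) z
    by_cases h : idx w a = x
    · simp only [φ, h, dite_true]
      rfl
    · obtain ⟨a₀, -, h1, h2⟩ := hw _ h
      rw [h2 a rfl]
      have : ¬ idx w a₀ = x := by rwa [← h2 a rfl]
      simp only [φ, this, dite_false, dsk_insMor_inl]
      exact h1 z

/-- The balls which are not mapped to `b`, and one more. -/
abbrev CleanIdx (f : balls m A ⟶ balls m B) (b : B) : Type := {a : A // idx f a ≠ b} ⊕ Unit

/-- The embedding which agrees with `f` away from `b` and is an isomorphism over `b`. -/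
def cleanAt (f : balls m A ⟶ balls m B) (b : B) : balls m (CleanIdx f b) ⟶ balls m B :=
  ballsMk (Sum.elim (fun a => idx f a.1) (fun _ => b))
    (fun
      | .inl a => dsk f a.1
      | .inr _ => id)
    (by
      rintro (a | _)
      · exact dsk_standard f a.1
      · exact ⟨1, 0, one_pos, exists_std_id⟩)
    (by
      rintro (a | _) (a' | _) x x' h h'
      · exact congrArg Sum.inl (Subtype.ext (eq_of_idx_eq_of_dsk_eq f h h'))
      · exact absurd h a.2
      · exact absurd h.symm a'.2
      · rfl)

open Classical in
/-- The embedding which agrees with `f` over `b` and is an isomorphism elsewhere. -/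
noncomputable def concAt (f : balls m A ⟶ balls m B) (b : B) :
    balls m A ⟶ balls m (CleanIdx f b) :=
  ballsMk (fun a => if h : idx f a = b then .inr () else .inl ⟨a, h⟩)
    (fun a => if idx f a = b then dsk f a else id)
    (fun a => by
      split_ifs
      · exact dsk_standard f a
      · exact ⟨1, 0, one_pos, exists_std_id⟩)
    (fun a a' x x' h h' => by
      split_ifs at h with h1 h2 h2
      · rw [if_pos h1, if_pos h2] at h'
        exact eq_of_idx_eq_of_dsk_eq f (h1.trans h2.symm) h'
      · exact congrArg Subtype.val (Sum.inl_injective h))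

/-- The basic decomposition step: the fibre over b is collected in one ball, which is then carried
identically onto b. If the fibre is empty, the intermediate set has one element more than A; this is
the source of all the size conditions below. -/
lemma concAt_comp_cleanAt (f : balls m A ⟶ balls m B) (b : B) : concAt f b ≫ cleanAt f b = f := by
  refine balls_ext (fun a => ?_) (fun a x => ?_)
  · by_cases h : idx f a = b <;> simp [concAt, cleanAt, h]
  · by_cases h : idx f a = b <;> simp [concAt, cleanAt, h]

lemma suppAt_concAt (f : balls m A ⟶ balls m B) (b : B) : SuppAt (concAt f b) (.inr ()) := by
  rintro (⟨a, ha⟩ | _) hy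
  · refine ⟨a, by simp [concAt, ha], fun x => by simp [concAt, ha], fun a' h => ?_⟩
    by_cases h' : idx f a' = b
    · simp [concAt, h'] at h
    · simpa [concAt, h'] using h
  · exact absurd rfl hy

lemma clean_cleanAt (f : balls m A ⟶ balls m B) (b : B) : Clean (cleanAt f b) (.inr ()) := by
  refine ⟨fun x => rfl, ?_⟩
  rintro (⟨a, ha⟩ | _) h
  · exact absurd h ha
  · rfl

lemma idx_concAt_eq_iff (f : balls m A ⟶ balls m B) (b : B) (a : A) :
    idx (concAt f b) a = .inr () ↔ idx f a = b := by
  by_cases h : idx f a = b <;> simp [concAt, h]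

/-- A factorization of an embedding which is clean at `x` is isomorphic to the canonical one. -/
lemma exists_equiv_cleanIdx {X : Type} (w : balls m A ⟶ balls m X) (v : balls m X ⟶ balls m B)
    {x : X} (hw : SuppAt w x) (hv : Clean v x) {f : balls m A ⟶ balls m B} {b : B}
    (hf : w ≫ v = f) (hb : idx v x = b) :
    ∃ i : CleanIdx f b ≃ X, cleanAt f b = ballsMap i ≫ v ∧ concAt f b ≫ ballsMap i = w := by
  subst hf hb
  have hne : ∀ a, idx (w ≫ v) a ≠ idx v x ↔ idx w a ≠ x := fun a => by
    rw [idx_comp, not_iff_not]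
    exact ⟨fun h => hv.2 _ h, fun h => by rw [h]⟩
  have hfix : ∀ a, idx w a ≠ x → Fix w a := fun a ha => by
    obtain ⟨a₀, -, h1, h2⟩ := hw _ ha
    rwa [h2 a rfl]
  let φ : CleanIdx (w ≫ v) (idx v x) → X := Sum.elim (fun a => idx w a.1) (fun _ => x)
  have hφ : Function.Bijective φ := by
    constructor
    · rintro (⟨a, ha⟩ | _) (⟨a', ha'⟩ | _) h
      · obtain ⟨a₀, -, -, h2⟩ := hw _ ((hne a).1 ha)
        exact congrArg Sum.inl (Subtype.ext ((h2 a rfl).trans (h2 a' h.symm).symm))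
      · exact absurd h ((hne a).1 ha)
      · exact absurd h.symm ((hne a').1 ha')
      · rfl
    · intro y
      by_cases hy : y = x
      · exact ⟨.inr (), hy.symm⟩
      · obtain ⟨a, rfl, -⟩ := hw y hy
        exact ⟨.inl ⟨a, (hne a).2 hy⟩, rfl⟩
  refine ⟨Equiv.ofBijective φ hφ, balls_ext ?_ ?_, balls_ext (fun a => ?_) (fun a z => ?_)⟩
  · rintro (⟨a, ha⟩ | _)
    · exact idx_comp w v a
    · rfl
  · rintro (⟨a, ha⟩ | _) z
    · refine (dsk_comp w v a z).trans ?_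
      rw [hfix a ((hne a).1 ha) z]
      rfl
    · exact (hv.1 z).symm
  · rw [idx_comp, idx_ballsMap]
    change φ _ = _
    by_cases h : idx (w ≫ v) a = idx v x
    · rw [(idx_concAt_eq_iff _ _ _).2 h]
      rw [idx_comp] at h
      exact (hv.2 _ h).symm
    · simp only [concAt, idx_ballsMk, dif_neg h]
      rfl
  · rw [dsk_comp, dsk_ballsMap]
    by_cases h : idx (w ≫ v) a = idx v x
    · simp only [concAt, dsk_ballsMk, if_pos h, dsk_comp]
      rw [idx_comp] at h
      rw [hv.2 _ h]
      exact hv.1 _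
    · simp only [concAt, dsk_ballsMk, if_neg h, id]
      exact (hfix a ((hne a).1 h) z).symm

/-- Clean factorizations over the same ball are isomorphic. -/
lemma exists_equiv_of_clean {X X' : Type} {w : balls m A ⟶ balls m X} {v : balls m X ⟶ balls m B}
    {w' : balls m A ⟶ balls m X'} {v' : balls m X' ⟶ balls m B} (h : w ≫ v = w' ≫ v')
    {x : X} {x' : X'} (hb : idx v x = idx v' x') (hw : SuppAt w x) (hv : Clean v x)
    (hw' : SuppAt w' x') (hv' : Clean v' x') :
    ∃ i : X ≃ X', v = ballsMap i ≫ v' ∧ w ≫ ballsMap i = w' := by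
  obtain ⟨i, h1, h2⟩ := exists_equiv_cleanIdx w v hw hv h hb
  obtain ⟨i', h1', h2'⟩ := exists_equiv_cleanIdx w' v' hw' hv' rfl rfl
  refine ⟨i.symm.trans i', ?_, ?_⟩
  · rw [ballsMap_trans, Category.assoc, ← h1', h1, ← Category.assoc, ← ballsMap_trans,
      Equiv.symm_trans_self, ballsMap_refl, Category.id_comp]
  · rw [ballsMap_trans, ← h2, Category.assoc, ← Category.assoc (ballsMap i), ← ballsMap_trans,
      Equiv.self_trans_symm, ballsMap_refl, Category.id_comp, h2']

end SM

/-! ### Single insertions acting on a right module: well-definedness, associativity, commutativity.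
-/

lemma exists_equiv_of_inl {X C C' : Type} (E : X ⊕ C ≃ X ⊕ C') (h : ∀ x, E (.inl x) = .inl x) :
    ∃ u : C ≃ C', ∀ c, E (.inr c) = .inr (u c) := by
  have h1 : ∀ c, ∃ c', E (.inr c) = .inr c' := fun c => by
    rcases hc : E (.inr c) with x | c'
    · exact absurd (E.injective (hc.trans (h x).symm)) Sum.inr_ne_inl
    · exact ⟨c', rfl⟩
  choose u hu using h1
  refine ⟨Equiv.ofBijective u ⟨fun c d hcd => ?_, fun c' => ?_⟩, hu⟩
  · exact Sum.inr_injective (E.injective ((hu c).trans ((congrArg _ hcd).trans (hu d).symm)))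
  · obtain ⟨x | c, hc⟩ := E.surjective (.inr c')
    · exact absurd ((h x).symm.trans hc) Sum.inl_ne_inr
    · exact ⟨c, Sum.inr_injective ((hu c).symm.trans hc)⟩

namespace TruncRightModule

variable {m : ℕ} {k : ℕ∞} {D : Type u} [Category.{v} D]
  (N : TruncRightModule (littleBalls m) k D)

/-- The embedding `w`, which is the identity outside of the ball with index `x`, acts by `n`. -/
def IsAct {Y X : FinLE k} (x : X) (w : balls m Y ⟶ balls m X) (n : N.obj X ⟶ N.obj Y) : Prop :=
  ∃ (C : Type) (_ : Finite C) (q : balls m C ⟶ balls m Unit)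
    (h : (Nat.card (Ins X x C) : ℕ∞) ≤ k) (e : Ins X x C ≃ Y),
    w = ballsMap e.symm ≫ insMor x q ∧ n = N.act X x h q ≫ N.map (A := X.ins x C h) e

variable {N}

lemma map_symm_map {A B : FinLE k} (e : A ≃ B) : N.map e.symm ≫ N.map e = 𝟙 _ := by
  rw [← N.map_trans, Equiv.symm_trans_self, N.map_refl]

lemma map_map_symm {A B : FinLE k} (e : A ≃ B) : N.map e ≫ N.map e.symm = 𝟙 _ := by
  rw [← N.map_trans, Equiv.self_trans_symm, N.map_refl]

lemma IsAct.suppAt {Y X : FinLE k} {x : X} {w : balls m Y ⟶ balls m X} {n : N.obj X ⟶ N.obj Y}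
    (h : N.IsAct x w n) : SuppAt w x := by
  obtain ⟨C, _, q, hc, e, rfl, -⟩ := h
  exact suppAt_insMor e q

lemma exists_isAct {Y X : FinLE k} {x : X} {w : balls m Y ⟶ balls m X} (hw : SuppAt w x) :
    ∃ n, N.IsAct x w n := by
  obtain ⟨e, he⟩ := hw.exists_eq
  exact ⟨_, _, inferInstance, part w x, by rw [Nat.card_congr e]; exact Y.card_le, e, he, rfl⟩

/-- Both insertions are the identity over the balls other than x, so E fixes their indices. It is
then given by a bijection C ≃ C' carrying q to q', and the claim becomes equivariance. -/
lemma act_eq_of_equiv {X : FinLE k} (x : X) {C C' : Type} [Finite C] [Finite C']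
    (q : balls m C ⟶ balls m Unit) (q' : balls m C' ⟶ balls m Unit)
    (h : (Nat.card (Ins X x C) : ℕ∞) ≤ k) (h' : (Nat.card (Ins X x C') : ℕ∞) ≤ k)
    (E : Ins X x C ≃ Ins X x C') (hE : insMor x q = ballsMap E ≫ insMor x q') :
    N.act X x h q ≫ N.map (A := X.ins x C h) (B := X.ins x C' h') E = N.act X x h' q' := by
  have h1 : ∀ z, E (.inl z) = .inl z := fun z => by
    have h2 := congrArg (fun f => idx f (.inl z)) hE
    simp only [idx_comp, idx_ballsMap, idx_insMor_inl] at h2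
    rcases h3 : E (.inl z) with z' | c
    · rw [h3] at h2
      exact congrArg Sum.inl (Subtype.ext h2.symm)
    · rw [h3] at h2
      exact absurd h2 z.2
  obtain ⟨u, hu⟩ := exists_equiv_of_inl E h1
  have hEu : E = Ins.congr (Equiv.refl X) x u := by
    refine Equiv.ext ?_
    rintro (z | c)
    · exact h1 z
    · exact hu c
  have hq : q' = ballsMap u.symm ≫ q := by
    refine balls_ext (fun _ => rfl) (fun c y => ?_)
    have h2 := congrArg (fun f => dsk f (.inr (u.symm c)) y) hE
    simp only [dsk_comp, dsk_ballsMap, idx_ballsMap, dsk_insMor_inr, hu,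
      Equiv.apply_symm_apply] at h2
    rw [dsk_comp]
    exact h2.symm
  subst hEu
  have h3 := N.act_map (Equiv.refl X) x u h h' q
  rw [N.map_refl, Category.id_comp] at h3
  rw [hq]
  exact h3

/-- Two presentations of w as an insertion at x differ by a bijection of their index sets. -/
lemma IsAct.unique {Y X : FinLE k} {x : X} {w : balls m Y ⟶ balls m X} {n n' : N.obj X ⟶ N.obj Y}
    (h : N.IsAct x w n) (h' : N.IsAct x w n') : n = n' := by
  obtain ⟨C, _, q, hc, e, he, rfl⟩ := h
  obtain ⟨C', _, q', hc', e', he', rfl⟩ := h'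
  have := act_eq_of_equiv (N := N) x q q' hc hc' (e.trans e'.symm) (by
    rw [ballsMap_trans, Category.assoc, ← he', he, ← Category.assoc, ← ballsMap_trans,
      Equiv.self_trans_symm, ballsMap_refl, Category.id_comp])
  have he : (e.trans e'.symm).trans e' = e := Equiv.ext fun z => e'.apply_symm_apply (e z)
  rw [← this, Category.assoc, ← N.map_trans]
  exact congrArg (fun e => _ ≫ N.map (A := X.ins x C hc) (B := Y) e) he.symm

end TruncRightModule

lemma trans_symm_trans {P Q R : Type} (E : P ≃ Q) (F : P ≃ R) : E.trans (E.symm.trans F) = F :=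
  Equiv.ext fun x => congrArg F (E.symm_apply_apply x)

lemma ballsMap_symm_comp {m : ℕ} {P Q R : Type} (E : P ≃ Q) (F : P ≃ R) :
    ballsMap (m := m) (E.symm.trans F).symm ≫ ballsMap E.symm = ballsMap F.symm := by
  have h : (E.symm.trans F).symm.trans E.symm = F.symm :=
    Equiv.ext fun x => E.symm_apply_apply (F.symm x)
  rw [← ballsMap_trans, h]

namespace TruncRightModule

variable {m : ℕ} {k : ℕ∞} {D : Type u} [Category.{v} D]
  {N : TruncRightModule (littleBalls m) k D}

lemma IsAct.precomp {Y Y' X : FinLE k} {x : X} {w : balls m Y ⟶ balls m X}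
    {n : N.obj X ⟶ N.obj Y} (h : N.IsAct x w n) (i : Y' ≃ Y) :
    N.IsAct (Y := Y') x (ballsMap i ≫ w) (n ≫ N.map i.symm) := by
  obtain ⟨C, _, q, hc, e, rfl, rfl⟩ := h
  refine ⟨C, inferInstance, q, hc, e.trans i.symm, ?_, ?_⟩
  · rw [← Category.assoc]
    rfl
  · rw [Category.assoc, ← N.map_trans]

lemma act_map_refl {X X' : FinLE k} (i : X ≃ X') (x : X) {C : Type} [Finite C]
    (q : balls m C ⟶ balls m Unit) (h : (Nat.card (Ins X x C) : ℕ∞) ≤ k)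
    (h' : (Nat.card (Ins X' (i x) C) : ℕ∞) ≤ k) :
    N.act X x h q ≫ N.map (A := X.ins x C h) (B := X'.ins (i x) C h')
      (Ins.congr i x (Equiv.refl C)) = N.map i ≫ N.act X' (i x) h' q := by
  refine (N.act_map i x (Equiv.refl C) h h' q).trans ?_
  rfl

lemma IsAct.postcomp {Y X X' : FinLE k} {x : X} {w : balls m Y ⟶ balls m X}
    {n : N.obj X ⟶ N.obj Y} (h : N.IsAct x w n) (i : X ≃ X') :
    N.IsAct (X := X') (i x) (w ≫ ballsMap i) (N.map i.symm ≫ n) := by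
  obtain ⟨C, _, q, hc, e, rfl, rfl⟩ := h
  have hc' : (Nat.card (Ins X' (i x) C) : ℕ∞) ≤ k := by
    rw [← Nat.card_congr (Ins.congr i x (Equiv.refl C))]
    exact hc
  refine ⟨C, inferInstance, q, hc', (Ins.congr i x (Equiv.refl C)).symm.trans e, ?_, ?_⟩
  · have h2 : insMor x q ≫ ballsMap i =
        ballsMap (Ins.congr i x (Equiv.refl C)) ≫ insMor (i x) q := by
      refine balls_ext ?_ ?_ <;> rintro (_ | _) <;> intros <;> rfl
    rw [Category.assoc, h2]
    rfl
  · have h3 := act_map_refl (N := N) i x q hc hc'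
    have h4 : N.act X x hc q = (N.map i ≫ N.act X' (i x) hc' q) ≫
        N.map (A := X'.ins (i x) C hc') (B := X.ins x C hc)
          (Ins.congr i x (Equiv.refl C)).symm := by
      rw [← h3, Category.assoc, map_map_symm, Category.comp_id]
    rw [h4]
    simp only [Category.assoc]
    rw [← N.map_trans, ← Category.assoc, map_symm_map, Category.id_comp]

/-- By the unit axiom, a bijection counts as an insertion of the operadic unit at whichever ball x
is chosen. -/
lemma isAct_ballsMap {Y X : FinLE k} (x : X) (e : Y ≃ X) :
    N.IsAct x (ballsMap e) (N.map e.symm) := by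
  have hc : (Nat.card (Ins X x Unit) : ℕ∞) ≤ k := by
    rw [Nat.card_congr (Ins.rightUnit X x)]
    exact X.card_le
  refine ⟨Unit, inferInstance, 𝟙 _, hc, (Ins.rightUnit X x).trans e.symm, ?_, ?_⟩
  · have := ballsMap_insMor_one (m := m) x
    refine Eq.trans ?_ (congrArg (ballsMap e ≫ ·) this.symm)
    rfl
  · have h1 := N.act_one X x hc
    have h2 : N.map (A := X.ins x Unit hc) (B := Y) ((Ins.rightUnit X x).trans e.symm) =
      N.map (A := X.ins x Unit hc) (B := X) (Ins.rightUnit X x) ≫ N.map e.symm := N.map_trans _ _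
    rw [h2, ← Category.assoc]
    exact (Category.id_comp _).symm.trans (congrArg (· ≫ N.map e.symm) h1.symm)

/-- Associativity: an insertion into a ball that was itself inserted at z is a single insertion at
z. -/
lemma IsAct.nested {Y X Z : FinLE k} {x : X} {z : Z} {w : balls m Y ⟶ balls m X}
    {v : balls m X ⟶ balls m Z} {n : N.obj X ⟶ N.obj Y} {n' : N.obj Z ⟶ N.obj X}
    (h : N.IsAct x w n) (h' : N.IsAct z v n') (hx : idx v x = z) :
    N.IsAct z (w ≫ v) (n' ≫ n) := by
  obtain ⟨C, _, q, hc, e, rfl, rfl⟩ := h'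
  obtain ⟨B, _, p, hb, e', rfl, rfl⟩ := h
  obtain ⟨i, rfl⟩ := e.surjective x
  rcases i with ⟨y, hy⟩ | c
  · simp at hx
    exact absurd hx hy
  have hb' : (Nat.card (Ins (Ins Z z C) (.inr c) B) : ℕ∞) ≤ k := by
    rw [Nat.card_congr (Ins.congr e (.inr c) (Equiv.refl B))]
    exact hb
  have hb'' : (Nat.card (Ins Z z (Ins C c B)) : ℕ∞) ≤ k := by
    rw [← Nat.card_congr (Ins.assoc Z z C c B)]
    exact hb'
  refine ⟨Ins C c B, inferInstance, insMor c p ≫ q, hb'',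
    (Ins.assoc Z z C c B).symm.trans ((Ins.congr e (.inr c) (Equiv.refl B)).trans e'), ?_, ?_⟩
  · rw [← ballsMap_insMor_assoc]
    have h1 := ballsMap_insMor e (.inr c) (Equiv.refl B) p
    have h2 : insMor (e (.inr c)) p ≫ ballsMap e.symm =
      ballsMap (Ins.congr e (.inr c) (Equiv.refl B)).symm ≫ insMor (Sum.inr c : Ins Z z C) p :=
      h1.symm
    rw [Category.assoc, ← Category.assoc (insMor _ p), h2, ← Category.assoc (ballsMap _)
      (ballsMap (Ins.assoc Z z C c B).symm), ballsMap_symm_comp, Category.assoc]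
    rfl
  · have h1 := N.act_assoc Z z c hc hb' hb'' q p
    have h2 := act_map_refl (N := N) (X := Z.ins z C hc) (X' := X) e (.inr c) p hb' hb
    refine Eq.trans ?_ (congrArg (· ≫ N.map (A := Z.ins z (Ins C c B) hb'') (B := Y) _) h1)
    simp only [Category.assoc]
    refine congrArg (N.act Z z hc q ≫ ·) ?_
    rw [← Category.assoc (N.map _), ← h2]
    simp only [Category.assoc, ← N.map_trans]
    rw [trans_symm_trans]

lemma card_ins {X : Type} [Finite X] (x : X) (B : Type) [Finite B] :
    Nat.card (Ins X x B) + 1 = Nat.card X + Nat.card B := by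
  classical
  have := Fintype.ofFinite X
  have h : Nat.card {y : X // y ≠ x} + 1 = Nat.card X := by
    rw [Nat.card_eq_fintype_card, Nat.card_eq_fintype_card, Fintype.card_subtype_compl,
      Fintype.card_subtype_eq]
    have : 0 < Fintype.card X := Fintype.card_pos_iff.2 ⟨x⟩
    omega
  rw [Nat.card_sum]
  omega

/-- Commutativity: insertions into two different balls of Z can be exchanged. The condition `hf`
keeps the new intermediate set within the truncation. The last two equivalences record that
emptiness of the two fibres is carried along. -/
lemma IsAct.comm {Y X Z : FinLE k} {y : Z} {x : X} {z : balls m X ⟶ balls m Z}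
    {w : balls m Y ⟶ balls m X} {nz : N.obj Z ⟶ N.obj X} {nw : N.obj X ⟶ N.obj Y}
    (hz : N.IsAct y z nz) (hw : N.IsAct x w nw) (hy : idx z x ≠ y)
    (hf : (∃ a, idx z a = y) ∨ ∀ a a', idx w a = x → idx w a' = x → a = a') :
    ∃ (X' : FinLE k) (x' : X') (z' : balls m X' ⟶ balls m Z) (w' : balls m Y ⟶ balls m X')
      (nz' : N.obj Z ⟶ N.obj X') (nw' : N.obj X' ⟶ N.obj Y),
      N.IsAct (idx z x) z' nz' ∧ N.IsAct x' w' nw' ∧ idx z' x' = y ∧ w ≫ z = w' ≫ z' ∧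
      nz ≫ nw = nz' ≫ nw' ∧ ((∃ a, idx w' a = x') ↔ ∃ a, idx z a = y) ∧
      ((∃ a, idx z' a = idx z x) ↔ ∃ a, idx w a = x) := by
  obtain ⟨C, _, q, hc, e, rfl, rfl⟩ := hz
  obtain ⟨B, _, p, hb, e', rfl, rfl⟩ := hw
  obtain ⟨i, rfl⟩ := e.surjective x
  rcases i with ⟨y', hy'⟩ | c
  swap
  · simp at hy
  have hb' : (Nat.card (Ins (Ins Z y C) (.inl ⟨y', hy'⟩) B) : ℕ∞) ≤ k := by
    rw [Nat.card_congr (Ins.congr e (.inl ⟨y', hy'⟩) (Equiv.refl B))]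
    exact hb
  have hb'' : (Nat.card (Ins (Ins Z y' B) (.inl ⟨y, hy'.symm⟩) C) : ℕ∞) ≤ k := by
    rw [← Nat.card_congr (Ins.comm Z y y' hy'.symm C B)]
    exact hb'
  have hX : (Nat.card (Ins Z y' B) : ℕ∞) ≤ k := by
    have h1 := card_ins y' B
    have h2 : Nat.card (Ins (Ins Z y' B) (.inl ⟨y, hy'.symm⟩) C) + 1 =
      Nat.card (Ins Z y' B) + Nat.card C := card_ins _ _
    -- If C is nonempty, the set `Ins Z y' B` is no larger than the final source. If B has at most
    -- one element, it is no larger than Z.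
    rcases hf with ⟨a, ha⟩ | hf
    · have hC : 0 < Nat.card C := by
        obtain ⟨i, rfl⟩ := e.surjective a
        rcases i with ⟨b, hb⟩ | c
        · simp at ha
          exact absurd ha hb
        · have : Nonempty C := ⟨c⟩
          exact Nat.card_pos
      refine le_trans ?_ hb''
      have : Nat.card (Ins Z y' B) ≤ Nat.card (Ins (Ins Z y' B) (.inl ⟨y, hy'.symm⟩) C) := by
        omega
      exact_mod_cast this
    · have hB : Nat.card B ≤ 1 := by
        rw [Finite.card_le_one_iff_subsingleton]
        refine ⟨fun b b' => ?_⟩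
        have := hf (e' (.inr b)) (e' (.inr b')) (by simp) (by simp)
        exact Sum.inr_injective (e'.injective this)
      refine le_trans ?_ Z.card_le
      have : Nat.card (Ins Z y' B) ≤ Nat.card Z := by
        omega
      exact_mod_cast this
  let E : Ins (Ins Z y' B) (.inl ⟨y, hy'.symm⟩) C ≃ Y := (Ins.comm Z y y' hy'.symm C B).symm.trans
    ((Ins.congr e (.inl ⟨y', hy'⟩) (Equiv.refl B)).trans e')
  have hy2 : idx (ballsMap e.symm ≫ insMor y q) (e (.inl ⟨y', hy'⟩)) = y' := by simp
  rw [hy2]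
  refine ⟨Z.ins y' B hX, .inl ⟨y, hy'.symm⟩, insMor y' p,
    ballsMap E.symm ≫ insMor (Sum.inl ⟨y, hy'.symm⟩ : Ins Z y' B) q,
    N.act Z y' hX p, N.act (Z.ins y' B hX) (.inl ⟨y, hy'.symm⟩) hb'' q ≫
      N.map (A := (Z.ins y' B hX).ins _ C hb'') E,
    ⟨B, inferInstance, p, hX, Equiv.refl _, rfl, ?_⟩,
    ⟨C, inferInstance, q, hb'', E, rfl, rfl⟩, rfl, ?_, ?_, ?_, ?_⟩
  · rw [N.map_refl, Category.comp_id]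
  · have h1 := ballsMap_insMor_comm y y' hy'.symm q p
    have h2 : insMor (e (.inl ⟨y', hy'⟩)) p ≫ ballsMap e.symm =
      ballsMap (Ins.congr e (.inl ⟨y', hy'⟩) (Equiv.refl B)).symm ≫
        insMor (Sum.inl ⟨y', hy'⟩ : Ins Z y C) p :=
      (ballsMap_insMor e (.inl ⟨y', hy'⟩) (Equiv.refl B) p).symm
    rw [Category.assoc, ← Category.assoc (insMor _ p), h2, Category.assoc]
    refine Eq.trans ?_ ((congrArg (ballsMap E.symm ≫ ·) h1).trans (Category.assoc _ _ _).symm)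
    refine Eq.trans ?_ (Category.assoc _ _ _)
    rw [ballsMap_symm_comp]
    rfl
  · have h1 := N.act_comm Z y y' hy'.symm hc hX hb' hb'' q p
    have h2 := act_map_refl (N := N) (X := Z.ins y C hc) (X' := X) e (.inl ⟨y', hy'⟩) p hb' hb
    rw [← Category.assoc (N.act Z y' hX p)]
    refine Eq.trans ?_ (congrArg (· ≫ N.map (A := (Z.ins y' B hX).ins _ C hb'') (B := Y) E) h1)
    simp only [Category.assoc]
    refine congrArg (N.act Z y hc q ≫ ·) ?_
    rw [← Category.assoc (N.map _), ← h2]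
    simp only [Category.assoc, ← N.map_trans]
    rw [trans_symm_trans]
  · constructor
    · rintro ⟨a, ha⟩
      obtain ⟨i, rfl⟩ := E.surjective a
      rcases i with ⟨b, hb⟩ | c
      · simp at ha
        exact absurd ha hb
      · exact ⟨e (.inr c), by simp⟩
    · rintro ⟨a, ha⟩
      obtain ⟨i, rfl⟩ := e.surjective a
      rcases i with ⟨b, hb⟩ | c
      · simp at ha
        exact absurd ha hb
      · exact ⟨E (.inr c), by simp⟩
  · constructor
    · rintro ⟨a, ha⟩
      rcases a with ⟨b, hb⟩ | c
      · exact absurd ha hb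
      · exact ⟨e' (.inr c), by simp⟩
    · rintro ⟨a, ha⟩
      obtain ⟨i, rfl⟩ := e'.surjective a
      rcases i with ⟨b, hb⟩ | c
      · simp at ha
        exact absurd ha hb
      · exact ⟨.inr c, rfl⟩

end TruncRightModule

/-! ### Clean balls and inclusions under composition. -/

namespace SM

variable {m : ℕ} {A B C : Type}

lemma SuppAt.clean {w : balls m A ⟶ balls m B} {x : B} (hw : SuppAt w x) {a : A}
    (ha : idx w a ≠ x) : Clean w a := by
  obtain ⟨a₀, -, h1, h2⟩ := hw _ ha
  have h3 := h2 a rfl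
  exact ⟨h3 ▸ h1, fun a' h => (h2 a' h).trans h3.symm⟩

lemma Clean.comp {w : balls m A ⟶ balls m B} {v : balls m B ⟶ balls m C} {a : A}
    (hw : Clean w a) (hv : Clean v (idx w a)) : Clean (w ≫ v) a := by
  refine ⟨fun x => by rw [dsk_comp, hv.1, hw.1], fun a' h => hw.2 _ (hv.2 _ ?_)⟩
  rwa [idx_comp, idx_comp] at h

lemma IsIncl.comp {w : balls m A ⟶ balls m B} {v : balls m B ⟶ balls m C}
    (hw : IsIncl w) (hv : IsIncl v) : IsIncl (w ≫ v) := fun a => (hw a).comp (hv _)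

lemma isIncl_ballsMap (e : A ≃ B) : IsIncl (m := m) (ballsMap e) :=
  fun _ => ⟨fun _ => rfl, fun _ h => e.injective h⟩

lemma SuppAt.isIncl {w : balls m A ⟶ balls m B} {x : B} (hw : SuppAt w x)
    (h : ¬ ∃ a, idx w a = x) : IsIncl w := fun a => hw.clean fun ha => h ⟨a, ha⟩

/-- Away from x, w is an isomorphism and hides nothing of v. A coincidence of indices with x itself
is excluded by cleanness of v at x. -/
lemma Clean.of_comp {w : balls m A ⟶ balls m B} {v : balls m B ⟶ balls m C} {x : B}
    (hw : SuppAt w x) (hv : Clean v x) {a : A} (ha : idx w a ≠ x) (h : Clean (w ≫ v) a) :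
    Clean v (idx w a) := by
  refine ⟨fun p => ?_, fun c hc => ?_⟩
  · have := h.1 p
    rwa [dsk_comp, (hw.clean ha).1] at this
  · by_cases hcx : c = x
    · subst hcx
      exact absurd (hv.2 _ hc.symm) ha
    · obtain ⟨a', rfl, -⟩ := hw c hcx
      rw [h.2 a' (by rw [idx_comp, idx_comp, hc])]

lemma IsIncl.of_comp_right {w : balls m A ⟶ balls m B} {v : balls m B ⟶ balls m C} {x : B}
    (hw : SuppAt w x) (hv : Clean v x) (h : IsIncl (w ≫ v)) : IsIncl v := fun c => by
  by_cases hc : c = x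
  · exact hc ▸ hv
  · obtain ⟨a, rfl, -⟩ := hw c hc
    exact Clean.of_comp hw hv hc (h a)

lemma IsIncl.of_comp_left {w : balls m A ⟶ balls m B} {v : balls m B ⟶ balls m C} {x : B}
    (hw : SuppAt w x) (hv : Clean v x) (h : IsIncl (w ≫ v)) : IsIncl w := fun a => by
  by_cases ha : idx w a = x
  · refine ⟨fun p => ?_, fun a' h' => (h a).2 a' (by rw [idx_comp, idx_comp, h'])⟩
    have := (h a).1 p
    rwa [dsk_comp, ha, hv.1] at this
  · exact hw.clean ha

lemma IsIncl.exists_equiv {f : balls m A ⟶ balls m B} (h : IsIncl f)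
    (hf : Function.Surjective (idx f)) : ∃ e : A ≃ B, f = ballsMap e :=
  ⟨Equiv.ofBijective (idx f) ⟨fun a a' h' => (h a').2 a h', hf⟩,
    balls_ext (fun _ => rfl) fun a x => (h a).1 x⟩

/-- Both factors are inclusions and hit every ball. The delicate index is x, which is hit by w
because v is injective over the image of x. -/
lemma exists_equiv_of_comp_eq_ballsMap {X : Type} {w : balls m A ⟶ balls m X}
    {v : balls m X ⟶ balls m B} {x : X} {e : A ≃ B} (h : w ≫ v = ballsMap e) (hw : SuppAt w x)
    (hv : Clean v x) :
    ∃ (i : A ≃ X) (j : X ≃ B), w = ballsMap i ∧ v = ballsMap j := by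
  have h1 : IsIncl (w ≫ v) := h ▸ isIncl_ballsMap e
  have h2 : ∀ a, idx v (idx w a) = e a := fun a => by rw [← idx_comp, h, idx_ballsMap]
  have hs : Function.Surjective (idx w) := fun y => by
    by_cases hy : y = x
    · refine ⟨e.symm (idx v x), ?_⟩
      rw [hy]
      exact hv.2 _ (by rw [h2, e.apply_symm_apply])
    · obtain ⟨a, ha, -⟩ := hw y hy
      exact ⟨a, ha⟩
  obtain ⟨i, hi⟩ := (IsIncl.of_comp_left hw hv h1).exists_equiv hs
  obtain ⟨j, hj⟩ := (IsIncl.of_comp_right hw hv h1).exists_equiv fun b =>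
    ⟨idx w (e.symm b), by rw [h2, e.apply_symm_apply]⟩
  exact ⟨i, j, hi, hj⟩

/-- A ball of the nonempty fibre takes the place of the additional index. -/
lemma card_cleanIdx_le [Finite A] (f : balls m A ⟶ balls m B) {b : B} (h : ∃ a, idx f a = b) :
    Nat.card (CleanIdx f b) ≤ Nat.card A := by
  obtain ⟨a, ha⟩ := h
  refine Nat.card_le_card_of_injective (Sum.elim Subtype.val fun _ => a) ?_
  rintro (⟨x, hx⟩ | _) (⟨y, hy⟩ | _) h
  · exact congrArg Sum.inl (Subtype.ext h)
  · have h : x = a := h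
    exact absurd ha (h ▸ hx)
  · have h : a = y := h
    exact absurd ha (h ▸ hy)
  · rfl

lemma IsIncl.card_le [Finite B] {f : balls m A ⟶ balls m B} (h : IsIncl f) :
    Nat.card A ≤ Nat.card B :=
  Nat.card_le_card_of_injective (idx f) fun _ a h' => (h a).2 _ h'

end SM

/-! ### Normal forms of embeddings and their confluence. -/

namespace TruncRightModule

variable {m : ℕ} {k : ℕ∞} {D : Type u} [Category.{v} D]

/-- The action of embeddings on a truncated right module, which is generated by the structure
maps. -/
inductive Acts (N : TruncRightModule (littleBalls m) k D) :
    {A B : FinLE k} → (balls m A ⟶ balls m B) → (N.obj B ⟶ N.obj A) → Prop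
  | iso {A B : FinLE k} (e : A ≃ B) : Acts N (A := A) (B := B) (ballsMap e) (N.map e.symm)
  -- `hc`: the new insertion is made at a ball not yet altered by v. `ha`: a nullary insertion is
  -- allowed only while v is an inclusion. Thus X has at most as many elements as A or as B, and the
  -- truncation is never left.
  | step {A X B : FinLE k} {w : balls m A ⟶ balls m X} {v : balls m X ⟶ balls m B}
    {nv : N.obj B ⟶ N.obj X} {nw : N.obj X ⟶ N.obj A} (x : X) (hv : Acts N v nv)
    (hw : N.IsAct x w nw) (hc : Clean v x) (ha : (∃ a, idx w a = x) ∨ IsIncl v) :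
    Acts N (w ≫ v) (nv ≫ nw)

variable {N : TruncRightModule (littleBalls m) k D}

lemma Acts.precomp {A A' B : FinLE k} {f : balls m A ⟶ balls m B} {n : N.obj B ⟶ N.obj A}
    (h : N.Acts f n) (i : A' ≃ A) : N.Acts (A := A') (ballsMap i ≫ f) (n ≫ N.map i.symm) := by
  cases h with
  | iso e =>
    rw [← N.map_trans]
    exact Acts.iso (A := A') (i.trans e)
  | step x hv hw hc ha =>
    rw [Category.assoc]
    refine (Category.assoc (ballsMap i) _ _) ▸ Acts.step x hv (hw.precomp i) hc ?_
    refine ha.imp_left ?_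
    rintro ⟨a, ha⟩
    exact ⟨i.symm a, by simpa using ha⟩

/-- Induction on the normal form w₁ ≫ v₁ of v. An insertion over the same ball merges with w₁ by
associativity. Otherwise, if w₁ is not nullary, it is exchanged with the new one, which moves
towards v₁. If w₁ is nullary, then v is an inclusion and the new insertion is an admissible step as
it stands. -/
lemma Acts.comp_isAct {A X B : FinLE k} {v : balls m X ⟶ balls m B} {n : N.obj B ⟶ N.obj X}
    (h : N.Acts v n) {x : X} {w : balls m A ⟶ balls m X} {nw : N.obj X ⟶ N.obj A}
    (hw : N.IsAct x w nw) : N.Acts (w ≫ v) (n ≫ nw) := by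
  induction h generalizing A with
  | iso e => exact Acts.step x (Acts.iso e) hw (isIncl_ballsMap e x) (.inr (isIncl_ballsMap e))
  | @step X X₁ B w₁ v₁ n₁ nw₁ x₁ hv₁ hw₁ hc ha ih =>
    by_cases hx : idx w₁ x = x₁
    · simpa only [Category.assoc] using ih (hw.nested hw₁ hx)
    by_cases hf : ∃ a, idx w₁ a = x₁
    · obtain ⟨X', x', z', w', nz', nw', hz', hw', h1, h2, h3, h4, -⟩ :=
        hw₁.comm hw hx (.inl hf)
      rw [← Category.assoc, h2, Category.assoc, Category.assoc, h3, ← Category.assoc n₁]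
      have h5 : Clean z' x' := hz'.suppAt.clean (by rw [h1]; exact Ne.symm hx)
      exact Acts.step x' (ih hz') hw' (h5.comp (h1 ▸ hc)) (.inl (h4.2 hf))
    · have h1 : IsIncl (w₁ ≫ v₁) := (hw₁.suppAt.isIncl hf).comp (ha.resolve_left hf)
      exact Acts.step x (Acts.step x₁ hv₁ hw₁ hc ha) hw (h1 x) (.inr h1)

lemma Acts.comp {A B C : FinLE k} {f : balls m A ⟶ balls m B} {g : balls m B ⟶ balls m C}
    {n : N.obj B ⟶ N.obj A} {n' : N.obj C ⟶ N.obj B} (h : N.Acts f n) (h' : N.Acts g n') :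
    N.Acts (f ≫ g) (n' ≫ n) := by
  induction h with
  | iso e => exact h'.precomp e
  | step x hv hw hc ha ih =>
    rw [Category.assoc, ← Category.assoc n']
    exact (ih h').comp_isAct hw

/-- Confluence: whichever normal form produced n, any admissible last insertion w can be peeled off.
If the last insertion w' of the normal form lies over the same ball of B, the two factorizations are
isomorphic. If not, the part of v' over the ball of w is peeled off v' by induction and exchanged
with w'. -/
lemma Acts.exists_of_fac {A X B : FinLE k} {f : balls m A ⟶ balls m B} {n : N.obj B ⟶ N.obj A}
    (h : N.Acts f n) {w : balls m A ⟶ balls m X} {v : balls m X ⟶ balls m B} (hf : w ≫ v = f)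
    {x : X} {nw : N.obj X ⟶ N.obj A} (hw : N.IsAct x w nw) (hc : Clean v x)
    (ha : (∃ a, idx w a = x) ∨ IsIncl v) : ∃ nv, N.Acts v nv ∧ n = nv ≫ nw := by
  induction h generalizing X with
  | iso e =>
    obtain ⟨i, j, rfl, rfl⟩ := exists_equiv_of_comp_eq_ballsMap hf hw.suppAt hc
    refine ⟨_, Acts.iso j, ?_⟩
    have h1 := hw.unique (isAct_ballsMap x i)
    subst h1
    have h2 : i.trans j = e := Equiv.ext fun a => congrArg (fun f => idx f a) hf
    rw [← h2, ← N.map_trans]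
    rfl
  | @step A X' B w' v' nv' nw' x' hv' hw' hc' ha' ih =>
    -- The case of two clean factorizations over the same ball of B, to which everything is reduced.
    have key : ∀ {X'' : FinLE k} {w'' : balls m A ⟶ balls m X''} {v'' : balls m X'' ⟶ balls m B}
        {x'' : X''} {nv'' : N.obj B ⟶ N.obj X''} {nw'' : N.obj X'' ⟶ N.obj A},
        w ≫ v = w'' ≫ v'' → idx v x = idx v'' x'' → Clean v'' x'' → N.Acts v'' nv'' →
        N.IsAct x'' w'' nw'' → ∃ nv, N.Acts v nv ∧ nv'' ≫ nw'' = nv ≫ nw := by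
      intro X'' w'' v'' x'' nv'' nw'' h1 h2 h3 h4 h5
      obtain ⟨i, rfl, rfl⟩ := exists_equiv_of_clean h1 h2 hw.suppAt hc h5.suppAt h3
      have h6 : i x = x'' := h3.2 _ (by rw [← h2, idx_comp, idx_ballsMap])
      subst h6
      refine ⟨_, h4.precomp i, ?_⟩
      rw [h5.unique (hw.postcomp i), Category.assoc]
    by_cases hb : idx v x = idx v' x'
    · exact key hf hb hc' hv' hw'
    -- Either way the set obtained from v' by collapsing this fibre has at most k elements: it is
    -- bounded by X' if the fibre is nonempty, and by B if v' is an inclusion.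
    have hfib : (∃ a, idx v' a = idx v x) ∨ IsIncl (w' ≫ v') := by
      by_cases hfw : ∃ a, idx w a = x
      · obtain ⟨a, ha⟩ := hfw
        refine .inl ⟨idx w' a, ?_⟩
        rw [← idx_comp, ← hf, idx_comp, ha]
      · exact .inr (hf ▸ (hw.suppAt.isIncl hfw).comp (ha.resolve_left hfw))
    have hs := suppAt_concAt v' (idx v x)
    have hcl := clean_cleanAt v' (idx v x)
    have hcomp := concAt_comp_cleanAt v' (idx v x)
    have hincl : IsIncl v' → IsIncl (cleanAt v' (idx v x)) := fun h =>
      IsIncl.of_comp_right hs hcl (hcomp.symm ▸ h)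
    have hincl' : IsIncl (w' ≫ v') → IsIncl v' := IsIncl.of_comp_right hw'.suppAt hc'
    have hcard : (Nat.card (CleanIdx v' (idx v x)) : ℕ∞) ≤ k := by
      rcases hfib with h | h
      · exact le_trans (by exact_mod_cast card_cleanIdx_le v' h) X'.card_le
      · exact le_trans (by exact_mod_cast (hincl (hincl' h)).card_le) B.card_le
    obtain ⟨n₁, hn₁⟩ := exists_isAct (N := N) (X := ⟨_, hcard⟩) hs
    obtain ⟨n₂, hn₂, rfl⟩ := ih hcomp hn₁ hcl (hfib.imp
      (fun ⟨a, ha⟩ => ⟨a, (idx_concAt_eq_iff _ _ _).2 ha⟩) fun h => hincl (hincl' h))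
    have hy : idx (concAt v' (idx v x)) x' ≠ .inr () := fun h =>
      hb ((idx_concAt_eq_iff _ _ _).1 h).symm
    -- After the exchange, the last insertion w'' lies over the same ball of B as w, so `key`
    -- applies.
    obtain ⟨X'', x'', z, w'', nz, nw'', hz, hw'', h1, h2, h3, h4, h5⟩ := hn₁.comm hw' hy (hfib.imp
      (fun ⟨a, ha⟩ => ⟨a, (idx_concAt_eq_iff _ _ _).2 ha⟩)
      (fun h a a' ha ha' => (h a').2 a (by rw [idx_comp, idx_comp, ha, ha'])))
    have h6 : Clean z x'' := hz.suppAt.clean (by rw [h1]; exact Ne.symm hy)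
    have h7 : Clean (cleanAt v' (idx v x)) (idx (concAt v' (idx v x)) x') :=
      Clean.of_comp hs hcl hy (hcomp.symm ▸ hc')
    have h8 : N.Acts (z ≫ cleanAt v' (idx v x)) (n₂ ≫ nz) :=
      Acts.step _ hn₂ hz h7 (ha'.imp h5.2 hincl)
    obtain ⟨nv, h9, h10⟩ := key (w'' := w'') (v'' := z ≫ cleanAt v' (idx v x)) (x'' := x'')
      (by rw [hf, ← Category.assoc, ← h2, Category.assoc, hcomp]) (by rw [idx_comp, h1]; rfl)
      (h6.comp (h1.symm ▸ hcl)) h8 hw''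
    refine ⟨nv, h9, ?_⟩
    rw [← h10, Category.assoc, h3, Category.assoc]

lemma Acts.eq_map {A B : FinLE k} {f : balls m A ⟶ balls m B} {n : N.obj B ⟶ N.obj A}
    (h : N.Acts f n) {e : A ≃ B} (he : f = ballsMap e) : n = N.map e.symm := by
  induction h with
  | iso e' =>
    have h2 : e' = e := Equiv.ext fun a => congrArg (fun f => idx f a) he
    rw [h2]
  | step x hv hw hc ha ih =>
    obtain ⟨i, j, rfl, rfl⟩ := exists_equiv_of_comp_eq_ballsMap he hw.suppAt hc
    have h2 : i.trans j = e := Equiv.ext fun a => congrArg (fun f => idx f a) he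
    rw [ih rfl, hw.unique (isAct_ballsMap x i), ← h2, ← N.map_trans]
    rfl

/-- The last step of the first normal form is admissible, hence can be peeled off the second; then
induct. -/
lemma Acts.unique {A B : FinLE k} {f : balls m A ⟶ balls m B} {n n' : N.obj B ⟶ N.obj A}
    (h : N.Acts f n) (h' : N.Acts f n') : n = n' := by
  induction h with
  | iso e => exact (h'.eq_map rfl).symm
  | step x hv hw hc ha ih =>
    obtain ⟨nv, h1, rfl⟩ := h'.exists_of_fac rfl hw hc ha
    rw [ih h1]

end TruncRightModule

/-! ### Measures for the existence of normal forms. -/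

namespace SM

variable {m : ℕ} {A B : Type}

lemma card_cleanIdx [Finite A] (f : balls m A ⟶ balls m B) {b : B} (h : ¬ ∃ a, idx f a = b) :
    Nat.card (CleanIdx f b) = Nat.card A + 1 := by
  rw [Nat.card_sum, Nat.card_unique (α := Unit),
    Nat.card_congr (Equiv.subtypeUnivEquiv fun a ha => h ⟨a, ha⟩)]

/-- Cleaning over one ball creates no new unclean ball: those remaining come from unclean balls of f
outside the fibre. The ball a, which lies in the fibre, is lost from the count. -/
lemma card_unclean_cleanAt_lt [Finite A] (f : balls m A ⟶ balls m B) {a : A} (h : ¬ Clean f a) :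
    Nat.card {y // ¬ Clean (cleanAt f (idx f a)) y} < Nat.card {a // ¬ Clean f a} := by
  have h1 : ∀ y : {y // ¬ Clean (cleanAt f (idx f a)) y},
      ∃ a' : {a // ¬ Clean f a}, ∃ h : idx f a'.1 ≠ idx f a, y.1 = .inl ⟨a', h⟩ := by
    rintro ⟨⟨a', ha'⟩ | _, hy⟩
    · refine ⟨⟨a', fun hc => hy ?_⟩, ha', rfl⟩
      have h2 : idx (concAt f (idx f a)) a' = .inl ⟨a', ha'⟩ := by simp [concAt, ha']
      have h3 := Clean.of_comp (suppAt_concAt f (idx f a)) (clean_cleanAt f (idx f a)) (a := a')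
        (by rw [h2]; exact Sum.inl_ne_inr) (by rwa [concAt_comp_cleanAt])
      rwa [h2] at h3
    · exact absurd (clean_cleanAt f (idx f a)) hy
  choose φ h2 h3 using h1
  rw [Nat.lt_iff_add_one_le, ← Finite.card_option]
  refine Nat.card_le_card_of_injective (fun o => o.elim ⟨a, h⟩ φ) ?_
  rintro (_ | y) (_ | y') h4
  · rfl
  · exact absurd (congrArg (fun z => idx f z.1) h4.symm) (h2 y')
  · exact absurd (congrArg (fun z => idx f z.1) h4) (h2 y)
  · have h4 : φ y = φ y' := h4
    refine congrArg some (Subtype.ext ?_)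
    rw [h3, h3]
    exact congrArg Sum.inl (Subtype.ext (congrArg (fun z => z.1) h4))

end SM

/-! ### The functor of a right module, and the equivalence for right modules. -/

namespace TruncRightModule

variable {m : ℕ} {k : ℕ∞} {D : Type u} [Category.{v} D]
  {N : TruncRightModule (littleBalls m) k D}

lemma exists_acts_of_cleanAt {A B : FinLE k} {f : balls m A ⟶ balls m B} (b : B)
    (hcard : (Nat.card (CleanIdx f b) : ℕ∞) ≤ k)
    (h : ∃ n, N.Acts (A := ⟨_, hcard⟩) (cleanAt f b) n) : ∃ n, N.Acts f n := by
  obtain ⟨n, hn⟩ := h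
  obtain ⟨n', hn'⟩ := exists_isAct (N := N) (X := ⟨_, hcard⟩) (suppAt_concAt f b)
  have := hn.comp_isAct hn'
  rw [concAt_comp_cleanAt] at this
  exact ⟨_, this⟩

/-- Each missed ball b is first filled in, which lowers |B| - |A|. The enlarged embedding is still
an inclusion, so its source stays bounded by B. -/
lemma exists_acts_of_isIncl {A B : FinLE k} {f : balls m A ⟶ balls m B} (h : IsIncl f) :
    ∃ n, N.Acts f n := by
  induction hd : Nat.card B - Nat.card A using Nat.strong_induction_on generalizing A with
  | _ d ih =>
    by_cases hs : Function.Surjective (idx f)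
    · obtain ⟨e, rfl⟩ := h.exists_equiv hs
      exact ⟨_, Acts.iso e⟩
    · simp only [Function.Surjective, not_forall] at hs
      obtain ⟨b, hb⟩ := hs
      have h1 : IsIncl (cleanAt f b) := IsIncl.of_comp_right (suppAt_concAt f b)
        (clean_cleanAt f b) (by rwa [concAt_comp_cleanAt])
      have h2 := h1.card_le
      have h3 := card_cleanIdx f hb
      have hcard : (Nat.card (CleanIdx f b) : ℕ∞) ≤ k :=
        le_trans (by exact_mod_cast h2) B.card_le
      exact exists_acts_of_cleanAt b hcard (ih (Nat.card B - Nat.card (CleanIdx f b)) (by omega)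
        (A := ⟨_, hcard⟩) h1 rfl)

/-- Induction on the number of unclean balls. The fibre that is cleaned contains the unclean ball a,
so collapsing it does not enlarge the set. Inclusions are the base case. -/
lemma exists_acts {A B : FinLE k} (f : balls m A ⟶ balls m B) : ∃ n, N.Acts f n := by
  induction hd : Nat.card {a // ¬ Clean f a} using Nat.strong_induction_on generalizing A with
  | _ d ih =>
    by_cases h : IsIncl f
    · exact exists_acts_of_isIncl h
    · simp only [IsIncl, not_forall] at h
      obtain ⟨a, ha⟩ := h
      have hcard : (Nat.card (CleanIdx f (idx f a)) : ℕ∞) ≤ k :=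
        le_trans (by exact_mod_cast card_cleanIdx_le f ⟨a, rfl⟩) A.card_le
      exact exists_acts_of_cleanAt _ hcard (ih _ (hd ▸ card_unclean_cleanAt_lt f ha)
        (A := ⟨_, hcard⟩) _ rfl)

variable (N) in
/-- The contravariant functor given by a truncated right module over the little balls operad. -/
noncomputable def toFunctor : (BallCat m k)ᵒᵖ ⥤ D where
  obj A := N.obj A.unop
  map f := (exists_acts (N := N) f.unop.hom).choose
  map_id A := (exists_acts (N := N) (𝟙 A : A ⟶ A).unop.hom).choose_spec.eq_map
    (e := Equiv.refl _) rfl |>.trans (N.map_refl _)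
  map_comp f g := (exists_acts (N := N) (f ≫ g).unop.hom).choose_spec.unique
    ((exists_acts (N := N) g.unop.hom).choose_spec.comp
      (exists_acts (N := N) f.unop.hom).choose_spec)

lemma toFunctor_map {A B : FinLE k} {f : balls m A ⟶ balls m B} {n : N.obj B ⟶ N.obj A}
    (h : N.Acts f n) : N.toFunctor.map (ballHom f).op = n :=
  (exists_acts (N := N) f).choose_spec.unique h

lemma Acts.of_isAct {Y X : FinLE k} {x : X} {w : balls m Y ⟶ balls m X} {n : N.obj X ⟶ N.obj Y}
    (h : N.IsAct x w n) : N.Acts w n := by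
  have := (Acts.iso (N := N) (Equiv.refl X)).comp_isAct h
  rwa [ballsMap_refl, Category.comp_id, Equiv.refl_symm, N.map_refl, Category.id_comp] at this

lemma isAct_act {X : FinLE k} (x : X) {C : Type} [Finite C] (h : (Nat.card (Ins X x C) : ℕ∞) ≤ k)
    (q : balls m C ⟶ balls m Unit) : N.IsAct (Y := X.ins x C h) x (insMor x q) (N.act X x h q) :=
  ⟨C, inferInstance, q, h, Equiv.refl _, rfl, by rw [N.map_refl, Category.comp_id]⟩

lemma acts_map {A B : FinLE k} (e : A ≃ B) :
    N.Acts (A := B) (B := A) (ballsMap e.symm) (N.map e) := Acts.iso e.symm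

lemma Hom.exists_isAct {N' : TruncRightModule (littleBalls m) k D} (τ : N ⟶ N') {X Y : FinLE k}
    {x : X} {w : balls m Y ⟶ balls m X} {n : N.obj X ⟶ N.obj Y} (h : N.IsAct x w n) :
    ∃ n', N'.IsAct x w n' ∧ n ≫ Hom.app τ Y = Hom.app τ X ≫ n' := by
  obtain ⟨C, _, q, hc, e, rfl, rfl⟩ := h
  refine ⟨_, ⟨C, inferInstance, q, hc, e, rfl, rfl⟩, ?_⟩
  have h1 : N.act X x hc q ≫ Hom.app τ (X.ins x C hc) = Hom.app τ X ≫ N'.act X x hc q :=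
    Hom.act_app τ X x hc q
  rw [Category.assoc, Hom.map_app τ, ← Category.assoc, h1, Category.assoc]

lemma Hom.exists_acts {N' : TruncRightModule (littleBalls m) k D} (τ : N ⟶ N') {A B : FinLE k}
    {f : balls m A ⟶ balls m B} {n : N.obj B ⟶ N.obj A} (h : N.Acts f n) :
    ∃ n', N'.Acts f n' ∧ n ≫ Hom.app τ A = Hom.app τ B ≫ n' := by
  induction h with
  | iso e => exact ⟨_, Acts.iso e, Hom.map_app τ e.symm⟩
  | step x hv hw hc ha ih =>
    obtain ⟨n', h1, h2⟩ := ih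
    obtain ⟨n'', h3, h4⟩ := Hom.exists_isAct τ hw
    exact ⟨_, Acts.step x h1 h3 hc ha, by
      rw [Category.assoc, h4, ← Category.assoc, h2, Category.assoc]⟩

/-- The generated action agrees with G on bijections and insertions, and both are compatible with
the steps of a normal form. -/
lemma toRightModule_acts (G : (BallCat m k)ᵒᵖ ⥤ D) {A B : FinLE k} {f : balls m A ⟶ balls m B}
    {n : ((toRightModule m k D).obj G).obj B ⟶ ((toRightModule m k D).obj G).obj A} (h : ((toRightModule m k D).obj G).Acts f n) :
    n = G.map (ballHom f).op := by
  induction h with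
  | iso e => rfl
  | @step A X B w v nv nw x hv hw hc ha ih =>
    obtain ⟨C, _, q, hc, e, rfl, rfl⟩ := hw
    rw [ih]
    exact (congrArg (G.map (ballHom v).op ≫ ·) (G.map_comp _ _).symm).trans (G.map_comp _ _).symm

/-- Module morphisms commute with the generators, and every embedding acts through a normal form in
them. This gives fullness. -/
lemma Hom.naturality {G H : (BallCat m k)ᵒᵖ ⥤ D}
    (τ : (toRightModule m k D).obj G ⟶ (toRightModule m k D).obj H) {A B : (BallCat m k)ᵒᵖ}
    (f : A ⟶ B) : G.map f ≫ Hom.app τ B.unop = Hom.app τ A.unop ≫ H.map f := by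
  obtain ⟨n, hn⟩ := TruncRightModule.exists_acts (N := (toRightModule m k D).obj G) f.unop.hom
  obtain ⟨n', hn', h⟩ := Hom.exists_acts τ hn
  rw [toRightModule_acts G hn, toRightModule_acts H hn'] at h
  exact h

/-- A truncated right module over the little balls operad is isomorphic to the one given by its
contravariant functor. -/
noncomputable def toFunctorIso : (toRightModule m k D).obj N.toFunctor ≅ N where
  hom :=
    { app := fun _ => 𝟙 _
      map_app := fun e => (Category.comp_id _).trans
        ((toFunctor_map (acts_map e)).trans (Category.id_comp _).symm)
      act_app := fun _ a _ _ h p => (Category.comp_id _).trans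
        ((toFunctor_map (Acts.of_isAct (isAct_act a h p))).trans (Category.id_comp _).symm) }
  inv :=
    { app := fun _ => 𝟙 _
      map_app := fun e => (Category.comp_id _).trans
        ((toFunctor_map (acts_map e)).symm.trans (Category.id_comp _).symm)
      act_app := fun _ a _ _ h p => (Category.comp_id _).trans
        ((toFunctor_map (Acts.of_isAct (isAct_act a h p))).symm.trans (Category.id_comp _).symm) }
  hom_inv_id := Hom.ext (funext fun _ => Category.comp_id _)
  inv_hom_id := Hom.ext (funext fun _ => Category.comp_id _)

end TruncRightModule

instance toRightModule_isEquivalence (m : ℕ) (k : ℕ∞) (D : Type u) [Category.{v} D] :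
    (toRightModule m k D).IsEquivalence where
  faithful := ⟨fun h => NatTrans.ext (funext fun A =>
    congrArg (fun f => TruncRightModule.Hom.app f A.unop) h)⟩
  full := ⟨fun τ => ⟨⟨fun A => TruncRightModule.Hom.app τ A.unop,
    fun _ _ f => TruncRightModule.Hom.naturality τ f⟩, rfl⟩⟩
  essSurj := ⟨fun N => ⟨N.toFunctor, ⟨TruncRightModule.toFunctorIso⟩⟩⟩

/-- The elements of `Option α` different from `none`. -/
def optionNeNone {α : Type} : {x : Option α // x ≠ none} ≃ α where
  toFun
    | ⟨some a, _⟩ => a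
    | ⟨none, h⟩ => (h rfl).elim
  invFun a := ⟨some a, Option.some_ne_none a⟩
  left_inv := by
    rintro ⟨_ | a, h⟩
    · exact absurd rfl h
    · rfl
  right_inv _ := rfl

/-! ### Embeddings with an antiball: the factorization through left operations. -/

section Geometry

variable {m : ℕ}

lemma stdInv_injective {A : Type} (o : balls m A ⟶ balls m Unit) (a : A) :
    Function.Injective (stdInv o a) := fun y z hyz => by
  obtain ⟨r, c, hr, -, h⟩ := exists_std o a
  rw [h, h] at hyz
  exact sub_left_injective (smul_right_injective _ (inv_ne_zero hr.ne') hyz)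

/-- The values at y and 2y, for a point y of the antiball, determine scaling factor and translation.
In dimension 0 the antiball is empty, but the space is a point. -/
lemma stdInv_eq_of_antidisc {A A' : Type} {o : balls m A ⟶ balls m Unit} {a : A}
    {o' : balls m A' ⟶ balls m Unit} {a' : A'}
    (h : ∀ y ∈ antidisc m, stdInv o a y = stdInv o' a' y) : stdInv o a = stdInv o' a' := by
  rcases subsingleton_or_nontrivial (Euc m) with hs | hn
  · exact funext fun y => Subsingleton.elim _ _
  · obtain ⟨r, c, hr, -, h1⟩ := exists_std o a
    obtain ⟨s, d, hs, -, h2⟩ := exists_std o' a'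
    obtain ⟨y, hy⟩ := NormedSpace.exists_lt_norm ℝ (Euc m) 1
    have h3 := h y (by simpa using hy)
    have h4 := h ((2 : ℝ) • y) (by
      rw [Set.mem_compl_iff, mem_closedBall_zero_iff, norm_smul, Real.norm_two]
      linarith)
    rw [h1, h2] at h3 h4
    have h5 : r⁻¹ • y = s⁻¹ • y := by
      have := congrArg₂ (· - ·) h4 h3
      simp only [smul_sub, sub_sub_sub_cancel_right, two_smul, smul_add, add_sub_cancel_right]
        at this
      exact this
    have hy0 : y ≠ 0 := fun h0 => by
      rw [h0, norm_zero] at hy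
      linarith
    have h6 : r⁻¹ = s⁻¹ := smul_left_injective ℝ hy0 h5
    have h7 : c = d := by
      rw [h6] at h3
      exact sub_right_injective (smul_right_injective _ (inv_ne_zero hs.ne') h3)
    funext z
    rw [h1, h2, h6, h7]

/-- If the image of the antiball under `x ↦ r x + c` does not meet the open set `U`, then `U` is
contained in the image of the unit ball. -/
lemma inv_smul_sub_mem_disc {r : ℝ} {c : Euc m} (hr : 0 < r) {U : Set (Euc m)} (hU : IsOpen U)
    (h : ∀ y ∈ antidisc m, r • y + c ∉ U) {z : Euc m} (hz : z ∈ U) :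
    r⁻¹ • (z - c) ∈ disc m := by
  by_contra hmem
  have h1 : r⁻¹ • (z - c) ∈ closure (antidisc m) := by
    rw [closure_compl, interior_closedBall _ one_ne_zero]
    exact hmem
  have hcont : Continuous fun x : Euc m => r • x + c := by fun_prop
  have h2 : (fun x : Euc m => r • x + c) ⁻¹' U ∈ nhds (r⁻¹ • (z - c)) := by
    refine (hU.preimage hcont).mem_nhds ?_
    change r • r⁻¹ • (z - c) + c ∈ U
    rwa [smul_inv_smul₀ hr.ne', sub_add_cancel]
  obtain ⟨y, hyU, hy⟩ := mem_closure_iff_nhds.1 h1 _ h2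
  exact h y hy hyU

variable {A B : Type} (f : ballsAndAntiball m A ⟶ ballsAndAntiball m B)

/-- The antiball is closed under multiplication by t ≥ 1, hence its image is unbounded as soon as it
is nonempty, and does not fit into a unit ball. -/
lemma exists_antiball_affine : ∃ (r : ℝ) (c : Euc m), 0 < r ∧ ∀ x : antidisc m,
    (f.toFun ⟨none, x⟩).1 = none ∧ ((f.toFun ⟨none, x⟩).2 : Euc m) = r • (x : Euc m) + c := by
  obtain ⟨j, r, c, hr, h⟩ := f.standard none
  refine ⟨r, c, hr, fun x => ⟨(h x).1.trans ?_, (h x).2⟩⟩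
  rcases j with _ | b
  · rfl
  exfalso
  have hx : 1 < ‖(x : Euc m)‖ := not_le.1 fun h => x.2 (by simpa using h)
  -- Then r t = 1 + ‖c‖ + r, and r t x + c has norm greater than 1.
  let t : ℝ := (1 + ‖c‖) / r + 1
  have ht : 1 ≤ t := by
    have : 0 ≤ (1 + ‖c‖) / r := by positivity
    simp only [t]
    linarith
  have hmem : t • (x : Euc m) ∈ antidisc m := by
    have : 1 < t * ‖(x : Euc m)‖ := by nlinarith
    simpa [norm_smul, abs_of_pos (lt_of_lt_of_le one_pos ht)] using this
  obtain ⟨h1, h2⟩ := h ⟨_, hmem⟩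
  generalize hp : f.toFun ⟨none, ⟨t • (x : Euc m), hmem⟩⟩ = p at h1 h2
  obtain ⟨j, y⟩ := p
  obtain rfl : j = some b := h1
  have hy : ‖(y : Euc m)‖ < 1 := by
    have := y.2
    change (y : Euc m) ∈ disc m at this
    simpa using this
  have h3 : (y : Euc m) = r • t • (x : Euc m) + c := h2
  have h4 : ‖r • t • (x : Euc m)‖ ≤ ‖(y : Euc m)‖ + ‖c‖ := by
    have := norm_sub_le (y : Euc m) c
    rwa [h3, add_sub_cancel_right, ← h3] at this
  rw [norm_smul, norm_smul, Real.norm_of_nonneg hr.le,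
    Real.norm_of_nonneg (zero_le_one.trans ht), ← mul_assoc] at h4
  have h5 : r * t = 1 + ‖c‖ + r := by
    simp only [t]
    field_simp
  nlinarith [norm_nonneg c]

lemma exists_antidisc_or_exists_disc (a : A) :
    (∀ x, ∃ y : antidisc m, f.toFun ⟨some a, x⟩ = ⟨none, y⟩) ∨
      ∃ b, ∀ x, ∃ y : disc m, f.toFun ⟨some a, x⟩ = ⟨some b, y⟩ := by
  obtain ⟨j, r, c, hr, h⟩ := f.standard (some a)
  rcases j with _ | b
  · refine .inl fun x => ?_
    have h1 := (h x).1
    generalize f.toFun ⟨some a, x⟩ = p at h1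
    obtain ⟨j, y⟩ := p
    obtain rfl : j = none := h1
    exact ⟨y, rfl⟩
  · refine .inr ⟨b, fun x => ?_⟩
    have h1 := (h x).1
    generalize f.toFun ⟨some a, x⟩ = p at h1
    obtain ⟨j, y⟩ := p
    obtain rfl : j = some b := h1
    exact ⟨y, rfl⟩

/-- The balls which are mapped to a ball. -/
abbrev Finitary (a : A) : Prop := ∃ b, ∀ x, ∃ y : disc m, f.toFun ⟨some a, x⟩ = ⟨some b, y⟩

/-- Every embedding is the composition of one of the form `lMor` with an embedding of balls. -/
lemma exists_lMor_fac : ∃ (A' : Type) (a : A') (C : Type) (e : Ins A' a C ≃ A)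
    (o : balls m A' ⟶ balls m Unit) (w : balls m C ⟶ balls m B),
    f = addAnti.map (ballsMap e.symm) ≫ lMor o a C ≫ addAnti.map w := by
  classical
  obtain ⟨r, c, hr, hn⟩ := exists_antiball_affine f
  have hinf : ∀ (a : {a // ¬ Finitary f a}) (x : disc m),
      ∃ y : antidisc m, f.toFun ⟨some a.1, x⟩ = ⟨none, y⟩ :=
    fun a => (exists_antidisc_or_exists_disc f a.1).resolve_right a.2
  choose α hα using hinf
  have hfin : ∀ a : {a // Finitary f a}, Finitary f a := fun a => a.2
  choose β γ hγ using hfin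
  have hnone : ∀ x : antidisc m, ∃ y : antidisc m,
      f.toFun ⟨none, x⟩ = ⟨none, y⟩ ∧ (y : Euc m) = r • (x : Euc m) + c := fun x => by
    obtain ⟨h1, h2⟩ := hn x
    generalize f.toFun ⟨none, x⟩ = p at h1 h2
    obtain ⟨j, y⟩ := p
    obtain rfl : j = none := h1
    exact ⟨y, rfl, h2⟩
  -- The image of the antiball under x ↦ r x + c misses the unit ball, so the inverse map carries
  -- the unit ball into itself.
  have hdisc : ∀ x : disc m, r⁻¹ • ((x : Euc m) - c) ∈ disc m := fun x => by
    refine inv_smul_sub_mem_disc hr Metric.isOpen_ball (fun y hy h => ?_) x.2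
    obtain ⟨z, -, hz⟩ := hnone ⟨y, hy⟩
    exact z.2 (Metric.ball_subset_closedBall (hz ▸ h))
  have hα' : ∀ (a : {a // ¬ Finitary f a}), ∃ (s : ℝ) (d : Euc m), 0 < s ∧
      ∀ x : disc m, (α a x : Euc m) = s • (x : Euc m) + d := fun a => by
    obtain ⟨_, s, d, hs, h⟩ := f.standard (some a.1)
    refine ⟨s, d, hs, fun x => ?_⟩
    have := (h x).2
    rw [val_eq (hα a x)] at this
    exact this
  -- The same argument for the image of a ball lying in the antiball; it misses the image of the
  -- antiball because f is injective.
  have hinfdisc : ∀ (a : {a // ¬ Finitary f a}) (x : disc m),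
      r⁻¹ • ((α a x : Euc m) - c) ∈ disc m := fun a x => by
    obtain ⟨s, d, hs, h⟩ := hα' a
    refine inv_smul_sub_mem_disc hr (U := (fun z => s⁻¹ • (z - d)) ⁻¹' disc m)
      (Metric.isOpen_ball.preimage (by fun_prop)) (fun y hy hmem => ?_) ?_
    · obtain ⟨z, hz, hz'⟩ := hnone ⟨y, hy⟩
      have h1 : (α a ⟨_, hmem⟩ : Euc m) = z := by
        rw [h, hz']
        change s • s⁻¹ • (r • y + c - d) + d = _
        rw [smul_inv_smul₀ hs.ne', sub_add_cancel]
      have h2 : f.toFun ⟨some a.1, ⟨_, hmem⟩⟩ = f.toFun ⟨none, ⟨y, hy⟩⟩ := by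
        refine (hα a _).trans (Eq.trans ?_ hz.symm)
        exact pt_ext rfl h1
      exact Option.some_ne_none _ (fst_eq (f.injective h2))
    · change s⁻¹ • ((α a x : Euc m) - d) ∈ disc m
      rw [h, add_sub_cancel_right, inv_smul_smul₀ hs.ne']
      exact x.2
  have hsub : ∀ {y z : Euc m}, r⁻¹ • (y - c) = r⁻¹ • (z - c) → y = z := fun h =>
    sub_left_injective (smul_right_injective _ (inv_ne_zero hr.ne') h)
  -- The inverse of the affine map of the antiball rescales the whole picture: the target unit ball
  -- becomes the ball `none` of o, and the balls sent to the antiball become its other balls.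
  let o : balls m (Option {a // ¬ Finitary f a}) ⟶ balls m Unit := ballsMk (fun _ => ())
    (fun
      | none => fun x => ⟨_, hdisc x⟩
      | some a => fun x => ⟨_, hinfdisc a x⟩)
    (by
      rintro (_ | a)
      · exact ⟨r⁻¹, - (r⁻¹ • c), inv_pos.2 hr, fun x => by
          change r⁻¹ • ((x : Euc m) - c) = _
          rw [smul_sub, sub_eq_add_neg]⟩
      · obtain ⟨s, d, hs, h⟩ := hα' a
        refine ⟨r⁻¹ * s, r⁻¹ • (d - c), mul_pos (inv_pos.2 hr) hs, fun x => ?_⟩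
        change r⁻¹ • ((α a x : Euc m) - c) = _
        rw [h, add_sub_assoc, smul_add, mul_smul])
    (by
      rintro (_ | a) (_ | a') x x' - h
      · rfl
      · have h1 : (x : Euc m) = α a' x' := hsub (congrArg Subtype.val h)
        exact absurd (Metric.ball_subset_closedBall (h1 ▸ x.2)) (α a' x').2
      · have h1 : (α a x : Euc m) = x' := hsub (congrArg Subtype.val h)
        exact absurd (Metric.ball_subset_closedBall (h1 ▸ x'.2)) (α a x).2
      · have h1 : (α a x : Euc m) = α a' x' := hsub (congrArg Subtype.val h)
        have h2 : f.toFun ⟨some a.1, x⟩ = f.toFun ⟨some a'.1, x'⟩ := by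
          rw [hα, hα]
          exact pt_ext rfl h1
        exact congrArg some (Subtype.ext (Option.some_injective _ (fst_eq (f.injective h2)))))
  let w : balls m {a // Finitary f a} ⟶ balls m B := ballsMk β γ
    (fun a => by
      obtain ⟨_, s, d, hs, h⟩ := f.standard (some a.1)
      refine ⟨s, d, hs, fun x => ?_⟩
      have := (h x).2
      rw [val_eq (hγ a x)] at this
      exact this)
    (fun a a' x x' h h' => by
      have h2 : f.toFun ⟨some a.1, x⟩ = f.toFun ⟨some a'.1, x'⟩ := by
        refine (hγ a x).trans (Eq.trans ?_ (hγ a' x').symm)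
        exact pt_ext (congrArg some h) (congrArg Subtype.val h')
      exact Subtype.ext (Option.some_injective _ (fst_eq (f.injective h2))))
  let e : Ins (Option {a // ¬ Finitary f a}) none {a // Finitary f a} ≃ A :=
    ((Equiv.sumCongr optionNeNone (Equiv.refl _)).trans (Equiv.sumComm _ _)).trans
      (Equiv.sumCompl (Finitary f))
  have ho : stdInv o none = fun x => r • x + c := funext fun x => by
    rw [stdInv_eq (r := r⁻¹) (c := - (r⁻¹ • c)) (inv_pos.2 hr)]
    · rw [inv_inv, sub_neg_eq_add, smul_add, smul_inv_smul₀ hr.ne']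
    · intro x
      change r⁻¹ • ((x : Euc m) - c) = _
      rw [smul_sub, sub_eq_add_neg]
  have key : addAnti.map (ballsMap e) ≫ f = lMor o none _ ≫ addAnti.map w := by
    refine hom_ext ?_ ?_ <;> rintro (_ | ⟨_ | a, ha⟩ | a) x
    · exact (hn x).1
    · exact absurd rfl ha
    · exact (fst_eq (hα a x) :)
    · exact fst_eq (hγ a x)
    · exact (hn x).2.trans (congrFun ho x).symm
    · exact absurd rfl ha
    · refine (val_eq (hα a x)).trans (Eq.trans ?_ (congrFun ho _).symm)
      change _ = r • r⁻¹ • ((α a x : Euc m) - c) + c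
      rw [smul_inv_smul₀ hr.ne', sub_add_cancel]
    · exact val_eq (hγ a x)
  refine ⟨_, none, _, e, o, w, ?_⟩
  rw [← key, ← Category.assoc, ← Functor.map_comp, ← ballsMap_trans, Equiv.symm_trans_self,
    ballsMap_refl, CategoryTheory.Functor.map_id, Category.id_comp]

end Geometry

/-- The bijection between the complements of a and a' is extended by a ↦ a'. -/
lemma exists_equiv_of_sum {A A' C C' : Type} {a : A} {a' : A'} (E : Ins A a C ≃ Ins A' a' C')
    (hl : ∀ x, ∃ y, E (.inl x) = .inl y) (hr : ∀ c, ∃ c', E (.inr c) = .inr c') :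
    ∃ (v : A ≃ A') (u : C ≃ C'), v a = a' ∧ (∀ x, ∃ h, E (.inl x) = .inl ⟨v x.1, h⟩) ∧
      ∀ c, E (.inr c) = .inr (u c) := by
  classical
  choose φ hφ using hl
  choose u hu using hr
  have hφ' : Function.Bijective φ := by
    refine ⟨fun x y h => ?_, fun y => ?_⟩
    · exact Sum.inl_injective (E.injective ((hφ x).trans ((congrArg _ h).trans (hφ y).symm)))
    · obtain ⟨x | c, hx⟩ := E.surjective (.inl y)
      · exact ⟨x, Sum.inl_injective ((hφ x).symm.trans hx)⟩
      · exact absurd ((hu c).symm.trans hx) Sum.inr_ne_inl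
  have hu' : Function.Bijective u := by
    refine ⟨fun x y h => ?_, fun y => ?_⟩
    · exact Sum.inr_injective (E.injective ((hu x).trans ((congrArg _ h).trans (hu y).symm)))
    · obtain ⟨x | c, hx⟩ := E.surjective (.inr y)
      · exact absurd ((hφ x).symm.trans hx) Sum.inl_ne_inr
      · exact ⟨c, Sum.inr_injective ((hu c).symm.trans hx)⟩
  let v : A ≃ A' := (Equiv.optionSubtypeNe a).symm.trans
    ((Equiv.optionCongr (Equiv.ofBijective φ hφ')).trans (Equiv.optionSubtypeNe a'))
  have hv : ∀ x : {x // x ≠ a}, v x.1 = (φ x).1 := fun x => by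
    simp only [v, Equiv.trans_apply, Equiv.optionSubtypeNe_symm_of_ne x.2]
    rfl
  refine ⟨v, Equiv.ofBijective u hu', ?_, fun x => ⟨hv x ▸ (φ x).2, ?_⟩, hu⟩
  · simp [v]
  · rw [hφ]
    exact congrArg Sum.inl (Subtype.ext (hv x).symm)

section Geometry

variable {m : ℕ}

/-- Uniqueness of the factorization up to bijections. The summand outside C consists of the balls
landing in the antiball, so E respects the summands. The restriction to the antiball determines the
affine map `stdInv`; as this is injective, o is recovered from the balls mapped to the antiball, and
w from the others. -/
lemma exists_equiv_of_lMor_comp_eq {A A' B C C' : Type} {a : A} {a' : A'}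
    {E : Ins A a C ≃ Ins A' a' C'} {o : balls m A ⟶ balls m Unit} {o' : balls m A' ⟶ balls m Unit}
    {w : balls m C ⟶ balls m B} {w' : balls m C' ⟶ balls m B}
    (h : lMor o a C ≫ addAnti.map w = addAnti.map (ballsMap E) ≫ lMor o' a' C' ≫ addAnti.map w') :
    ∃ (v : A ≃ A') (u : C ≃ C'), v a = a' ∧ (∀ x, ∃ h, E (.inl x) = .inl ⟨v x.1, h⟩) ∧
      (∀ c, E (.inr c) = .inr (u c)) ∧ o = ballsMap v ≫ o' ∧ w = ballsMap u ≫ w' := by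
  have h0 : ∀ p, (lMor o a C ≫ addAnti.map w).toFun p =
      (addAnti.map (ballsMap E) ≫ lMor o' a' C' ≫ addAnti.map w').toFun p := fun p => by rw [h]
  let x₀ : disc m := ⟨0, by simp⟩
  obtain ⟨v, u, hv, hl, hr⟩ := exists_equiv_of_sum E (fun x => by
      rcases hx : E (.inl x) with y | c
      · exact ⟨y, rfl⟩
      · have h1 : none = ((lMor o' a' C' ≫ addAnti.map w').toFun ⟨some (E (.inl x)), x₀⟩).1 :=
          fst_eq (h0 ⟨some (.inl x), x₀⟩)
        rw [hx] at h1
        exact absurd h1.symm (Option.some_ne_none _)) (fun c => by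
      rcases hx : E (.inr c) with y | c
      · have h1 : _ = ((lMor o' a' C' ≫ addAnti.map w').toFun ⟨some (E (.inr c)), x₀⟩).1 :=
          fst_eq (h0 ⟨some (.inr c), x₀⟩)
        rw [hx] at h1
        exact absurd h1 (Option.some_ne_none _)
      · exact ⟨c, rfl⟩)
  refine ⟨v, u, hv, hl, hr, ?_, ?_⟩
  · have hs : stdInv o a = stdInv o' a' := stdInv_eq_of_antidisc fun y hy =>
      val_eq (h0 ⟨none, ⟨y, hy⟩⟩)
    refine balls_ext (fun _ => rfl) fun y x => ?_
    rw [dsk_comp, idx_ballsMap, dsk_ballsMap]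
    refine Subtype.ext (stdInv_injective o a ?_)
    by_cases hy : y = a
    · subst hy
      refine (stdInv_apply o y x).trans ?_
      rw [hs, hv]
      exact (stdInv_apply o' a' x).symm
    · obtain ⟨h1, h2⟩ := hl ⟨y, hy⟩
      have h3 : stdInv o a (dsk o y x) =
        ((lMor o' a' C' ≫ addAnti.map w').toFun ⟨some (E (.inl ⟨y, hy⟩)), x⟩).2 :=
        val_eq (h0 ⟨some (.inl ⟨y, hy⟩), x⟩)
      rw [h2] at h3
      rw [h3, hs]
      rfl
  · refine balls_ext (fun c => ?_) fun c x => ?_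
    · have h1 : some (w.toFun ⟨c, x₀⟩).1 =
        ((lMor o' a' C' ≫ addAnti.map w').toFun ⟨some (E (.inr c)), x₀⟩).1 :=
        fst_eq (h0 ⟨some (.inr c), x₀⟩)
      rw [hr] at h1
      exact Option.some_injective _ h1
    · have h1 : ((w.toFun ⟨c, x⟩).2 : Euc m) =
        ((lMor o' a' C' ≫ addAnti.map w').toFun ⟨some (E (.inr c)), x⟩).2 :=
        val_eq (h0 ⟨some (.inr c), x⟩)
      rw [hr] at h1
      exact Subtype.ext h1

end Geometry

/-! ### The action of all embeddings with an antiball on a weak bimodule. -/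

namespace TruncWeakBimodule

variable {m : ℕ} {k : ℕ∞} {D : Type u} [Category.{v} D]

/-- The action of embeddings on a truncated weak bimodule, which is generated by the structure
maps. -/
def Acts (N : TruncWeakBimodule (littleBalls m) k D) {A B : FinLE k}
    (f : ballsAndAntiball m A ⟶ ballsAndAntiball m B) (n : N.obj B ⟶ N.obj A) : Prop :=
  ∃ (C : FinLE k) (A' : Type) (_ : Finite A') (a : A') (h : (Nat.card (Ins A' a C) : ℕ∞) ≤ k)
    (e : Ins A' a C ≃ A) (o : balls m A' ⟶ balls m Unit) (w : balls m C ⟶ balls m B)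
    (nw : N.obj B ⟶ N.obj C), N.toTruncRightModule.Acts w nw ∧
    f = addAnti.map (ballsMap e.symm) ≫ lMor o a C ≫ addAnti.map w ∧
    n = nw ≫ N.lact a C h o ≫ N.map (A := ⟨Ins A' a C, h⟩) e

variable {N : TruncWeakBimodule (littleBalls m) k D}

lemma lact_map_eq {A' A'' : Type} [Finite A'] [Finite A''] {C C' : FinLE k} (v : A' ≃ A'')
    (a : A') (u : C ≃ C') (h : (Nat.card (Ins A' a C) : ℕ∞) ≤ k)
    (h' : (Nat.card (Ins A'' (v a) C') : ℕ∞) ≤ k) (o : balls m A'' ⟶ balls m Unit) :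
    N.lact a C h (ballsMap v ≫ o) ≫ N.map (A := ⟨Ins A' a C, h⟩) (B := ⟨Ins A'' (v a) C', h'⟩)
      (Ins.congr v a u) = N.map u ≫ N.lact (v a) C' h' o := by
  refine (N.lact_map v a u h h' (ballsMap v ≫ o)).trans
    (congrArg (fun o => N.map u ≫ N.lact (v a) C' h' o) ?_)
  change ballsMap v.symm ≫ ballsMap v ≫ o = o
  rw [← Category.assoc, ← ballsMap_trans, Equiv.symm_trans_self, ballsMap_refl, Category.id_comp]

/-- The bijections relating two factorizations are absorbed by equivariance of the left action. What
remains is uniqueness for right modules. -/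
lemma Acts.unique {A B : FinLE k} {f : ballsAndAntiball m A ⟶ ballsAndAntiball m B}
    {n n' : N.obj B ⟶ N.obj A} (hn : N.Acts f n) (hn' : N.Acts f n') : n = n' := by
  obtain ⟨C, A', _, a, h, e, o, w, nw, hw, rfl, rfl⟩ := hn
  obtain ⟨C', A'', _, a', h', e', o', w', nw', hw', hf, rfl⟩ := hn'
  obtain ⟨v, u, rfl, hl, hr, rfl, rfl⟩ := exists_equiv_of_lMor_comp_eq (E := e.trans e'.symm)
    (o := o) (o' := o') (w := w) (w' := w') (by
      have := congrArg (addAnti.map (ballsMap e) ≫ ·) hf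
      simp only [← Category.assoc, ← Functor.map_comp, ← ballsMap_trans, Equiv.self_trans_symm]
        at this
      rw [ballsMap_refl, CategoryTheory.Functor.map_id, Category.id_comp] at this
      rw [this, Category.assoc])
  have hE : e = (Ins.congr v a u).trans e' := by
    refine Equiv.ext fun i => e'.symm.injective (Eq.trans ?_ (e'.symm_apply_apply _).symm)
    rcases i with x | c
    · obtain ⟨h1, h2⟩ := hl x
      exact h2
    · exact hr c
  have h1 := hw.unique (hw'.precomp u)
  have h2 : N.map (A := ⟨Ins A' a C, h⟩) (B := A) e =
      N.map (A := ⟨Ins A' a C, h⟩) (B := ⟨Ins A'' (v a) C', h'⟩) (Ins.congr v a u) ≫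
        N.map (A := ⟨Ins A'' (v a) C', h'⟩) e' := by
    rw [← N.map_trans, hE]
  have h3 := lact_map_eq (N := N) v a u h h' o'
  rw [h1, h2]
  refine (congrArg ((nw' ≫ N.map u.symm) ≫ ·) ((Category.assoc _ _ _).symm.trans
    ((congrArg (· ≫ N.map (A := ⟨Ins A'' (v a) C', h'⟩) e') h3).trans
      (Category.assoc _ _ _)))).trans ?_
  simp only [Category.assoc]
  rw [← Category.assoc (N.map u.symm), TruncRightModule.map_symm_map, Category.id_comp]

lemma exists_acts {A B : FinLE k} (f : ballsAndAntiball m A ⟶ ballsAndAntiball m B) :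
    ∃ n, N.Acts f n := by
  obtain ⟨A', a, C, e, o, w, hf⟩ := exists_lMor_fac f
  have : Finite (Ins A' a C) := Finite.of_equiv _ e.symm
  have hC : Finite C := Finite.of_injective (Sum.inr : C → Ins A' a C) Sum.inr_injective
  have hA : Finite {x // x ≠ a} :=
    Finite.of_injective (Sum.inl : _ → Ins A' a C) Sum.inl_injective
  have hA' : Finite A' := by
    classical
    exact Finite.of_equiv _ (Equiv.optionSubtypeNe a)
  have h : (Nat.card (Ins A' a C) : ℕ∞) ≤ k := by
    rw [Nat.card_congr e]
    exact A.card_le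
  -- C is a summand of a set in bijection with A, so the left operation causes no size problem.
  have h' : (Nat.card C : ℕ∞) ≤ k := le_trans (by
    exact_mod_cast Nat.card_le_card_of_injective (Sum.inr : C → Ins A' a C) Sum.inr_injective) h
  obtain ⟨nw, hw⟩ := TruncRightModule.exists_acts (N := N.toTruncRightModule) (A := ⟨C, h'⟩) w
  exact ⟨_, ⟨C, h'⟩, A', hA', a, h, e, o, w, nw, hw, hf, rfl⟩

/-- The operadic unit serves as the left operation. -/
lemma acts_addAnti {A B : FinLE k} {f : balls m A ⟶ balls m B} {n : N.obj B ⟶ N.obj A}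
    (hf : N.toTruncRightModule.Acts f n) : N.Acts (addAnti.map f) n := by
  have h : (Nat.card (Ins Unit () A) : ℕ∞) ≤ k := by
    rw [Nat.card_congr (Ins.leftUnit A)]
    exact A.card_le
  refine ⟨A, Unit, inferInstance, (), h, Ins.leftUnit A, 𝟙 _, f, n, hf, ?_, ?_⟩
  · have := addAnti_one_lMor (m := m) (B := A)
    rw [← Category.assoc, this, Category.id_comp]
  · have := N.lact_one A h
    exact (Category.comp_id n).symm.trans (congrArg (n ≫ ·) this.symm)

lemma acts_lMor {A' : Type} [Finite A'] (a : A') (C : FinLE k)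
    (h : (Nat.card (Ins A' a C) : ℕ∞) ≤ k) (o : balls m A' ⟶ balls m Unit) :
    N.Acts (A := ⟨Ins A' a C, h⟩) (lMor o a C) (N.lact a C h o) := by
  refine ⟨C, A', inferInstance, a, h, Equiv.refl _, o, 𝟙 _, 𝟙 _, ?_, ?_, ?_⟩
  · rw [← N.map_refl]
    exact TruncRightModule.Acts.iso (Equiv.refl C)
  · rw [Equiv.refl_symm, ballsMap_refl, CategoryTheory.Functor.map_id,
      CategoryTheory.Functor.map_id, Category.comp_id, Category.id_comp]
  · rw [N.map_refl, Category.comp_id, Category.id_comp]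

lemma Acts.precomp {A A₁ B : FinLE k} {f : ballsAndAntiball m A ⟶ ballsAndAntiball m B}
    {n : N.obj B ⟶ N.obj A} (hn : N.Acts f n) (i : A₁ ≃ A) :
    N.Acts (A := A₁) (addAnti.map (ballsMap i) ≫ f) (n ≫ N.map i.symm) := by
  obtain ⟨C, A', _, a, h, e, o, w, nw, hw, rfl, rfl⟩ := hn
  refine ⟨C, A', inferInstance, a, h, e.trans i.symm, o, w, nw, hw, ?_, ?_⟩
  · rw [← Category.assoc, ← Functor.map_comp]
    rfl
  · simp only [Category.assoc]
    rw [← N.map_trans]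

lemma Acts.comp_isAct {A X B : FinLE k} {f : ballsAndAntiball m X ⟶ ballsAndAntiball m B}
    {n : N.obj B ⟶ N.obj X} (hn : N.Acts f n) {x : X} {w : balls m A ⟶ balls m X}
    {nw : N.obj X ⟶ N.obj A} (hw : N.IsAct x w nw) : N.Acts (addAnti.map w ≫ f) (n ≫ nw) := by
  obtain ⟨C, A', _, a, h, e, o, g, ng, hg, rfl, rfl⟩ := hn
  obtain ⟨Q, _, q, hq, e', rfl, rfl⟩ := hw
  obtain ⟨i, rfl⟩ := e.surjective x
  have h1 : insMor (e i) q ≫ ballsMap e.symm =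
      ballsMap (Ins.congr e i (Equiv.refl Q)).symm ≫ insMor i q :=
    (ballsMap_insMor e i (Equiv.refl Q) q).symm
  have h2 : (Nat.card (Ins (Ins A' a C) i Q) : ℕ∞) ≤ k := by
    rw [Nat.card_congr (Ins.congr e i (Equiv.refl Q))]
    exact hq
  have h3 := TruncRightModule.act_map_refl (N := N.toTruncRightModule) (X := ⟨Ins A' a C, h⟩)
    (X' := X) e i q h2 hq
  have h4 : N.map (A := ⟨Ins A' a C, h⟩) e ≫ N.act X (e i) hq q ≫ N.map (A := X.ins (e i) Q hq) e' =
      N.act ⟨Ins A' a C, h⟩ i h2 q ≫ N.map (A := ⟨_, h2⟩) (B := A)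
        ((Ins.congr e i (Equiv.refl Q)).trans e') := by
    refine Eq.trans ?_ (congrArg (N.act ⟨Ins A' a C, h⟩ i h2 q ≫ ·)
      (N.map_trans (A := ⟨_, h2⟩) (B := X.ins (e i) Q hq) (C := A) _ _).symm)
    rw [← Category.assoc, ← h3, Category.assoc]
  have h5 : ∀ {Y : SM m} (t : ballsAndAntiball m (Ins A' a C) ⟶ Y),
      addAnti.map (ballsMap e'.symm ≫ insMor (e i) q) ≫ addAnti.map (ballsMap e.symm) ≫ t =
      addAnti.map (ballsMap ((Ins.congr e i (Equiv.refl Q)).trans e').symm) ≫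
        addAnti.map (insMor i q) ≫ t := fun t => by
    rw [← Category.assoc, ← Category.assoc, ← Functor.map_comp, ← Functor.map_comp,
      Category.assoc, h1]
    rfl
  set F := (Ins.congr e i (Equiv.refl Q)).trans e'
  rw [h5]
  simp only [Category.assoc]
  rw [h4]
  clear_value F
  -- A ball outside C: the insertion is absorbed into the left operation o by `lact_act_comm`. A
  -- ball of C: it passes through o by `lact_act` and joins the embedding g.
  rcases i with ⟨a', ha'⟩ | c
  · have h6 : (Nat.card (Ins (Ins A' a' Q) (.inl ⟨a, ha'.symm⟩) C) : ℕ∞) ≤ k := by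
      rw [Nat.card_congr (Ins.comm A' a' a ha' Q C)]
      exact h2
    refine ⟨C, Ins A' a' Q, inferInstance, .inl ⟨a, ha'.symm⟩, h6,
      (Ins.comm A' a' a ha' Q C).trans F, insMor a' q ≫ o, g, ng, hg, ?_, ?_⟩
    · have h7 := addAnti_lMor_comm (C := C) a' a ha' o q
      rw [← Category.assoc (addAnti.map (insMor _ q)), ← h7, Category.assoc, ← Category.assoc,
        ← Functor.map_comp]
      rfl
    · have h7 := N.lact_act_comm C a' a ha' h h2 h6 o q
      refine congrArg (ng ≫ ·) ?_
      refine (Category.assoc _ _ _).symm.trans ((congrArg (· ≫ N.map (A := ⟨_, h2⟩) (B := A) F)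
        h7.symm).trans ((Category.assoc _ _ _).trans ?_))
      rw [← N.map_trans]
      rfl
  · have h6 : (Nat.card (Ins A' a (Ins C c Q)) : ℕ∞) ≤ k := by
      rw [← Nat.card_congr (Ins.assoc A' a C c Q)]
      exact h2
    have h7 : (Nat.card (Ins C c Q) : ℕ∞) ≤ k := le_trans (by
      exact_mod_cast Nat.card_le_card_of_injective (Sum.inr : _ → Ins A' a (Ins C c Q))
        Sum.inr_injective) h6
    refine ⟨C.ins c Q h7, A', inferInstance, a, h6, (Ins.assoc A' a C c Q).symm.trans F, o,
      insMor c q ≫ g, ng ≫ N.act C c h7 q,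
      hg.comp_isAct (TruncRightModule.isAct_act c h7 q), ?_, ?_⟩
    · have h8 := addAnti_lMor_insMor a c o q
      rw [Functor.map_comp, ← Category.assoc (lMor _ _ _), ← h8]
      simp only [← Category.assoc, ← Functor.map_comp]
      rw [ballsMap_symm_comp]
    · have h8 := N.lact_act C a c h h2 h7 h6 o q
      simp only [Category.assoc]
      refine congrArg (ng ≫ ·) ?_
      refine Eq.trans ?_ ((congrArg (· ≫ N.map (A := ⟨_, h6⟩) (B := A)
        ((Ins.assoc A' a C c Q).symm.trans F)) h8).trans (Category.assoc _ _ _))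
      simp only [Category.assoc]
      rw [← N.map_trans, trans_symm_trans]

lemma Acts.comp_acts {A X B : FinLE k} {f : ballsAndAntiball m X ⟶ ballsAndAntiball m B}
    {n : N.obj B ⟶ N.obj X} (hn : N.Acts f n) {w : balls m A ⟶ balls m X}
    {nw : N.obj X ⟶ N.obj A} (hw : N.toTruncRightModule.Acts w nw) :
    N.Acts (addAnti.map w ≫ f) (n ≫ nw) := by
  induction hw with
  | iso e => exact hn.precomp e
  | step x hv hw hc ha ih =>
    rw [Functor.map_comp, Category.assoc, ← Category.assoc n]
    exact (ih hn).comp_isAct hw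

/-- Associativity of the left action fuses the two left operations into one. -/
lemma Acts.comp_lMor {X B : FinLE k} {f : ballsAndAntiball m X ⟶ ballsAndAntiball m B}
    {n : N.obj B ⟶ N.obj X} (hn : N.Acts f n) {A : Type} [Finite A] (a : A)
    (h : (Nat.card (Ins A a X) : ℕ∞) ≤ k) (o : balls m A ⟶ balls m Unit) :
    N.Acts (A := ⟨Ins A a X, h⟩) (lMor o a X ≫ f) (n ≫ N.lact a X h o) := by
  obtain ⟨C, A', _, a', h', e, o', g, ng, hg, rfl, rfl⟩ := hn
  have h1 : (Nat.card (Ins A a (Ins A' a' C)) : ℕ∞) ≤ k := by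
    rw [Nat.card_congr (Ins.congr (Equiv.refl A) a e)]
    exact h
  have h2 : (Nat.card (Ins (Ins A a A') (.inr a') C) : ℕ∞) ≤ k := by
    rw [Nat.card_congr (Ins.assoc A a A' a' C)]
    exact h1
  obtain ⟨E, hE⟩ : ∃ E : Ins A a (Ins A' a' C) ≃ Ins A a X,
    E = Ins.congr (Equiv.refl A) a e := ⟨_, rfl⟩
  refine ⟨C, Ins A a A', inferInstance, .inr a', h2, (Ins.assoc A a A' a' C).trans E,
    insMor a o' ≫ o, g, ng, hg, ?_, ?_⟩
  · have h3 : addAnti.map (ballsMap E.symm) ≫ lMor o a (Ins A' a' C) =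
        lMor o a X ≫ addAnti.map (ballsMap e.symm) := by
      rw [hE]
      exact addAnti_lMor (Equiv.refl A) a e o
    dsimp only
    have h4 := addAnti_lMor_assoc (C := C) a a' o o'
    rw [← Category.assoc, ← h3, Category.assoc, ← Category.assoc (lMor _ _ _), ← h4,
      Category.assoc, ← Category.assoc, ← Functor.map_comp]
    rfl
  · have h3 : N.lact a ⟨Ins A' a' C, h'⟩ h1 o ≫ N.map (A := ⟨_, h1⟩) (B := ⟨Ins A a X, h⟩) E =
        N.map (A := ⟨Ins A' a' C, h'⟩) e ≫ N.lact a X h o := by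
      rw [hE]
      exact lact_map_eq (N := N) (C := ⟨Ins A' a' C, h'⟩) (C' := X) (Equiv.refl A) a e h1 h o
    have h4 := N.lact_assoc C a a' h' h1 h2 o o'
    simp only [Category.assoc]
    refine congrArg (ng ≫ ·) ?_
    refine (congrArg (N.lact a' C h' o' ≫ ·) h3.symm).trans ?_
    refine (Category.assoc _ _ _).symm.trans ((congrArg (· ≫ N.map (A := ⟨_, h1⟩)
      (B := ⟨Ins A a X, h⟩) E) h4.symm).trans ((Category.assoc _ _ _).trans ?_))
    exact congrArg (N.lact (Sum.inr a' : Ins A a A') C h2 (insMor a o' ≫ o) ≫ ·)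
      (N.map_trans (A := ⟨_, h2⟩) (B := ⟨_, h1⟩) (C := ⟨_, h⟩) _ _).symm

/-- The first map is a bijection, a left operation and an embedding of balls in succession; the
action is closed under precomposition with each. -/
lemma Acts.comp {A B C : FinLE k} {f : ballsAndAntiball m A ⟶ ballsAndAntiball m B}
    {g : ballsAndAntiball m B ⟶ ballsAndAntiball m C} {n : N.obj B ⟶ N.obj A}
    {n' : N.obj C ⟶ N.obj B} (hn : N.Acts f n) (hn' : N.Acts g n') :
    N.Acts (f ≫ g) (n' ≫ n) := by
  obtain ⟨C, A', _, a, h, e, o, w, nw, hw, rfl, rfl⟩ := hn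
  have := ((hn'.comp_acts hw).comp_lMor a h o).precomp e.symm
  simpa only [Category.assoc, Equiv.symm_symm] using this

end TruncWeakBimodule

/-! ### The functor of a weak bimodule, and the equivalence for weak bimodules. -/

namespace TruncWeakBimodule

variable {m : ℕ} {k : ℕ∞} {D : Type u} [Category.{v} D]
  {N : TruncWeakBimodule (littleBalls m) k D}

lemma acts_id (A : FinLE k) : N.Acts (𝟙 (ballsAndAntiball m A)) (𝟙 (N.obj A)) := by
  have := acts_addAnti (N := N) (TruncRightModule.Acts.iso (Equiv.refl A))
  rwa [ballsMap_refl, CategoryTheory.Functor.map_id, Equiv.refl_symm, N.map_refl] at this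

variable (N) in
/-- The contravariant functor given by a truncated weak bimodule over the little balls operad. -/
noncomputable def toFunctor : (AntiballCat m k)ᵒᵖ ⥤ D where
  obj A := N.obj A.unop
  map f := (exists_acts (N := N) f.unop.hom).choose
  map_id A := (exists_acts (N := N) (𝟙 A : A ⟶ A).unop.hom).choose_spec.unique (acts_id A.unop)
  map_comp f g := (exists_acts (N := N) (f ≫ g).unop.hom).choose_spec.unique
    ((exists_acts (N := N) g.unop.hom).choose_spec.comp
      (exists_acts (N := N) f.unop.hom).choose_spec)

lemma toFunctor_map {A B : FinLE k} {f : ballsAndAntiball m A ⟶ ballsAndAntiball m B}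
    {n : N.obj B ⟶ N.obj A} (h : N.Acts f n) : N.toFunctor.map (antiballHom f).op = n :=
  (exists_acts (N := N) f).choose_spec.unique h

lemma toFunctor_map_addAnti {A B : FinLE k} {f : balls m A ⟶ balls m B}
    {n : N.obj B ⟶ N.obj A} (h : N.toTruncRightModule.Acts f n) :
    N.toFunctor.map (antiballHom (A := A) (B := B) (addAnti.map f)).op = n :=
  toFunctor_map (acts_addAnti h)

lemma Hom.exists_acts {N' : TruncWeakBimodule (littleBalls m) k D} (τ : N ⟶ N') {A B : FinLE k}
    {f : ballsAndAntiball m A ⟶ ballsAndAntiball m B} {n : N.obj B ⟶ N.obj A} (h : N.Acts f n) :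
    ∃ n', N'.Acts f n' ∧ n ≫ (Hom.right τ).app A = (Hom.right τ).app B ≫ n' := by
  obtain ⟨C, A', _, a, h, e, o, w, nw, hw, rfl, rfl⟩ := h
  obtain ⟨nw', hw', h1⟩ := TruncRightModule.Hom.exists_acts (Hom.right τ) hw
  refine ⟨_, ⟨C, A', inferInstance, a, h, e, o, w, nw', hw', rfl, rfl⟩, ?_⟩
  have h2 : N.lact a C h o ≫ (Hom.right τ).app ⟨Ins A' a C, h⟩ =
    (Hom.right τ).app C ≫ N'.lact a C h o := Hom.lact_app τ a C h o
  have h3 := TruncRightModule.Hom.map_app (Hom.right τ) (A := ⟨Ins A' a C, h⟩) (B := A) e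
  simp only [Category.assoc]
  rw [h3]
  refine (congrArg (nw ≫ ·) ((Category.assoc _ _ _).symm.trans
    ((congrArg (· ≫ N'.map (A := ⟨Ins A' a C, h⟩) e) h2).trans (Category.assoc _ _ _)))).trans ?_
  rw [← Category.assoc nw, h1, Category.assoc]

lemma toWeakBimodule_right_acts (G : (AntiballCat m k)ᵒᵖ ⥤ D) {A B : FinLE k}
    {f : balls m A ⟶ balls m B}
    {n : ((toWeakBimodule m k D).obj G).obj B ⟶ ((toWeakBimodule m k D).obj G).obj A}
    (h : ((toWeakBimodule m k D).obj G).toTruncRightModule.Acts f n) :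
    n = G.map (antiballHom (A := A) (B := B) (addAnti.map f)).op :=
  TruncRightModule.toRightModule_acts ((addAntiball m k).op ⋙ G) h

lemma toWeakBimodule_acts (G : (AntiballCat m k)ᵒᵖ ⥤ D) {A B : FinLE k}
    {f : ballsAndAntiball m A ⟶ ballsAndAntiball m B}
    {n : ((toWeakBimodule m k D).obj G).obj B ⟶ ((toWeakBimodule m k D).obj G).obj A}
    (h : ((toWeakBimodule m k D).obj G).Acts f n) : n = G.map (antiballHom f).op := by
  obtain ⟨C, A', _, a, h, e, o, w, nw, hw, rfl, rfl⟩ := h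
  rw [toWeakBimodule_right_acts G hw]
  refine (congrArg (G.map (antiballHom (A := C) (B := B) (addAnti.map w)).op ≫ ·)
    (G.map_comp _ _).symm).trans ((G.map_comp _ _).symm.trans ?_)
  refine congrArg (fun f => G.map (antiballHom (A := A) (B := B) f).op) ?_
  exact Category.assoc _ _ _

lemma Hom.naturality {G H : (AntiballCat m k)ᵒᵖ ⥤ D}
    (τ : (toWeakBimodule m k D).obj G ⟶ (toWeakBimodule m k D).obj H) {A B : (AntiballCat m k)ᵒᵖ}
    (f : A ⟶ B) : G.map f ≫ (Hom.right τ).app B.unop = (Hom.right τ).app A.unop ≫ H.map f := by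
  obtain ⟨n, hn⟩ := TruncWeakBimodule.exists_acts (N := (toWeakBimodule m k D).obj G) f.unop.hom
  obtain ⟨n', hn', h⟩ := Hom.exists_acts τ hn
  rw [toWeakBimodule_acts G hn, toWeakBimodule_acts H hn'] at h
  exact h

/-- A truncated weak bimodule over the little balls operad is isomorphic to the one given by its
contravariant functor. -/
noncomputable def toFunctorIso : (toWeakBimodule m k D).obj N.toFunctor ≅ N where
  hom :=
    { right :=
        { app := fun _ => 𝟙 _
          map_app := fun e => (Category.comp_id _).trans
            ((toFunctor_map_addAnti (TruncRightModule.acts_map e)).trans (Category.id_comp _).symm)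
          act_app := fun _ a _ _ h p => (Category.comp_id _).trans
            ((toFunctor_map_addAnti (TruncRightModule.Acts.of_isAct
              (TruncRightModule.isAct_act a h p))).trans (Category.id_comp _).symm) }
      lact_app := fun a B h o => (Category.comp_id _).trans
        ((toFunctor_map (acts_lMor a B h o)).trans (Category.id_comp _).symm) }
  inv :=
    { right :=
        { app := fun _ => 𝟙 _
          map_app := fun e => (Category.comp_id _).trans
            ((toFunctor_map_addAnti (TruncRightModule.acts_map e)).symm.trans
              (Category.id_comp _).symm)
          act_app := fun _ a _ _ h p => (Category.comp_id _).trans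
            ((toFunctor_map_addAnti (TruncRightModule.Acts.of_isAct
              (TruncRightModule.isAct_act a h p))).symm.trans (Category.id_comp _).symm) }
      lact_app := fun a B h o => (Category.comp_id _).trans
        ((toFunctor_map (acts_lMor a B h o)).symm.trans (Category.id_comp _).symm) }
  hom_inv_id := Hom.ext (TruncRightModule.Hom.ext (funext fun _ => Category.comp_id _))
  inv_hom_id := Hom.ext (TruncRightModule.Hom.ext (funext fun _ => Category.comp_id _))

end TruncWeakBimodule

instance toWeakBimodule_isEquivalence (m : ℕ) (k : ℕ∞) (D : Type u) [Category.{v} D] :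
    (toWeakBimodule m k D).IsEquivalence where
  faithful := ⟨fun h => NatTrans.ext (funext fun A =>
    congrArg (fun f => (TruncWeakBimodule.Hom.right f).app A.unop) h)⟩
  full := ⟨fun τ => ⟨⟨fun A => (TruncWeakBimodule.Hom.right τ).app A.unop,
    fun _ _ f => TruncWeakBimodule.Hom.naturality τ f⟩, rfl⟩⟩
  essSurj := ⟨fun N => ⟨N.toFunctor, ⟨TruncWeakBimodule.toFunctorIso⟩⟩⟩

/-! ### Transfer of derived maps from functors to modules. -/

section Modules

variable {D : Type u} [Category.{v} D] {m : ℕ} {k : ℕ∞}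

/-- The evaluation of truncated right modules at a finite set. -/
def TruncRightModule.evaluation (O : SetOperad) (A : FinLE k) : TruncRightModule O k D ⥤ D where
  obj N := N.obj A
  map f := TruncRightModule.Hom.app f A

/-- The underlying right module of a weak bimodule. -/
def TruncWeakBimodule.forget (O : SetOperad) : TruncWeakBimodule O k D ⥤ TruncRightModule O k D where
  obj N := N.toTruncRightModule
  map f := TruncWeakBimodule.Hom.right f

variable [ModelCategory D]

lemma rightModuleWeq_respectsIso (O : SetOperad) : (rightModuleWeq D O k).RespectsIso :=
  MorphismProperty.RespectsIso.mk _
    (fun e f hf A => (MorphismProperty.cancel_left_of_respectsIso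
      ((weakEquivalences D).inverseImage (TruncRightModule.evaluation O A)) e.hom f).2 (hf A))
    (fun e f hf A => (MorphismProperty.cancel_right_of_respectsIso
      ((weakEquivalences D).inverseImage (TruncRightModule.evaluation O A)) f e.hom).2 (hf A))

lemma weakBimoduleWeq_respectsIso (O : SetOperad) : (weakBimoduleWeq D O k).RespectsIso :=
  have := rightModuleWeq_respectsIso (D := D) (k := k) O
  inferInstanceAs ((rightModuleWeq D O k).inverseImage (TruncWeakBimodule.forget O)).RespectsIso

lemma functorCategory_eq_inverseImage_toRightModule :
    (weakEquivalences D).functorCategory (BallCat m k)ᵒᵖ =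
      (rightModuleWeq D (littleBalls m) k).inverseImage (toRightModule m k D) := by
  ext F G τ
  exact ⟨fun h A => h (.op A), fun h A => h A.unop⟩

lemma functorCategory_eq_inverseImage_toWeakBimodule :
    (weakEquivalences D).functorCategory (AntiballCat m k)ᵒᵖ =
      (weakBimoduleWeq D (littleBalls m) k).inverseImage (toWeakBimodule m k D) := by
  ext F G τ
  exact ⟨fun h A => h (.op A), fun h A => h A.unop⟩

variable [HasCoproducts.{0} D] {I : Type*} [Category I]

/-- Derived maps of functors on `ᵟF_k(B_m)` are derived maps of right modules. -/
noncomputable def rightModuleNatHomEquiv (X : (BallCat m k)ᵒᵖ ⥤ Type)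
    (G : I ⥤ (BallCat m k)ᵒᵖ ⥤ D) :
    NatHomEquiv (CofibrantObject.ι ⋙ diagTensor X ⋙ diagQ (D := D) _) (G ⋙ diagQ _)
      (CofibrantObject.ι ⋙ ((toRightModule m k Type).obj X).tensor ⋙
        (rightModuleWeq D (littleBalls m) k).Q)
      (G ⋙ toRightModule m k D ⋙ (rightModuleWeq D (littleBalls m) k).Q) :=
  -- The module of the functor X ⊗ d is, by definition, the copower by d of the module of X.
  homEquivOfEquivalence (toRightModule m k D) functorCategory_eq_inverseImage_toRightModule
    (rightModuleWeq_respectsIso _) (CofibrantObject.ι ⋙ diagTensor X) G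

/-- Derived maps of functors on `ᵟΓ̃_k(B_m)` are derived maps of weak bimodules. -/
noncomputable def weakBimoduleNatHomEquiv (X : (AntiballCat m k)ᵒᵖ ⥤ Type)
    (G : I ⥤ (AntiballCat m k)ᵒᵖ ⥤ D) :
    NatHomEquiv (CofibrantObject.ι ⋙ diagTensor X ⋙ diagQ (D := D) _) (G ⋙ diagQ _)
      (CofibrantObject.ι ⋙ ((toWeakBimodule m k Type).obj X).tensor ⋙
        (weakBimoduleWeq D (littleBalls m) k).Q)
      (G ⋙ toWeakBimodule m k D ⋙ (weakBimoduleWeq D (littleBalls m) k).Q) :=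
  homEquivOfEquivalence (toWeakBimodule m k D) functorCategory_eq_inverseImage_toWeakBimodule
    (weakBimoduleWeq_respectsIso _) (CofibrantObject.ι ⋙ diagTensor X) G

end Modules

/-! ### Assembling the absolute and the compactly supported case. -/

section Comparison

variable {D : Type u} [Category.{v} D] [ModelCategory D] [HasCoproducts.{0} D] {m : ℕ}
  {S : Type → SM m} {j k : ℕ∞} (h : k ≤ j) (M : TopologicalSpace.Opens (Euc m))
  [(ev S k M).IsEquivalence]

/-- A comparison of derived maps of functors with derived maps in another category gives
descriptions of the Taylor approximations. -/
lemma taylor_comparison (c : CofibrantReplacement D) {E : Type*} [Category E] (tensor : D ⥤ E)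
    (W : MorphismProperty E) (G : ContextFree S j M D ⥤ E)
    (e : NatHomEquiv (CofibrantObject.ι ⋙ diagTensor (sEmb S k M) ⋙ diagQ (D := D) _)
      (ContextFree.modelAt h ⋙ diagQ _) (CofibrantObject.ι ⋙ tensor ⋙ W.Q) (G ⋙ W.Q)) :
    Nonempty (NatHomEquiv
      (CofibrantObject.ι ⋙ Functor.const (ImagePoset S k M)ᵒᵖ ⋙ diagQ (D := D) _)
      (ContextFree.fnAt (S := S) (M := M) (D := D) h ⋙ diagQ _)
      (CofibrantObject.ι ⋙ diagTensor (sEmb S k M) ⋙ diagQ (D := D) _)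
      (ContextFree.modelAt h ⋙ diagQ _)) ∧
    Nonempty (NatHomEquiv
      (CofibrantObject.ι ⋙ Functor.const (ImagePoset S k M)ᵒᵖ ⋙ diagQ (D := D) _)
      (ContextFree.fnAt (S := S) (M := M) (D := D) h ⋙ diagQ _)
      (CofibrantObject.ι ⋙ tensor ⋙ W.Q) (G ⋙ W.Q)) ∧
    (∀ T : ContextFree S j M D ⥤ Ho D,
      (Nonempty (ContextFree.TaylorData h T) ↔ Nonempty (ContextFree.HNatData h T)) ∧
      (Nonempty (ContextFree.TaylorData h T) ↔ Nonempty (DerivedMapData tensor W G T))) ∧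
    (∀ T N R : ContextFree S j M D ⥤ Ho D,
      Nonempty (ContextFree.TaylorData h T) → Nonempty (ContextFree.HNatData h N) →
      Nonempty (DerivedMapData tensor W G R) → Nonempty (T ≅ N) ∧ Nonempty (T ≅ R)) := by
  let e₀ := taylorNatHomEquiv (S := S) (M := M) (D := D) h c
  have h1 := nonempty_taylorData_iff h c (diagTensor (sEmb S k M)) _ (ContextFree.modelAt h) e₀
  have h2 := nonempty_taylorData_iff h c tensor W G (e₀.trans e)
  refine ⟨⟨e₀⟩, ⟨e₀.trans e⟩, fun T => ⟨h1 T, h2 T⟩, fun T N R ⟨t⟩ n r => ?_⟩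
  obtain ⟨n⟩ := (h1 N).2 n
  obtain ⟨r⟩ := (h2 R).2 r
  exact ⟨nonempty_iso_of_taylorData h t n, nonempty_iso_of_taylorData h t r⟩

end Comparison

end EmbCalc

theorem mainTheorem10 (m : ℕ) (D : Type u) [Category.{v} D] [ModelCategory D]
    [HasCoproducts.{0} D]
    [(cofibrations D).HasFunctorialFactorization (trivialFibrations D)]
    (k j : ℕ∞) (h : k ≤ j) :
    -- contravariant functors on `ᵟF_j(B_m)` are right modules, and contravariant functors on
    -- `ᵟΓ̃_j(B_m)` are weak bimodules
    (toRightModule m j D).IsEquivalence ∧ (toWeakBimodule m j D).IsEquivalence ∧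
    -- context-free functors on `ᵟO^s_j(M)`
    (∀ M : TopologicalSpace.Opens (Euc m),
      Nonempty (NatHomEquiv
        (CofibrantObject.ι ⋙ Functor.const (BallPoset k M)ᵒᵖ ⋙ diagQ (D := D) _)
        (ContextFree.fnAt (S := balls m) (M := M) (D := D) h ⋙ diagQ _)
        (CofibrantObject.ι ⋙ diagTensor (sEmb (balls m) k M) ⋙ diagQ (D := D) _)
        (ContextFree.modelAt h ⋙ diagQ _)) ∧
      Nonempty (NatHomEquiv
        (CofibrantObject.ι ⋙ Functor.const (BallPoset k M)ᵒᵖ ⋙ diagQ (D := D) _)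
        (ContextFree.fnAt (S := balls m) (M := M) (D := D) h ⋙ diagQ _)
        (CofibrantObject.ι ⋙ ((toRightModule m k Type).obj (sEmb (balls m) k M)).tensor ⋙
          (rightModuleWeq D (littleBalls m) k).Q)
        (ContextFree.modelAt h ⋙ toRightModule m k D ⋙
          (rightModuleWeq D (littleBalls m) k).Q)) ∧
      (∀ T : ContextFree (balls m) j M D ⥤ Ho D,
        (Nonempty (ContextFree.TaylorData h T) ↔ Nonempty (ContextFree.HNatData h T)) ∧
        (Nonempty (ContextFree.TaylorData h T) ↔ Nonempty (ContextFree.HRmodData h T))) ∧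
      (∀ T N R : ContextFree (balls m) j M D ⥤ Ho D,
        Nonempty (ContextFree.TaylorData h T) → Nonempty (ContextFree.HNatData h N) →
        Nonempty (ContextFree.HRmodData h R) → Nonempty (T ≅ N) ∧ Nonempty (T ≅ R))) ∧
    -- context-free functors on `ᵟÕ^s_j(ℝᵐ)`
    (Nonempty (NatHomEquiv
        (CofibrantObject.ι ⋙ Functor.const (AntiballPoset m k)ᵒᵖ ⋙ diagQ (D := D) _)
        (ContextFree.fnAt (S := ballsAndAntiball m) (M := ⊤) (D := D) h ⋙ diagQ _)
        (CofibrantObject.ι ⋙ diagTensor (sEmb (ballsAndAntiball m) k ⊤) ⋙ diagQ (D := D) _)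
        (ContextFree.modelAt h ⋙ diagQ _)) ∧
      Nonempty (NatHomEquiv
        (CofibrantObject.ι ⋙ Functor.const (AntiballPoset m k)ᵒᵖ ⋙ diagQ (D := D) _)
        (ContextFree.fnAt (S := ballsAndAntiball m) (M := ⊤) (D := D) h ⋙ diagQ _)
        (CofibrantObject.ι ⋙
          ((toWeakBimodule m k Type).obj (sEmb (ballsAndAntiball m) k ⊤)).tensor ⋙
          (weakBimoduleWeq D (littleBalls m) k).Q)
        (ContextFree.modelAt h ⋙ toWeakBimodule m k D ⋙
          (weakBimoduleWeq D (littleBalls m) k).Q)) ∧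
      (∀ T : ContextFree (ballsAndAntiball m) j ⊤ D ⥤ Ho D,
        (Nonempty (ContextFree.TaylorData h T) ↔ Nonempty (ContextFree.HNatData h T)) ∧
        (Nonempty (ContextFree.TaylorData h T) ↔ Nonempty (ContextFree.HWBimodData h T))) ∧
      (∀ T N R : ContextFree (ballsAndAntiball m) j ⊤ D ⥤ Ho D,
        Nonempty (ContextFree.TaylorData h T) → Nonempty (ContextFree.HNatData h N) →
        Nonempty (ContextFree.HWBimodData h R) → Nonempty (T ≅ N) ∧ Nonempty (T ≅ R))) := by
  obtain ⟨c⟩ := nonempty_cofibrantReplacement D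
  exact ⟨inferInstance, inferInstance,
    fun M => taylor_comparison (S := balls m) h M c
      ((toRightModule m k Type).obj (sEmb (balls m) k M)).tensor (rightModuleWeq D (littleBalls m) k)
      (ContextFree.modelAt h ⋙ toRightModule m k D) (rightModuleNatHomEquiv _ _),
    taylor_comparison (S := ballsAndAntiball m) h ⊤ c
      ((toWeakBimodule m k Type).obj (sEmb (ballsAndAntiball m) k ⊤)).tensor
      (weakBimoduleWeq D (littleBalls m) k) (ContextFree.modelAt h ⋙ toWeakBimodule m k D)
      (weakBimoduleNatHomEquiv _ _)⟩
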